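/- Let $0<\overline\alpha<\underline\beta$ and let $F\in C^5(0,\infty)$ satisfy $F''>0$ on $(0,\overline\alpha)\cup(\underline\beta,\infty)$, $F''<0$ on $(\overline\alpha,\underline\beta)$, $F'(0)<F'(\underline\beta)$ and $F'(\infty)>F'(\overline\alpha)$, where $F'(0)$ and $F'(\infty)$ denote the (possibly infinite) limits of $F'$ at $0^+$ and $+\infty$. Put $\Phi_\sigma(z)=F(z)-\sigma z$, $\underline\sigma=F'(\underline\beta)$, $\overline\sigma=F'(\overline\alpha)$. For $\sigma\in[\underline\sigma,\overline\sigma]$ let $\alpha_\sigma\in(0,\overline\alpha]$, $\zeta_\sigma\in[\overline\alpha,\underline\beta]$, $\beta_\sigma\in[\underline\beta,\infty)$ be the critical points of $\Phi_\sigma$, let $\sigma_0\in(\underline\sigma,\overline\sigma)$ be the value with $\Phi_{\sigma_0}(\alpha_{\sigma_0})=\Phi_{\sigma_0}(\beta_{\sigma_0})=:b_0$, and let $\Delta_0=(\sigma_0,b_0)$ (the Maxwell point). Let $$\Sigma=\{\Delta=(\sigma,b):\ \underline\sigma<\sigma<\overline\sigma,\ \max\{\Phi_\sigma(\alpha_\sigma),\Phi_\sigma(\beta_\sigma)\}<b<\Phi_\sigma(\zeta_\sigma)\}$$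 be the set of admissible pairs, and let $$\partial_1\Sigma=\{(\sigma,\Phi_\sigma(\alpha_\sigma)):\sigma_0\le\sigma<\overline\sigma\},\qquad \partial_2\Sigma=\{(\sigma,\Phi_\sigma(\beta_\sigma)):\underline\sigma<\sigma\le\sigma_0\}.$$ For $\Delta=(\sigma,b)\in\overline\Sigma$ let $z_1(\Delta)\in[\alpha_\sigma,\zeta_\sigma]$ and $z_2(\Delta)\in[\zeta_\sigma,\beta_\sigma]$ be the solutions of $\Phi_\sigma(z)=b$, and put $f_\Delta(z)=\Phi_\sigma(z)-b$, $\pi_1(\Delta)=b-\Phi_\sigma(\alpha_\sigma)$, $\pi_2(\Delta)=b-\Phi_\sigma(\beta_\sigma)$, $\pi=(\pi_1,\pi_2)$, $\mathcal F_i=\{\Delta\in\overline\Sigma: F''(z_i(\Delta))>0\}$ and $\mathcal Q_i(\Delta)=[2F''(z_i(\Delta))]^{-1/2}$ on $\mathcal F_i$. Let $0<\varepsilon<[\Phi_{\sigma_0}(\zeta_{\sigma_0})-\Phi_{\sigma_0}(\beta_{\sigma_0})]^{-1/2}$ and, for $n\in\{0,1\}$ and $\Delta\in\Sigma$, $$I_n(\Delta)=I_n(\Delta;\varepsilon)=\int_{z_1(\Delta)}^{z_2(\Delta)}\frac{(1-\varepsilon^2f_\Delta(z))\,z^n}{\sqrt{f_\Delta(z)\,(2-\varepsilon^2f_\Delta(z))}}\,dz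 .$$ If $\Omega\subset\overline\Sigma$ is a neighbourhood of $\Delta_0$ in $\overline\Sigma$, then $NR(\Omega)$ denotes the set of $\varphi\in C(\Omega)$ such that $\psi=\varphi\circ\pi^{-1}$ is nearly regular at $h=0$; that is, with $\mathcal H=\pi(\Sigma)$, there are $s<1$ and an open $U\ni 0$ in $\mathbb R^2$ such that $\psi$ is continuous on $U\cap\overline{\mathcal H}$ and $C^1$ on $U\cap\mathcal H$, and, as $h\to0$, $\psi(h)=\psi(0)+O(|h|^{1-s})$ in $\overline{\mathcal H}$ and $\partial\psi/\partial h_i=O(h_i^{-s})$, $i=1,2$, in $\mathcal H$. Then, for $n=0,1$, the integral $I_n(\Delta)$ converges absolutely for every $\Delta\in\Sigma$, and: 1. if $\Omega_1\subset\mathcal F_1\setminus\partial_2\Sigma$ is closed, then $I_n+\frac1{\sqrt2}\mathcal Q_1z_1^n\ln\pi_1$, defined on $\Omega_1\cap\Sigma$, extends to a function in $C(\Omega_1)$; 2. if $\Omega_2\subset\mathcal F_2\setminus\partial_1\Sigma$ is closed, then $I_n+\frac1{\sqrt2}\mathcal Q_2z_2^n\ln\pi_2$, defined on $\Omega_2\cap\Sigma$,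 extends to a function in $C(\Omega_2)$; 3. if $\Omega_0\subset\mathcal F_1\cap\mathcal F_2$ is closed, then $I_n+\frac1{\sqrt2}\mathcal Q_1z_1^n\ln\pi_1+\frac1{\sqrt2}\mathcal Q_2z_2^n\ln\pi_2$, defined on $\Omega_0\cap\Sigma$, extends to a function in $C(\Omega_0)$, which belongs to $NR(\Omega_0)$ if $\Omega_0$ is a neighbourhood of $\Delta_0$ in $\overline\Sigma$. -/

import Mathlib

open Set Filter Topology MeasureTheory Asymptotics

noncomputable section

/-- The assumptions on the free energy `F : (0,∞) → ℝ` (values of `F` outside `(0,∞)` are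
irrelevant).  `F'(0)` and `F'(∞)` are the limits of `F'` at `0⁺` and `+∞`, possibly infinite. -/
structure IsFreeEnergy (F : ℝ → ℝ) (αbar βbar : ℝ) : Prop where
  alpha_pos : 0 < αbar
  alpha_lt_beta : αbar < βbar
  contDiffOn : ContDiffOn ℝ 5 F (Ioi 0)
  convex_left : ∀ z ∈ Ioo 0 αbar, 0 < deriv (deriv F) z
  concave_mid : ∀ z ∈ Ioo αbar βbar, deriv (deriv F) z < 0
  convex_right : ∀ z ∈ Ioi βbar, 0 < deriv (deriv F) z
  slope_zero : ∃ L : EReal, Tendsto (fun z : ℝ => ((deriv F z : ℝ) : EReal)) (𝓝[>] 0) (𝓝 L) ∧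
    L < ((deriv F βbar : ℝ) : EReal)
  slope_infty : ∃ L : EReal, Tendsto (fun z : ℝ => ((deriv F z : ℝ) : EReal)) atTop (𝓝 L) ∧
    ((deriv F αbar : ℝ) : EReal) < L

/-- The Gibbs function `Φ_σ(z) = F(z) - σ z`. -/
def gibbs (F : ℝ → ℝ) (σ z : ℝ) : ℝ := F z - σ * z

/-- The lower end `F'(β̲)` of the range of `σ`. -/
def sigmaLow (F : ℝ → ℝ) (βbar : ℝ) : ℝ := deriv F βbar

/-- The upper end `F'(ᾱ)` of the range of `σ`. -/
def sigmaUp (F : ℝ → ℝ) (αbar : ℝ) : ℝ := deriv F αbar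

/-- `α_σ`: the critical point of `Φ_σ` in `(0, ᾱ]`, for `σ` in `[sigmaLow, sigmaUp]`. -/
def critAlpha (F : ℝ → ℝ) (αbar σ : ℝ) : ℝ := Function.invFunOn (deriv F) (Ioc 0 αbar) σ

/-- `ζ_σ`: the critical point of `Φ_σ` in `[ᾱ, β̲]`, for `σ` in `[sigmaLow, sigmaUp]`. -/
def critZeta (F : ℝ → ℝ) (αbar βbar σ : ℝ) : ℝ := Function.invFunOn (deriv F) (Icc αbar βbar) σ

/-- `β_σ`: the critical point of `Φ_σ` in `[β̲, ∞)`, for `σ` in `[sigmaLow, sigmaUp]`. -/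
def critBeta (F : ℝ → ℝ) (βbar σ : ℝ) : ℝ := Function.invFunOn (deriv F) (Ici βbar) σ

/-- `σ₀`: the value of `σ` for which the two wells of `Φ_σ` have equal depth. -/
def sigmaZero (F : ℝ → ℝ) (αbar βbar : ℝ) : ℝ :=
  Classical.epsilon fun σ => σ ∈ Ioo (sigmaLow F βbar) (sigmaUp F αbar) ∧
    gibbs F σ (critAlpha F αbar σ) = gibbs F σ (critBeta F βbar σ)

/-- The Maxwell point `Δ₀ = (σ₀, b₀)`. -/
def maxwellPoint (F : ℝ → ℝ) (αbar βbar : ℝ) : ℝ × ℝ :=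
  (sigmaZero F αbar βbar,
    gibbs F (sigmaZero F αbar βbar) (critAlpha F αbar (sigmaZero F αbar βbar)))

/-- `F̄ = [Φ_{σ₀}(ζ₀) - Φ_{σ₀}(β₀)]^{-1/2}`. -/
def epsMax (F : ℝ → ℝ) (αbar βbar : ℝ) : ℝ :=
  (gibbs F (sigmaZero F αbar βbar) (critZeta F αbar βbar (sigmaZero F αbar βbar)) -
    gibbs F (sigmaZero F αbar βbar) (critBeta F βbar (sigmaZero F αbar βbar))) ^ (-(1 / 2) : ℝ)

/-- The set `Σ` of admissible pairs `Δ = (σ, b)`. -/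
def admissible (F : ℝ → ℝ) (αbar βbar : ℝ) : Set (ℝ × ℝ) :=
  {Δ | Δ.1 ∈ Ioo (sigmaLow F βbar) (sigmaUp F αbar) ∧
    max (gibbs F Δ.1 (critAlpha F αbar Δ.1)) (gibbs F Δ.1 (critBeta F βbar Δ.1)) < Δ.2 ∧
    Δ.2 < gibbs F Δ.1 (critZeta F αbar βbar Δ.1)}

/-- The part `∂₁Σ` of the boundary of `Σ`. -/
def bdryOne (F : ℝ → ℝ) (αbar βbar : ℝ) : Set (ℝ × ℝ) :=
  {Δ | Δ.2 = gibbs F Δ.1 (critAlpha F αbar Δ.1) ∧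
    Δ.1 ∈ Ico (sigmaZero F αbar βbar) (sigmaUp F αbar)}

/-- The part `∂₂Σ` of the boundary of `Σ`. -/
def bdryTwo (F : ℝ → ℝ) (αbar βbar : ℝ) : Set (ℝ × ℝ) :=
  {Δ | Δ.2 = gibbs F Δ.1 (critBeta F βbar Δ.1) ∧
    Δ.1 ∈ Ioc (sigmaLow F βbar) (sigmaZero F αbar βbar)}

/-- `z₁(Δ)`: the solution of `Φ_σ(z) = b` in `[α_σ, ζ_σ]`, for `Δ` in the closure of `Σ`. -/
def zOne (F : ℝ → ℝ) (αbar βbar : ℝ) (Δ : ℝ × ℝ) : ℝ :=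
  Function.invFunOn (gibbs F Δ.1) (Icc (critAlpha F αbar Δ.1) (critZeta F αbar βbar Δ.1)) Δ.2

/-- `z₂(Δ)`: the solution of `Φ_σ(z) = b` in `[ζ_σ, β_σ]`, for `Δ` in the closure of `Σ`. -/
def zTwo (F : ℝ → ℝ) (αbar βbar : ℝ) (Δ : ℝ × ℝ) : ℝ :=
  Function.invFunOn (gibbs F Δ.1) (Icc (critZeta F αbar βbar Δ.1) (critBeta F βbar Δ.1)) Δ.2

/-- `π₁(Δ) = b - Φ_σ(α_σ)`. -/
def piOne (F : ℝ → ℝ) (αbar : ℝ) (Δ : ℝ × ℝ) : ℝ :=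
  Δ.2 - gibbs F Δ.1 (critAlpha F αbar Δ.1)

/-- `π₂(Δ) = b - Φ_σ(β_σ)`. -/
def piTwo (F : ℝ → ℝ) (βbar : ℝ) (Δ : ℝ × ℝ) : ℝ :=
  Δ.2 - gibbs F Δ.1 (critBeta F βbar Δ.1)

/-- The change of variables `h = π(Δ)`. -/
def piMap (F : ℝ → ℝ) (αbar βbar : ℝ) (Δ : ℝ × ℝ) : ℝ × ℝ :=
  (piOne F αbar Δ, piTwo F βbar Δ)

/-- The inverse of `π`, which is injective on the closure of `Σ`. -/
def piInv (F : ℝ → ℝ) (αbar βbar : ℝ) (h : ℝ × ℝ) : ℝ × ℝ :=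
  Function.invFunOn (piMap F αbar βbar) (closure (admissible F αbar βbar)) h

/-- `f_Δ(z) = Φ_σ(z) - b`. -/
def fDelta (F : ℝ → ℝ) (Δ : ℝ × ℝ) (z : ℝ) : ℝ := gibbs F Δ.1 z - Δ.2

/-- `H_ε⁺(ξ) = √(ξ(2 - ε²ξ)) / (1 - ε²ξ)`, the inverse of
`P_ε(s) = ε⁻²(1 - 1/√(1 + ε²s²))` on `s > 0`. -/
def hPlus (ε ξ : ℝ) : ℝ := √(ξ * (2 - ε ^ 2 * ξ)) / (1 - ε ^ 2 * ξ)

/-- The integrand of `I_n(Δ;ε)`. -/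
def integrandI (F : ℝ → ℝ) (ε : ℝ) (n : ℕ) (Δ : ℝ × ℝ) (z : ℝ) : ℝ :=
  z ^ n / hPlus ε (fDelta F Δ z)

/-- `I_n(Δ;ε) = ∫_{z₁(Δ)}^{z₂(Δ)} zⁿ / H_ε⁺(f_Δ(z)) dz`. -/
def integralI (F : ℝ → ℝ) (αbar βbar ε : ℝ) (n : ℕ) (Δ : ℝ × ℝ) : ℝ :=
  ∫ z in (zOne F αbar βbar Δ)..(zTwo F αbar βbar Δ), integrandI F ε n Δ z

/-- `𝒬₁(Δ) = [2F''(z₁(Δ))]^{-1/2}`. -/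
def coeffOne (F : ℝ → ℝ) (αbar βbar : ℝ) (Δ : ℝ × ℝ) : ℝ :=
  (2 * deriv (deriv F) (zOne F αbar βbar Δ)) ^ (-(1 / 2) : ℝ)

/-- `𝒬₂(Δ) = [2F''(z₂(Δ))]^{-1/2}`. -/
def coeffTwo (F : ℝ → ℝ) (αbar βbar : ℝ) (Δ : ℝ × ℝ) : ℝ :=
  (2 * deriv (deriv F) (zTwo F αbar βbar Δ)) ^ (-(1 / 2) : ℝ)

/-- The term `(1/√2) 𝒬₁ z₁ⁿ ln π₁`. -/
def logTermOne (F : ℝ → ℝ) (αbar βbar : ℝ) (n : ℕ) (Δ : ℝ × ℝ) : ℝ :=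
  1 / √2 * coeffOne F αbar βbar Δ * zOne F αbar βbar Δ ^ n * Real.log (piOne F αbar Δ)

/-- The term `(1/√2) 𝒬₂ z₂ⁿ ln π₂`. -/
def logTermTwo (F : ℝ → ℝ) (αbar βbar : ℝ) (n : ℕ) (Δ : ℝ × ℝ) : ℝ :=
  1 / √2 * coeffTwo F αbar βbar Δ * zTwo F αbar βbar Δ ^ n * Real.log (piTwo F βbar Δ)

/-- `ℱ₁`: the points of the closure of `Σ` with `F''(z₁) > 0`. -/
def regionOne (F : ℝ → ℝ) (αbar βbar : ℝ) : Set (ℝ × ℝ) :=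
  {Δ | Δ ∈ closure (admissible F αbar βbar) ∧ 0 < deriv (deriv F) (zOne F αbar βbar Δ)}

/-- `ℱ₂`: the points of the closure of `Σ` with `F''(z₂) > 0`. -/
def regionTwo (F : ℝ → ℝ) (αbar βbar : ℝ) : Set (ℝ × ℝ) :=
  {Δ | Δ ∈ closure (admissible F αbar βbar) ∧ 0 < deriv (deriv F) (zTwo F αbar βbar Δ)}

/-- Near regularity at `h = 0` of a function `ψ` on the closure of an open set `H ⊆ (0,∞)²` having
`0` as a boundary point: `ψ` is continuous up to the boundary near `0`, it is `C¹` in `H` near `0`,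
and, for some `s < 1`, `ψ(h) = ψ(0) + O(|h|^{1-s})` and `∂ψ/∂hᵢ = O(hᵢ^{-s})`, `i = 1, 2`. -/
def NearlyRegular (H : Set (ℝ × ℝ)) (ψ : ℝ × ℝ → ℝ) : Prop :=
  ∃ U : Set (ℝ × ℝ), IsOpen U ∧ (0 : ℝ × ℝ) ∈ U ∧ ∃ s : ℝ, s < 1 ∧
    ContinuousOn ψ (U ∩ closure H) ∧
    ContDiffOn ℝ 1 ψ (U ∩ H) ∧
    (fun h => ψ h - ψ 0) =O[𝓝[closure H] 0] (fun h => ‖h‖ ^ (1 - s)) ∧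
    (fun h => fderiv ℝ ψ h (1, 0)) =O[𝓝[H] 0] (fun h => h.1 ^ (-s)) ∧
    (fun h => fderiv ℝ ψ h (0, 1)) =O[𝓝[H] 0] (fun h => h.2 ^ (-s))

/-- `φ ∈ NR(Ω)`, for `Ω` a neighbourhood of the Maxwell point in the closure of `Σ`. -/
def MemNR (F : ℝ → ℝ) (αbar βbar : ℝ) (Ω : Set (ℝ × ℝ)) (φ : ℝ × ℝ → ℝ) : Prop :=
  ContinuousOn φ Ω ∧
    NearlyRegular (piMap F αbar βbar '' admissible F αbar βbar)
      (fun h => φ (piInv F αbar βbar h))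

end

/-! Below the barrier, `f_Δ` acquires a double zero at `z_i` exactly when `π_i = 0`. The integrand
behaves like a multiple of `f_Δ^(-1/2)`, so the logarithms come only from the two ends. Cut the
interval at the level `f_Δ = δ²` for a small fixed `δ`. The endpoints of the middle piece solve `Φ_σ
= b + δ²`, strictly between bottom and barrier, so they are C¹ in `Δ` even on the boundary of `Σ`,
and so is the middle integral (`contDiffAt_middleIntegral`). The bound on `ε` enters through
`barrier_le`: the barrier is highest at the Maxwell point, hence `ε² f_Δ < 1` on the whole interval.

On the left piece take `h = π₁` as coordinate in place of `b` and substitute `f_Δ = v²`. The piece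
becomes `∫₀^δ κ(v) D(σ, h + v²) dv`. Here `κ` is smooth with `κ(0) = √2`, and `D = g(z)/Φ_σ'(z)`
with `g(z) = zⁿ` at the point `z` of the given height over the bottom. With `y = z - α_σ` one has `h
≈ F'' y²/2` and `Φ_σ' ≈ F'' y`, so `D ≈ A(σ)/√h` with `A = g/√(2F'')` at `α_σ`. Since `∫₀^δ √2 A (h
+ v²)^(-1/2) dv = -(A/√2) ln h + O(1)`, the added logarithmic term cancels the singularity. It
carries the coefficient at `z₁` instead of `α_σ`, but the two differ only by `O(√h)`.

Boundedness would not give continuity, so derivatives are controlled: `∂_σ D = A'/√h + O(1)` and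
`∂_h D = -A/(2h^(3/2)) + O(1/h)` (`isBigO_estimates`). After integration the leading terms cancel
against the derivatives of the logarithmic term. What remains is bounded in the `σ`-direction and
`O(h^(-3/4))` in the `h`-direction (`exists_regularPart_bounds`). The regularized piece is therefore
Hölder of exponent 1/4 up to `h = 0` and has limits there; where `h > 0` it is C¹. This yields the
continuous extensions. The right well of `F` is the left well of `x ↦ F(-x)` at slope `-σ`, so the
analysis is done once, for an abstract `WellBranch`.

Near the Maxwell point `(π₁, π₂)` are coordinates. Their difference is the difference of the well
depths, a function of `σ` alone with derivative `α_σ - β_σ < 0`; hence `σ = u(h₁ - h₂)` with `u` of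
class C¹. The regularized integral is `L(u, h₁) + N(h) + R(-u, h₂)` with `N` of class C¹, and the
derivative bounds on `L` and `R` give near regularity with `s = 3/4` (`nearlyRegular`). -/

noncomputable section

/-! ### Inverses on compact sets -/

/-- A continuous injection of a compact space into a Hausdorff space is an embedding. No derivative
is needed, so this gives continuity of the critical points and of `z₁`, `z₂` also where `F''` or the
slope vanishes. -/
theorem continuousOn_of_rightInverse_of_isCompact {X Y : Type*} [TopologicalSpace X]
    [TopologicalSpace Y] [T2Space Y] {f : X → Y} {g : Y → X} {K : Set X} {S : Set Y}
    (hK : IsCompact K) (hf : ContinuousOn f K) (hinj : InjOn f K) (hg : MapsTo g S K)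
    (hfg : ∀ y ∈ S, f (g y) = y) : ContinuousOn g S := by
  have : CompactSpace K := isCompact_iff_compactSpace.1 hK
  have hemb : IsClosedEmbedding (K.domRestrict f) :=
    (continuousOn_iff_continuous_domRestrict.1 hf).isClosedEmbedding hinj.injective
  have hc : Continuous (hg.restrict g S K) := by
    rw [hemb.isEmbedding.continuous_iff]
    refine continuous_subtype_val.congr fun y => ?_
    exact (hfg y y.2).symm
  rw [continuousOn_iff_continuous_domRestrict]
  exact continuous_subtype_val.comp hc

/-! ### Continuously differentiable functions and parametric integrals -/

theorem contDiffOn_one_of_hasFDerivAt {E G : Type*} [NormedAddCommGroup E] [NormedSpace ℝ E]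
    [NormedAddCommGroup G] [NormedSpace ℝ G] {f : E → G} {f' : E → E →L[ℝ] G} {O : Set E}
    (hO : IsOpen O) (h : ∀ x ∈ O, HasFDerivAt f (f' x) x) (hc : ContinuousOn f' O) :
    ContDiffOn ℝ 1 f O := by
  have : ContDiffOn ℝ (0 + 1) f O := by
    rw [contDiffOn_succ_iff_fderiv_of_isOpen hO]
    refine ⟨fun x hx => (h x hx).differentiableAt.differentiableWithinAt, by simp, ?_⟩
    rw [contDiffOn_zero]
    exact hc.congr fun x hx => (h x hx).fderiv
  simpa using this

/-- On a closed ball times `[a, b]`, which is compact, the derivative is bounded by a constant. That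
constant is the dominating function, both for differentiating under the integral and for continuity
of the result. -/
theorem hasFDerivAt_intervalIntegral_of_continuousOn {E : Type*} [NormedAddCommGroup E]
    [NormedSpace ℝ E] [ProperSpace E] {f : E → ℝ → ℝ} {f' : E → ℝ → E →L[ℝ] ℝ} {O : Set E}
    {a b : ℝ} (hab : a ≤ b) (hO : IsOpen O)
    (hd : ∀ x ∈ O, ∀ v ∈ Icc a b, HasFDerivAt (fun x => f x v) (f' x v) x)
    (hf : ∀ x ∈ O, ContinuousOn (f x) (Icc a b))
    (hf' : ContinuousOn (fun p : E × ℝ => f' p.1 p.2) (O ×ˢ Icc a b)) :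
    (∀ x ∈ O, HasFDerivAt (fun x => ∫ v in a..b, f x v) (∫ v in a..b, f' x v) x) ∧
      ContinuousOn (fun x => ∫ v in a..b, f' x v) O := by
  have key : ∀ x ∈ O, ∃ C r, 0 < r ∧ Metric.closedBall x r ⊆ O ∧
      ∀ y ∈ Metric.closedBall x r, ∀ v ∈ Icc a b, ‖f' y v‖ ≤ C := by
    intro x hx
    obtain ⟨r, hr, hrO⟩ := Metric.nhds_basis_closedBall.mem_iff.1 (hO.mem_nhds hx)
    have hcomp : IsCompact (Metric.closedBall x r ×ˢ Icc a b) :=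
      (isCompact_closedBall x r).prod isCompact_Icc
    obtain ⟨C, hC⟩ := hcomp.exists_bound_of_continuousOn
      (hf'.mono (prod_mono hrO Subset.rfl))
    exact ⟨C, r, hr, hrO, fun y hy v hv => hC (y, v) ⟨hy, hv⟩⟩
  have hslice : ∀ x ∈ O, ContinuousOn (f' x) (Icc a b) := fun x hx =>
    hf'.comp (f := fun v => (x, v)) (by fun_prop) fun v hv => ⟨hx, hv⟩
  have hIoc : uIoc a b ⊆ Icc a b := by rw [uIoc_of_le hab]; exact Ioc_subset_Icc_self
  refine ⟨fun x hx => ?_, fun x hx => ?_⟩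
  · obtain ⟨C, r, hr, hrO, hC⟩ := key x hx
    refine intervalIntegral.hasFDerivAt_integral_of_dominated_of_fderiv_le
      (bound := fun _ => C) (Metric.closedBall_mem_nhds x hr) ?_ ?_ ?_ ?_ ?_ ?_
    · filter_upwards [hO.mem_nhds hx] with y hy
      exact ((hf y hy).mono hIoc).aestronglyMeasurable measurableSet_uIoc
    · exact ContinuousOn.intervalIntegrable (by rw [uIcc_of_le hab]; exact hf x hx)
    · exact ((hslice x hx).mono hIoc).aestronglyMeasurable measurableSet_uIoc
    · exact Eventually.of_forall fun v hv y hy => hC y hy v (hIoc hv)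
    · exact intervalIntegrable_const
    · exact Eventually.of_forall fun v hv y hy => hd y (hrO hy) v (hIoc hv)
  · obtain ⟨C, r, hr, hrO, hC⟩ := key x hx
    refine ContinuousAt.continuousWithinAt ?_
    refine intervalIntegral.continuousAt_of_dominated_interval (bound := fun _ => C) ?_ ?_ ?_ ?_
    · filter_upwards [hO.mem_nhds hx] with y hy
      exact ((hslice y hy).mono hIoc).aestronglyMeasurable measurableSet_uIoc
    · filter_upwards [Metric.closedBall_mem_nhds x hr] with y hy
      exact Eventually.of_forall fun v hv => hC y hy v (hIoc hv)
    · exact intervalIntegrable_const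
    · refine Eventually.of_forall fun v hv => ?_
      have : ContinuousOn (fun y => f' y v) O :=
        hf'.comp (f := fun y => (y, v)) (by fun_prop) fun y hy => ⟨hy, hIoc hv⟩
      exact this.continuousAt (hO.mem_nhds hx)

/-- A parametric integral of a function which is `C¹` on an open set of `E × ℝ`. -/
theorem contDiffAt_intervalIntegral {f : (ℝ × ℝ) × ℝ → ℝ} {O : Set ((ℝ × ℝ) × ℝ)}
    (hO : IsOpen O) (hf : ContDiffOn ℝ 1 f O) {a b : ℝ} (hab : a ≤ b) {x₀ : ℝ × ℝ}
    (hx : ∀ v ∈ Icc a b, (x₀, v) ∈ O) :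
    ContDiffAt ℝ 1 (fun x => ∫ v in a..b, f (x, v)) x₀ ∧
      ∀ e : ℝ × ℝ, fderiv ℝ (fun x => ∫ v in a..b, f (x, v)) x₀ e =
        ∫ v in a..b, fderiv ℝ (fun x => f (x, v)) x₀ e := by
  obtain ⟨U, T, hU, hT, hxU, hIT, hUT⟩ := generalized_tube_lemma
    (isCompact_singleton (x := x₀)) (isCompact_Icc (a := a) (b := b)) hO
    (by rintro ⟨x, v⟩ ⟨hx', hv⟩; rw [mem_singleton_iff] at hx'; subst hx'; exact hx v hv)
  have hxU : x₀ ∈ U := hxU rfl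
  have hd : ∀ x ∈ U, ∀ v ∈ Icc a b, HasFDerivAt (fun x => f (x, v))
      ((fderiv ℝ f (x, v)).comp (ContinuousLinearMap.inl ℝ (ℝ × ℝ) ℝ)) x := by
    intro x hx v hv
    have h1 : HasFDerivAt f (fderiv ℝ f (x, v)) (x, v) :=
      ((hf.contDiffAt (hO.mem_nhds (hUT ⟨hx, hIT hv⟩))).differentiableAt (by simp)).hasFDerivAt
    exact h1.comp x (hasFDerivAt_prodMk_left x v)
  have hc : ContinuousOn (fderiv ℝ f) O := (hf.continuousOn_fderiv_of_isOpen hO (by simp))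
  have hsub : U ×ˢ Icc a b ⊆ O := fun p hp => hUT ⟨hp.1, hIT hp.2⟩
  obtain ⟨h1, h2⟩ := hasFDerivAt_intervalIntegral_of_continuousOn
    (f := fun x v => f (x, v))
    (f' := fun x v => (fderiv ℝ f (x, v)).comp (ContinuousLinearMap.inl ℝ (ℝ × ℝ) ℝ)) hab hU hd
    (fun x hx => hf.continuousOn.comp (f := fun v => (x, v)) (by fun_prop)
      fun v hv => hsub ⟨hx, hv⟩)
    ((hc.mono hsub).clm_comp continuousOn_const)
  refine ⟨(contDiffOn_one_of_hasFDerivAt hU h1 h2).contDiffAt (hU.mem_nhds hxU), fun e => ?_⟩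
  rw [(h1 x₀ hxU).fderiv, ContinuousLinearMap.intervalIntegral_apply]
  · refine intervalIntegral.integral_congr fun v hv => ?_
    rw [uIcc_of_le hab] at hv
    simp only [(hd x₀ hxU v hv).fderiv]
  · refine ContinuousOn.intervalIntegrable ?_
    rw [uIcc_of_le hab]
    exact ((hc.mono hsub).clm_comp continuousOn_const).comp (f := fun v => (x₀, v)) (by fun_prop)
      fun v hv => ⟨hxU, hv⟩

/-! ### Hölder estimates from derivative bounds -/

/-- The function `4 C t^(1/4)` is a primitive of the bound, so it dominates the increments of `f`;
and `t^(1/4)` is itself Hölder, being subadditive. -/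
theorem abs_sub_le_of_abs_deriv_le_rpow {f f' : ℝ → ℝ} {r C : ℝ} (hC : 0 ≤ C)
    (hd : ∀ x ∈ Ioo 0 r, HasDerivAt f (f' x) x)
    (hb : ∀ x ∈ Ioo 0 r, |f' x| ≤ C * x ^ (-(3 / 4) : ℝ)) {x y : ℝ} (hx : x ∈ Ioo 0 r)
    (hy : y ∈ Ioo 0 r) : |f x - f y| ≤ 4 * C * |x - y| ^ (1 / 4 : ℝ) := by
  wlog hxy : y ≤ x generalizing x y
  · rw [abs_sub_comm, abs_sub_comm x y]
    exact this hy hx (le_of_not_ge hxy)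
  have hp : ∀ t ∈ Ioo 0 r, HasDerivAt (fun t => 4 * C * t ^ (1 / 4 : ℝ))
      (C * t ^ (-(3 / 4) : ℝ)) t := by
    intro t ht
    refine ((Real.hasDerivAt_rpow_const (p := 1 / 4) (Or.inl ht.1.ne')).const_mul
      (4 * C)).congr_deriv ?_
    norm_num
    ring
  -- Taking `s = 1` and `s = -1` gives the two one-sided bounds.
  have mono : ∀ s : ℝ, |s| = 1 → MonotoneOn (fun t => 4 * C * t ^ (1 / 4 : ℝ) + s * f t) (Ioo 0 r) := by
    intro s hs
    refine monotoneOn_of_hasDerivWithinAt_nonneg (convex_Ioo 0 r)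
      (fun t ht => ((hp t ht).add ((hd t ht).const_mul s)).continuousAt.continuousWithinAt)
      (fun t ht => ((hp t (interior_subset ht)).add
        ((hd t (interior_subset ht)).const_mul s)).hasDerivWithinAt) ?_
    intro t ht
    have h1 := hb t (interior_subset ht)
    have h2 : |s * f' t| ≤ C * t ^ (-(3 / 4) : ℝ) := by rw [abs_mul, hs, one_mul]; exact h1
    linarith [neg_abs_le (s * f' t)]
  have m1 := mono 1 (by simp) hy hx hxy
  have m2 := mono (-1) (by simp) hy hx hxy
  simp only at m1 m2
  have h3 : x ^ (1 / 4 : ℝ) - y ^ (1 / 4 : ℝ) ≤ |x - y| ^ (1 / 4 : ℝ) := by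
    rw [abs_of_nonneg (by linarith)]
    have := Real.rpow_add_le_add_rpow (p := 1 / 4) (sub_nonneg.2 hxy) hy.1.le (by norm_num)
      (by norm_num)
    rw [sub_add_cancel] at this
    linarith
  have h4 : 4 * C * (x ^ (1 / 4 : ℝ) - y ^ (1 / 4 : ℝ)) ≤ 4 * C * |x - y| ^ (1 / 4 : ℝ) :=
    mul_le_mul_of_nonneg_left h3 (by linarith)
  rw [abs_le]
  constructor <;> linarith

/-- A Lipschitz bound, weakened to exponent 1/4 on an interval of length at most 1 so that it
combines with the bound in the singular direction. -/
theorem abs_sub_le_of_abs_deriv_le {f f' : ℝ → ℝ} {a b C : ℝ}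
    (hab : b - a ≤ 1) (hd : ∀ x ∈ Ioo a b, HasDerivAt f (f' x) x)
    (hb : ∀ x ∈ Ioo a b, |f' x| ≤ C) {x y : ℝ} (hx : x ∈ Ioo a b)
    (hy : y ∈ Ioo a b) : |f x - f y| ≤ C * |x - y| ^ (1 / 4 : ℝ) := by
  have h1 := (convex_Ioo a b).norm_image_sub_le_of_norm_hasDerivWithin_le
    (fun t ht => (hd t ht).hasDerivWithinAt) (fun t ht => hb t ht) hy hx
  have hC : 0 ≤ C := (abs_nonneg _).trans (hb x hx)
  refine h1.trans (mul_le_mul_of_nonneg_left ?_ hC)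
  have h2 : |x - y| ≤ 1 := by
    rw [abs_le]; constructor <;> linarith [hx.1, hx.2, hy.1, hy.2]
  simpa using Real.rpow_le_rpow_of_exponent_ge_of_imp (abs_nonneg (x - y)) h2
    (show (1 / 4 : ℝ) ≤ 1 by norm_num) (by norm_num)

/-- Go from `p` to `q` through the corner `(q.1, p.2)`, which stays in the product set; each leg
costs one factor `C`. -/
theorem abs_sub_le_norm_rpow_of_slices {f : ℝ × ℝ → ℝ} {I J : Set ℝ} {C : ℝ} (hC : 0 ≤ C)
    (h1 : ∀ t ∈ J, ∀ x ∈ I, ∀ y ∈ I, |f (x, t) - f (y, t)| ≤ C * |x - y| ^ (1 / 4 : ℝ))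
    (h2 : ∀ t ∈ I, ∀ x ∈ J, ∀ y ∈ J, |f (t, x) - f (t, y)| ≤ C * |x - y| ^ (1 / 4 : ℝ))
    {p q : ℝ × ℝ} (hp : p ∈ I ×ˢ J) (hq : q ∈ I ×ˢ J) :
    |f p - f q| ≤ 2 * C * ‖p - q‖ ^ (1 / 4 : ℝ) := by
  obtain ⟨p1, p2⟩ := p
  obtain ⟨q1, q2⟩ := q
  have a1 := h1 p2 hp.2 p1 hp.1 q1 hq.1
  have a2 := h2 q1 hq.1 p2 hp.2 q2 hq.2
  have b1 : |p1 - q1| ^ (1 / 4 : ℝ) ≤ ‖(p1, p2) - (q1, q2)‖ ^ (1 / 4 : ℝ) :=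
    Real.rpow_le_rpow (abs_nonneg _) (norm_fst_le ((p1, p2) - (q1, q2))) (by norm_num)
  have b2 : |p2 - q2| ^ (1 / 4 : ℝ) ≤ ‖(p1, p2) - (q1, q2)‖ ^ (1 / 4 : ℝ) :=
    Real.rpow_le_rpow (abs_nonneg _) (norm_snd_le ((p1, p2) - (q1, q2))) (by norm_num)
  have b1' := mul_le_mul_of_nonneg_left b1 hC
  have b2' := mul_le_mul_of_nonneg_left b2 hC
  have := abs_sub_le (f (p1, p2)) (f (q1, p2)) (f (q1, q2))
  linarith

/-- The Hölder bound makes the image filter Cauchy. This is how boundary limits are obtained without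
a formula for them. -/
theorem exists_tendsto_of_abs_sub_le_norm_rpow {f : ℝ × ℝ → ℝ} {N : Set (ℝ × ℝ)} {C : ℝ}
    {x₀ : ℝ × ℝ} (hx : x₀ ∈ closure N)
    (h : ∀ p ∈ N, ∀ q ∈ N, |f p - f q| ≤ C * ‖p - q‖ ^ (1 / 4 : ℝ)) :
    ∃ y, Tendsto f (𝓝[N] x₀) (𝓝 y) := by
  have : (𝓝[N] x₀).NeBot := mem_closure_iff_nhdsWithin_neBot.1 hx
  have hc : Cauchy (map f (𝓝[N] x₀)) := by
    rw [Metric.cauchy_iff]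
    refine ⟨this.map f, fun e he => ?_⟩
    have ht : Tendsto (fun t : ℝ => C * t ^ (1 / 4 : ℝ)) (𝓝 0) (𝓝 0) := by
      have : ContinuousAt (fun t : ℝ => C * t ^ (1 / 4 : ℝ)) 0 :=
        (Real.continuousAt_rpow_const 0 (1 / 4) (Or.inr (by norm_num))).const_mul C
      simpa [ContinuousAt] using this
    obtain ⟨d, hd, hde⟩ := Metric.eventually_nhds_iff.1 (ht.eventually_lt_const he)
    refine ⟨f '' (N ∩ Metric.ball x₀ (d / 2)), image_mem_map ?_, ?_⟩
    · exact inter_mem_nhdsWithin N (Metric.ball_mem_nhds x₀ (by linarith))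
    · rintro _ ⟨p, hp, rfl⟩ _ ⟨q, hq, rfl⟩
      rw [Real.dist_eq]
      refine (h p hp.1 q hq.1).trans_lt (hde ?_)
      rw [← dist_eq_norm, Real.dist_0_eq_abs, abs_of_nonneg dist_nonneg]
      have := dist_triangle_right p q x₀
      have := Metric.mem_ball.1 hp.2
      have := Metric.mem_ball.1 hq.2
      linarith
  exact CompleteSpace.complete hc

/-! ### Singular kernels -/

/-- The source of the logarithm: a primitive is `log (v + √(h + v²))`, whose value at `v = 0` is
`(log h)/2`. -/
theorem integral_inv_sqrt_add_sq {h δ : ℝ} (hh : 0 < h) :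
    ∫ v in (0 : ℝ)..δ, 1 / √(h + v ^ 2) = Real.log (δ + √(h + δ ^ 2)) - Real.log h / 2 := by
  have hpos : ∀ v : ℝ, 0 < h + v ^ 2 := fun v => by positivity
  have hlin : ∀ v : ℝ, 0 < v + √(h + v ^ 2) := fun v => by
    have : |v| < √(h + v ^ 2) := by
      rw [← Real.sqrt_sq_eq_abs]; exact Real.sqrt_lt_sqrt (sq_nonneg v) (by linarith)
    linarith [neg_abs_le v]
  have hd : ∀ v ∈ uIcc 0 δ, HasDerivAt (fun v => Real.log (v + √(h + v ^ 2)))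
      (1 / √(h + v ^ 2)) v := by
    intro v _
    have h1 : HasDerivAt (fun v : ℝ => h + v ^ 2) (2 * v) v := by
      simpa using (hasDerivAt_pow 2 v).const_add h
    have h2 := ((hasDerivAt_id v).add (h1.sqrt (hpos v).ne')).log (hlin v).ne'
    refine h2.congr_deriv ?_
    have := Real.sqrt_pos.2 (hpos v)
    have := hlin v
    simp only [Pi.add_apply, id]
    field_simp
    ring
  rw [intervalIntegral.integral_eq_sub_of_hasDerivAt hd]
  · simp [Real.log_sqrt hh.le]
  · refine Continuous.intervalIntegrable ?_ _ _
    exact continuous_const.div (by fun_prop) fun v => (Real.sqrt_pos.2 (hpos v)).ne'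

theorem integral_inv_rpow_three_halves_add_sq {h δ : ℝ} (hh : 0 < h) :
    ∫ v in (0 : ℝ)..δ, 1 / ((h + v ^ 2) * √(h + v ^ 2)) = δ / (h * √(h + δ ^ 2)) := by
  have hpos : ∀ v : ℝ, 0 < h + v ^ 2 := fun v => by positivity
  have hd : ∀ v ∈ uIcc 0 δ, HasDerivAt (fun v => v / (h * √(h + v ^ 2)))
      (1 / ((h + v ^ 2) * √(h + v ^ 2))) v := by
    intro v _
    have h1 : HasDerivAt (fun v : ℝ => h + v ^ 2) (2 * v) v := by
      simpa using (hasDerivAt_pow 2 v).const_add h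
    have hs := Real.sqrt_pos.2 (hpos v)
    have h2 := (hasDerivAt_id v).div ((h1.sqrt (hpos v).ne').const_mul h) (by positivity)
    refine h2.congr_deriv ?_
    have hsq : √(h + v ^ 2) ^ 2 = h + v ^ 2 := Real.sq_sqrt (hpos v).le
    have hv : v ^ 2 = √(h + v ^ 2) ^ 2 - h := by linarith
    generalize √(h + v ^ 2) = s at *
    simp only [id, ← hsq]
    field_simp
    linarith
  rw [intervalIntegral.integral_eq_sub_of_hasDerivAt hd]
  · simp
  · refine Continuous.intervalIntegrable ?_ _ _
    exact continuous_const.div (by fun_prop)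
      fun v => (mul_pos (hpos v) (Real.sqrt_pos.2 (hpos v))).ne'

/-- The primitive is `arctan (v/√h)/√h`, and `2` is a crude bound for `π/2`. It controls the
`O(1/h)` error in `∂_h D` after integration. -/
theorem integral_inv_add_sq_le {h δ : ℝ} (hh : 0 < h) :
    ∫ v in (0 : ℝ)..δ, 1 / (h + v ^ 2) ≤ 2 / √h := by
  have hpos : ∀ v : ℝ, 0 < h + v ^ 2 := fun v => by positivity
  have hs := Real.sqrt_pos.2 hh
  have hd : ∀ v ∈ uIcc 0 δ, HasDerivAt (fun v => Real.arctan (v / √h) / √h)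
      (1 / (h + v ^ 2)) v := by
    intro v _
    have h2 := (((hasDerivAt_id v).div_const (√h)).arctan).div_const (√h)
    refine h2.congr_deriv ?_
    have hsq : √h ^ 2 = h := Real.sq_sqrt hh.le
    generalize √h = s at *
    simp only [id, ← hsq]
    field_simp
  rw [intervalIntegral.integral_eq_sub_of_hasDerivAt hd]
  · simp only [zero_div, Real.arctan_zero, sub_zero]
    gcongr
    linarith [Real.arctan_lt_pi_div_two (δ / √h), Real.pi_lt_four]
  · refine Continuous.intervalIntegrable ?_ _ _
    exact continuous_const.div (by fun_prop) fun v => (hpos v).ne'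

end

/-! ### The integration kernel after the substitution `ξ = v²`. -/

noncomputable section

/-- The weight of `dv` in `dξ / H_ε⁺(ξ)` under the substitution `ξ = v²`. -/
def kernelWeight (ε v : ℝ) : ℝ := 2 * (1 - ε ^ 2 * v ^ 2) / √(2 - ε ^ 2 * v ^ 2)

theorem inv_hPlus_sq_mul (ε : ℝ) {v : ℝ} (hv : 0 < v) :
    (hPlus ε (v ^ 2))⁻¹ * (2 * v) = kernelWeight ε v := by
  have : √(v ^ 2 * (2 - ε ^ 2 * v ^ 2)) = v * √(2 - ε ^ 2 * v ^ 2) := by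
    rw [Real.sqrt_mul (sq_nonneg v), Real.sqrt_sq hv.le]
  rw [hPlus, kernelWeight, this, inv_div, div_mul_eq_mul_div, mul_comm v,
    show (1 - ε ^ 2 * v ^ 2) * (2 * v) = (2 * (1 - ε ^ 2 * v ^ 2)) * v by ring,
    mul_div_mul_right _ _ hv.ne']

theorem contDiffOn_kernelWeight (ε : ℝ) :
    ContDiffOn ℝ 1 (kernelWeight ε) {v | ε ^ 2 * v ^ 2 < 2} := by
  intro v hv
  have hv : 0 < 2 - ε ^ 2 * v ^ 2 := sub_pos.2 hv
  refine ContDiffAt.contDiffWithinAt ?_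
  refine ContDiffAt.div (by fun_prop) (ContDiffAt.sqrt (by fun_prop) hv.ne') ?_
  exact (Real.sqrt_pos.2 hv).ne'

/-- The weight is an even function of `v` with value `√2` at zero. The quadratic error is what
absorbs the singularity of the kernels at `v = 0`. -/
theorem abs_kernelWeight_sub_le {ε v : ℝ} (hv : ε ^ 2 * v ^ 2 ≤ 1) :
    |kernelWeight ε v - √2| ≤ 4 * ε ^ 2 * v ^ 2 := by
  set x := ε ^ 2 * v ^ 2 with hx
  have hx0 : 0 ≤ x := by positivity
  have h1 : 1 ≤ √(2 - x) := Real.one_le_sqrt.2 (by linarith)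
  have h2 : √(2 - x) ≤ √2 := Real.sqrt_le_sqrt (by linarith)
  have hsq : √(2 - x) ^ 2 = 2 - x := Real.sq_sqrt (by linarith)
  have hsq2 : √2 ^ 2 = 2 := Real.sq_sqrt (by norm_num)
  have h3 : √2 ≤ 2 := by nlinarith
  rw [kernelWeight, ← hx, mul_assoc 4, ← hx, abs_le]
  generalize √(2 - x) = s at *
  generalize √2 = t at *
  have hs : (0 : ℝ) < s := by linarith
  have e : 2 * (1 - x) / s - t = (2 * (1 - x) - t * s) / s := by field_simp
  rw [e]
  constructor
  · rw [le_div_iff₀ hs]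
    nlinarith
  · rw [div_le_iff₀ hs]
    nlinarith

section KernelBounds

variable {κ : ℝ → ℝ} {δ C : ℝ}

theorem intervalIntegrable_div_of_continuousOn (hδ : 0 < δ) (hκ : ContinuousOn κ (Icc 0 δ))
    {u : ℝ → ℝ} (hu : Continuous u) (hpos : ∀ v, 0 < u v) :
    IntervalIntegrable (fun v => κ v / u v) volume 0 δ := by
  refine ContinuousOn.intervalIntegrable ?_
  rw [uIcc_of_le hδ.le]
  exact hκ.div hu.continuousOn fun v _ => (hpos v).ne'

/-- Replacing `κ` by `√2` costs at most `C v²/√(h + v²) ≤ C v`, uniformly in `h`; the remaining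
integral is explicit. -/
theorem exists_abs_integral_div_sqrt_le (hδ : 0 < δ) (hC : 0 ≤ C) (hκ : ContinuousOn κ (Icc 0 δ))
    (hκ2 : ∀ v ∈ Icc 0 δ, |κ v - √2| ≤ C * v ^ 2) :
    ∃ K, ∀ h ∈ Ioo (0 : ℝ) 1,
      |(∫ v in (0 : ℝ)..δ, κ v / √(h + v ^ 2)) + 1 / √2 * Real.log h| ≤ K := by
  -- The first summand is the cost of replacing `κ` by `√2`. The second bounds the endpoint value
  -- `log (δ + √(h + δ²))` between `log δ` and its value at `h = 1`.
  refine ⟨C * δ * δ + √2 * (|Real.log δ| + |Real.log (δ + √(1 + δ ^ 2))|), fun h hh => ?_⟩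
  have hpos : ∀ v : ℝ, 0 < √(h + v ^ 2) := fun v => Real.sqrt_pos.2 (by have := hh.1; positivity)
  have hcont : Continuous fun v : ℝ => √(h + v ^ 2) := by fun_prop
  have i1 := intervalIntegrable_div_of_continuousOn hδ hκ hcont hpos
  have i2 := intervalIntegrable_div_of_continuousOn hδ (κ := fun _ => √2)
    continuousOn_const hcont hpos
  have e1 : (∫ v in (0 : ℝ)..δ, κ v / √(h + v ^ 2)) =
      (∫ v in (0 : ℝ)..δ, (κ v / √(h + v ^ 2) - √2 / √(h + v ^ 2))) +
        √2 * (Real.log (δ + √(h + δ ^ 2)) - Real.log h / 2) := by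
    rw [intervalIntegral.integral_sub i1 i2, ← integral_inv_sqrt_add_sq hh.1,
      ← intervalIntegral.integral_const_mul]
    simp only [mul_one_div, sub_add_cancel]
  have e2 : ‖∫ v in (0 : ℝ)..δ, (κ v / √(h + v ^ 2) - √2 / √(h + v ^ 2))‖ ≤ C * δ * |δ - 0| := by
    refine intervalIntegral.norm_integral_le_of_norm_le_const fun v hv => ?_
    rw [uIoc_of_le hδ.le] at hv
    rw [← sub_div, Real.norm_eq_abs, abs_div, abs_of_pos (hpos v), div_le_iff₀ (hpos v)]
    have hvs : v ≤ √(h + v ^ 2) := Real.le_sqrt_of_sq_le (by linarith [hh.1])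
    calc _ ≤ C * v ^ 2 := hκ2 v ⟨hv.1.le, hv.2⟩
      _ = C * v * v := by ring
      _ ≤ C * δ * √(h + v ^ 2) := by have := hv.1.le; have := hv.2; gcongr
  have e3 : √2 * (Real.log h / 2) = 1 / √2 * Real.log h := by
    have : √2 ^ 2 = 2 := Real.sq_sqrt (by norm_num)
    field_simp
    rw [this, mul_comm]
  have e4 : |Real.log (δ + √(h + δ ^ 2))| ≤ |Real.log δ| + |Real.log (δ + √(1 + δ ^ 2))| := by
    have l1 : Real.log δ ≤ Real.log (δ + √(h + δ ^ 2)) :=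
      Real.log_le_log hδ (by linarith [hpos δ])
    have l2 : Real.log (δ + √(h + δ ^ 2)) ≤ Real.log (δ + √(1 + δ ^ 2)) := by
      refine Real.log_le_log (by linarith [hpos δ]) ?_
      gcongr
      exact hh.2.le
    rw [abs_le]
    constructor
    · linarith [neg_abs_le (Real.log δ), abs_nonneg (Real.log (δ + √(1 + δ ^ 2)))]
    · linarith [le_abs_self (Real.log (δ + √(1 + δ ^ 2))), abs_nonneg (Real.log δ)]
  rw [e1, mul_sub, e3, add_sub, sub_add_cancel]
  refine (abs_add_le _ _).trans (add_le_add ?_ ?_)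
  · rwa [sub_zero, abs_of_pos hδ] at e2
  · rw [abs_mul, abs_of_nonneg (Real.sqrt_nonneg 2)]
    gcongr

/-- The same comparison with one more power of `h + v²`: the error integrand is at most `C/√h`, and
the explicit integral of the main term is `√2/h` up to a bounded quantity. -/
theorem exists_abs_integral_div_rpow_le (hδ : 0 < δ) (hC : 0 ≤ C)
    (hκ : ContinuousOn κ (Icc 0 δ)) (hκ2 : ∀ v ∈ Icc 0 δ, |κ v - √2| ≤ C * v ^ 2) :
    ∃ K, ∀ h ∈ Ioo (0 : ℝ) 1,
      |(∫ v in (0 : ℝ)..δ, κ v / ((h + v ^ 2) * √(h + v ^ 2))) - √2 / h| ≤ K / √h := by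
  refine ⟨C * δ + √2 / (2 * δ ^ 2), fun h hh => ?_⟩
  have hh0 := hh.1
  have hpos : ∀ v : ℝ, 0 < √(h + v ^ 2) := fun v => Real.sqrt_pos.2 (by positivity)
  have hpos' : ∀ v : ℝ, 0 < (h + v ^ 2) * √(h + v ^ 2) :=
    fun v => mul_pos (by positivity) (hpos v)
  have hcont : Continuous fun v : ℝ => (h + v ^ 2) * √(h + v ^ 2) := by fun_prop
  have i1 := intervalIntegrable_div_of_continuousOn hδ hκ hcont hpos'
  have i2 := intervalIntegrable_div_of_continuousOn hδ (κ := fun _ => √2)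
    continuousOn_const hcont hpos'
  have e1 : (∫ v in (0 : ℝ)..δ, κ v / ((h + v ^ 2) * √(h + v ^ 2))) =
      (∫ v in (0 : ℝ)..δ, (κ v / ((h + v ^ 2) * √(h + v ^ 2)) -
        √2 / ((h + v ^ 2) * √(h + v ^ 2)))) + √2 * (δ / (h * √(h + δ ^ 2))) := by
    rw [intervalIntegral.integral_sub i1 i2, ← integral_inv_rpow_three_halves_add_sq hh0,
      ← intervalIntegral.integral_const_mul]
    simp only [mul_one_div, sub_add_cancel]
  have hs := Real.sqrt_pos.2 hh0
  have e2 : ‖∫ v in (0 : ℝ)..δ, (κ v / ((h + v ^ 2) * √(h + v ^ 2)) -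
      √2 / ((h + v ^ 2) * √(h + v ^ 2)))‖ ≤ C / √h * |δ - 0| := by
    refine intervalIntegral.norm_integral_le_of_norm_le_const fun v hv => ?_
    rw [uIoc_of_le hδ.le] at hv
    rw [← sub_div, Real.norm_eq_abs, abs_div, abs_of_pos (hpos' v), div_le_iff₀ (hpos' v)]
    have hvs : √h ≤ √(h + v ^ 2) := Real.sqrt_le_sqrt (by nlinarith)
    calc _ ≤ C * v ^ 2 := hκ2 v ⟨hv.1.le, hv.2⟩
      _ = C / √h * (v ^ 2 * √h) := by field_simp
      _ ≤ C / √h * ((h + v ^ 2) * √(h + v ^ 2)) := by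
        gcongr
        linarith
  have e3 : |√2 * (δ / (h * √(h + δ ^ 2))) - √2 / h| ≤ √2 / (2 * δ ^ 2) / √h := by
    have hst : δ ≤ √(h + δ ^ 2) := Real.le_sqrt_of_sq_le (by linarith)
    have hsq : √(h + δ ^ 2) ^ 2 = h + δ ^ 2 := Real.sq_sqrt (by positivity)
    have h1 : √h ≤ 1 := Real.sqrt_le_one.2 hh.2.le
    -- Rationalizing `δ - √(h + δ²)` produces a factor `h` that cancels the singular denominator.
    have e : √2 * (δ / (h * √(h + δ ^ 2))) - √2 / h =
        -(√2 * (1 / ((√(h + δ ^ 2) + δ) * √(h + δ ^ 2)))) := by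
      have := hpos δ
      generalize √(h + δ ^ 2) = s at *
      have hh' : h = s ^ 2 - δ ^ 2 := by linarith
      field_simp
      rw [hh']
      ring
    rw [e, abs_neg, abs_of_nonneg (by have := hpos δ; positivity), div_div, div_eq_mul_one_div √2]
    refine mul_le_mul_of_nonneg_left (one_div_le_one_div_of_le (by positivity) ?_)
      (Real.sqrt_nonneg 2)
    calc 2 * δ ^ 2 * √h ≤ 2 * δ ^ 2 * 1 := by gcongr
      _ = (δ + δ) * δ := by ring
      _ ≤ _ := by gcongr
  rw [e1, add_sub_assoc, add_div]
  refine (abs_add_le _ _).trans (add_le_add ?_ e3)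
  rw [sub_zero, abs_of_pos hδ] at e2
  exact e2.trans_eq (by ring)

end KernelBounds

/-! ### The substitution -/

/-- The integrand `g` may be singular at an endpoint, so integrability must be transferred together
with the value. Injectivity on the open interval allows the measure-theoretic change of variables,
and `G` is the regular transformed integrand. -/
theorem integral_eq_integral_comp_mul_deriv_of_strictMonoOn {f f' g : ℝ → ℝ} {a b : ℝ}
    (hab : a ≤ b) (hc : ContinuousOn f (Icc a b)) (hm : StrictMonoOn f (Icc a b))
    (hd : ∀ x ∈ Ioo a b, HasDerivAt f (f' x) x) {G : ℝ → ℝ}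
    (hG : ∀ x ∈ Ioo a b, g (f x) * f' x = G x) (hGi : IntervalIntegrable G volume a b)
    (hf' : ∀ x ∈ Ioo a b, 0 ≤ f' x) :
    IntervalIntegrable g volume (f a) (f b) ∧ ∫ z in (f a)..(f b), g z = ∫ x in a..b, G x := by
  have hle : f a ≤ f b := hm.monotoneOn ⟨le_rfl, hab⟩ ⟨hab, le_rfl⟩ hab
  have himg : f '' Ioo a b = Ioo (f a) (f b) := by
    apply Subset.antisymm
    · rintro _ ⟨x, hx, rfl⟩
      exact ⟨hm ⟨le_rfl, hab⟩ (Ioo_subset_Icc_self hx) hx.1,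
        hm (Ioo_subset_Icc_self hx) ⟨hab, le_rfl⟩ hx.2⟩
    · exact intermediate_value_Ioo hab hc
  have hinj : InjOn f (Ioo a b) := (hm.mono Ioo_subset_Icc_self).injOn
  have hd' : ∀ x ∈ Ioo a b, HasDerivWithinAt f (f' x) (Ioo a b) x :=
    fun x hx => (hd x hx).hasDerivWithinAt
  have hcongr : ∀ x ∈ Ioo a b, |f' x| • g (f x) = G x := fun x hx => by
    rw [abs_of_nonneg (hf' x hx), smul_eq_mul, mul_comm, hG x hx]
  constructor
  · rw [intervalIntegrable_iff_integrableOn_Ioo_of_le hle, ← himg,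
      integrableOn_image_iff_integrableOn_abs_deriv_smul measurableSet_Ioo hd' hinj]
    rw [intervalIntegrable_iff_integrableOn_Ioo_of_le hab] at hGi
    exact hGi.congr_fun (fun x hx => (hcongr x hx).symm) measurableSet_Ioo
  · rw [intervalIntegral.integral_of_le hle, intervalIntegral.integral_of_le hab,
      integral_Ioc_eq_integral_Ioo, integral_Ioc_eq_integral_Ioo, ← himg,
      integral_image_eq_integral_abs_deriv_smul measurableSet_Ioo hd' hinj]
    exact setIntegral_congr_fun measurableSet_Ioo hcongr

end

/-! ### Wells of `Φ_σ` and the branch of solutions, for one abstract well. -/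

noncomputable section

/-- A family of wells of `Φ_σ`, `σ ∈ S`, with bottom `a σ`, barrier `ζ σ > a σ` and the branch
`z (σ, b)` of solutions of `Φ_σ(z) = b` between them. -/
structure WellBranch (F : ℝ → ℝ) (W V S : Set ℝ) (a ζ : ℝ → ℝ) (z : ℝ × ℝ → ℝ) : Prop where
  isOpen_W : IsOpen W
  isOpen_V : IsOpen V
  V_subset : V ⊆ W
  isOpen_S : IsOpen S
  contDiffOn : ContDiffOn ℝ 5 F W
  convex : ∀ x ∈ V, 0 < deriv (deriv F) x
  a_mem : ∀ σ ∈ S, a σ ∈ V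
  a_cont : ContinuousOn a S
  deriv_a : ∀ σ ∈ S, deriv F (a σ) = σ
  ζ_cont : ContinuousOn ζ S
  a_lt : ∀ σ ∈ S, a σ < ζ σ
  Icc_subset : ∀ σ ∈ S, Icc (a σ) (ζ σ) ⊆ W
  slope : ∀ σ ∈ S, ∀ x ∈ Ioo (a σ) (ζ σ), σ < deriv F x
  z_mem : ∀ σ ∈ S, ∀ b ∈ Icc (gibbs F σ (a σ)) (gibbs F σ (ζ σ)), z (σ, b) ∈ Icc (a σ) (ζ σ)
  z_eq : ∀ σ ∈ S, ∀ b ∈ Icc (gibbs F σ (a σ)) (gibbs F σ (ζ σ)), gibbs F σ (z (σ, b)) = b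
  z_cont : ContinuousOn z {p | p.1 ∈ S ∧ p.2 ∈ Icc (gibbs F p.1 (a p.1)) (gibbs F p.1 (ζ p.1))}

/-- The points `(σ, b)` with `b` strictly between the bottom and the barrier. -/
def wellRegion (F : ℝ → ℝ) (S : Set ℝ) (a ζ : ℝ → ℝ) : Set (ℝ × ℝ) :=
  {p | p.1 ∈ S ∧ gibbs F p.1 (a p.1) < p.2 ∧ p.2 < gibbs F p.1 (ζ p.1)}

/-- The branch `z` in terms of the height `h` over the bottom of the well. -/
def heightBranch (F : ℝ → ℝ) (a : ℝ → ℝ) (z : ℝ × ℝ → ℝ) (p : ℝ × ℝ) : ℝ :=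
  z (p.1, gibbs F p.1 (a p.1) + p.2)

/-- The points `(σ, h)` with `h` strictly between zero and the height of the barrier. -/
def heightRegion (F : ℝ → ℝ) (S : Set ℝ) (a ζ : ℝ → ℝ) : Set (ℝ × ℝ) :=
  {p | p.1 ∈ S ∧ 0 < p.2 ∧ gibbs F p.1 (a p.1) + p.2 < gibbs F p.1 (ζ p.1)}

theorem hasFDerivAt_fst_real (p : ℝ × ℝ) :
    HasFDerivAt (Prod.fst : ℝ × ℝ → ℝ) (ContinuousLinearMap.fst ℝ ℝ ℝ) p := hasFDerivAt_fst

theorem hasFDerivAt_snd_real (p : ℝ × ℝ) :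
    HasFDerivAt (Prod.snd : ℝ × ℝ → ℝ) (ContinuousLinearMap.snd ℝ ℝ ℝ) p := hasFDerivAt_snd

theorem hasDerivAt_gibbs {F : ℝ → ℝ} {σ x : ℝ} (h : DifferentiableAt ℝ F x) :
    HasDerivAt (gibbs F σ) (deriv F x - σ) x := by
  have := h.hasDerivAt.sub ((hasDerivAt_id x).const_mul σ)
  rwa [mul_one] at this

namespace WellBranch

variable {F : ℝ → ℝ} {W V S : Set ℝ} {a ζ : ℝ → ℝ} {z : ℝ × ℝ → ℝ}

theorem contDiffOn_deriv (H : WellBranch F W V S a ζ z) : ContDiffOn ℝ 4 (deriv F) W :=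
  H.contDiffOn.deriv_of_isOpen H.isOpen_W (by norm_num)

theorem contDiffOn_deriv2 (H : WellBranch F W V S a ζ z) :
    ContDiffOn ℝ 3 (deriv (deriv F)) W :=
  H.contDiffOn_deriv.deriv_of_isOpen H.isOpen_W (by norm_num)

theorem contDiffOn_deriv3 (H : WellBranch F W V S a ζ z) :
    ContDiffOn ℝ 2 (deriv (deriv (deriv F))) W :=
  H.contDiffOn_deriv2.deriv_of_isOpen H.isOpen_W (by norm_num)

theorem differentiableAt (H : WellBranch F W V S a ζ z) {x : ℝ} (hx : x ∈ W) :
    DifferentiableAt ℝ F x :=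
  (H.contDiffOn.contDiffAt (H.isOpen_W.mem_nhds hx)).differentiableAt (by norm_num)

theorem hasDerivAt_deriv (H : WellBranch F W V S a ζ z) {x : ℝ} (hx : x ∈ W) :
    HasDerivAt (deriv F) (deriv (deriv F) x) x :=
  ((H.contDiffOn_deriv.contDiffAt (H.isOpen_W.mem_nhds hx)).differentiableAt
    (by norm_num)).hasDerivAt

theorem hasDerivAt_deriv2 (H : WellBranch F W V S a ζ z) {x : ℝ} (hx : x ∈ W) :
    HasDerivAt (deriv (deriv F)) (deriv (deriv (deriv F)) x) x :=
  ((H.contDiffOn_deriv2.contDiffAt (H.isOpen_W.mem_nhds hx)).differentiableAt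
    (by norm_num)).hasDerivAt

theorem a_mem_W (H : WellBranch F W V S a ζ z) {σ : ℝ} (hσ : σ ∈ S) : a σ ∈ W :=
  H.V_subset (H.a_mem σ hσ)

theorem ζ_mem_W (H : WellBranch F W V S a ζ z) {σ : ℝ} (hσ : σ ∈ S) : ζ σ ∈ W :=
  H.Icc_subset σ hσ ⟨(H.a_lt σ hσ).le, le_rfl⟩

theorem strictMonoOn_gibbs (H : WellBranch F W V S a ζ z) {σ : ℝ} (hσ : σ ∈ S) :
    StrictMonoOn (gibbs F σ) (Icc (a σ) (ζ σ)) := by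
  have hd : ∀ x ∈ Icc (a σ) (ζ σ), HasDerivAt (gibbs F σ) (deriv F x - σ) x :=
    fun x hx => hasDerivAt_gibbs (H.differentiableAt (H.Icc_subset σ hσ hx))
  refine strictMonoOn_of_deriv_pos (convex_Icc _ _)
    (fun x hx => (hd x hx).continuousAt.continuousWithinAt) fun x hx => ?_
  rw [interior_Icc] at hx
  rw [(hd x (Ioo_subset_Icc_self hx)).deriv]
  exact sub_pos.2 (H.slope σ hσ x hx)

theorem hasDerivAt_a (H : WellBranch F W V S a ζ z) {σ : ℝ} (hσ : σ ∈ S) :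
    HasDerivAt a (deriv (deriv F) (a σ))⁻¹ σ := by
  refine HasDerivAt.of_local_left_inverse (H.a_cont.continuousAt (H.isOpen_S.mem_nhds hσ))
    (H.hasDerivAt_deriv (H.a_mem_W hσ)) (H.convex _ (H.a_mem σ hσ)).ne' ?_
  filter_upwards [H.isOpen_S.mem_nhds hσ] with s hs using H.deriv_a s hs

/-- Envelope theorem: the terms containing the derivative of `a` cancel because `a σ` is critical
for `Φ_σ`, leaving the explicit dependence on `σ`. -/
theorem hasDerivAt_bottom (H : WellBranch F W V S a ζ z) {σ : ℝ} (hσ : σ ∈ S) :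
    HasDerivAt (fun s => gibbs F s (a s)) (-a σ) σ := by
  have h1 := (H.differentiableAt (H.a_mem_W hσ)).hasDerivAt.comp σ (H.hasDerivAt_a hσ)
  have h2 := h1.sub ((hasDerivAt_id σ).mul (H.hasDerivAt_a hσ))
  refine h2.congr_deriv ?_
  simp only [id, H.deriv_a σ hσ]
  ring

theorem contDiffOn_a (H : WellBranch F W V S a ζ z) : ContDiffOn ℝ 1 a S := by
  have : ContDiffOn ℝ (0 + 1) a S := by
    rw [contDiffOn_succ_iff_deriv_of_isOpen H.isOpen_S]
    refine ⟨fun σ hσ => (H.hasDerivAt_a hσ).differentiableAt.differentiableWithinAt, by simp, ?_⟩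
    rw [contDiffOn_zero]
    refine ContinuousOn.congr ?_ fun σ hσ => (H.hasDerivAt_a hσ).deriv
    refine (H.contDiffOn_deriv2.continuousOn.comp H.a_cont fun σ hσ => H.a_mem_W hσ).inv₀ ?_
    exact fun σ hσ => (H.convex _ (H.a_mem σ hσ)).ne'
  simpa using this

theorem contDiffOn_bottom (H : WellBranch F W V S a ζ z) :
    ContDiffOn ℝ 1 (fun s => gibbs F s (a s)) S := by
  have h1 : ContDiffOn ℝ 1 (fun s => F (a s)) S :=
    (H.contDiffOn.of_le (by norm_num)).comp H.contDiffOn_a fun σ hσ => H.a_mem_W hσ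
  exact h1.sub (contDiffOn_id.mul H.contDiffOn_a)

theorem continuousOn_top (H : WellBranch F W V S a ζ z) :
    ContinuousOn (fun s => gibbs F s (ζ s)) S := by
  have h1 : ContinuousOn (fun s => F (ζ s)) S :=
    H.contDiffOn.continuousOn.comp H.ζ_cont fun σ hσ => H.ζ_mem_W hσ
  exact h1.sub (continuousOn_id.mul H.ζ_cont)

theorem isOpen_wellRegion (H : WellBranch F W V S a ζ z) : IsOpen (wellRegion F S a ζ) := by
  have hS : IsOpen {p : ℝ × ℝ | p.1 ∈ S} := H.isOpen_S.preimage continuous_fst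
  have h1 : ContinuousOn (fun p : ℝ × ℝ => p.2 - gibbs F p.1 (a p.1)) {p | p.1 ∈ S} :=
    continuousOn_snd.sub (H.contDiffOn_bottom.continuousOn.comp continuousOn_fst fun p hp => hp)
  have h2 : ContinuousOn (fun p : ℝ × ℝ => gibbs F p.1 (ζ p.1) - p.2) {p | p.1 ∈ S} :=
    (H.continuousOn_top.comp continuousOn_fst fun p hp => hp).sub continuousOn_snd
  have := (h1.isOpen_inter_preimage hS isOpen_Ioi (t := Ioi 0)).inter
    (h2.isOpen_inter_preimage hS isOpen_Ioi (t := Ioi 0))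
  convert this using 1
  ext p
  simp only [wellRegion, mem_ofPred_eq, mem_inter_iff, mem_preimage, mem_Ioi, sub_pos]
  tauto

theorem z_mem_Ioo (H : WellBranch F W V S a ζ z) {p : ℝ × ℝ} (hp : p ∈ wellRegion F S a ζ) :
    z p ∈ Ioo (a p.1) (ζ p.1) := by
  obtain ⟨hσ, h1, h2⟩ := hp
  have hm := H.z_mem p.1 hσ p.2 ⟨h1.le, h2.le⟩
  have he := H.z_eq p.1 hσ p.2 ⟨h1.le, h2.le⟩
  refine ⟨lt_of_le_of_ne hm.1 fun h => ?_, lt_of_le_of_ne hm.2 fun h => ?_⟩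
  · rw [← h] at he; exact h1.ne he
  · rw [h] at he; exact h2.ne he.symm

theorem gibbs_z (H : WellBranch F W V S a ζ z) {p : ℝ × ℝ} (hp : p ∈ wellRegion F S a ζ) :
    gibbs F p.1 (z p) = p.2 :=
  H.z_eq p.1 hp.1 p.2 ⟨hp.2.1.le, hp.2.2.le⟩

theorem slope_z (H : WellBranch F W V S a ζ z) {p : ℝ × ℝ} (hp : p ∈ wellRegion F S a ζ) :
    0 < deriv F (z p) - p.1 :=
  sub_pos.2 (H.slope p.1 hp.1 _ (H.z_mem_Ioo hp))

theorem z_mem_W (H : WellBranch F W V S a ζ z) {p : ℝ × ℝ} (hp : p ∈ wellRegion F S a ζ) :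
    z p ∈ W :=
  H.Icc_subset p.1 hp.1 (Ioo_subset_Icc_self (H.z_mem_Ioo hp))

theorem continuousOn_z (H : WellBranch F W V S a ζ z) : ContinuousOn z (wellRegion F S a ζ) :=
  H.z_cont.mono fun _ hp => ⟨hp.1, hp.2.1.le, hp.2.2.le⟩

/-- The map `p ↦ (p.1, z p)` is a continuous right inverse of `(σ, x) ↦ (σ, Φ_σ(x))`, whose
derivative is invertible as long as the slope of `Φ_σ` is nonzero. -/
theorem hasFDerivAt_z (H : WellBranch F W V S a ζ z) {p : ℝ × ℝ} (hp : p ∈ wellRegion F S a ζ) :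
    HasFDerivAt z ((deriv F (z p) - p.1)⁻¹ •
      (z p • ContinuousLinearMap.fst ℝ ℝ ℝ + ContinuousLinearMap.snd ℝ ℝ ℝ)) p := by
  set q := deriv F (z p) - p.1 with hq
  have hq0 : q ≠ 0 := (H.slope_z hp).ne'
  -- The derivative is triangular with diagonal entries `1` and `q`, so its inverse can be written
  -- down.
  let e : (ℝ × ℝ) ≃L[ℝ] (ℝ × ℝ) := ContinuousLinearEquiv.equivOfInverse
    ((ContinuousLinearMap.fst ℝ ℝ ℝ).prod
      (q • ContinuousLinearMap.snd ℝ ℝ ℝ - z p • ContinuousLinearMap.fst ℝ ℝ ℝ))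
    ((ContinuousLinearMap.fst ℝ ℝ ℝ).prod
      (q⁻¹ • (z p • ContinuousLinearMap.fst ℝ ℝ ℝ + ContinuousLinearMap.snd ℝ ℝ ℝ)))
    (fun x => by ext <;> simp <;> field_simp <;> ring)
    (fun x => by ext <;> simp <;> field_simp <;> ring)
  have hO := H.isOpen_wellRegion.mem_nhds hp
  have hT : HasFDerivAt (fun x : ℝ × ℝ => (x.1, gibbs F x.1 x.2)) (e : ℝ × ℝ →L[ℝ] ℝ × ℝ)
      (p.1, z p) := by
    refine hasFDerivAt_fst.prodMk ?_
    have h1 : HasFDerivAt (fun x : ℝ × ℝ => F x.2) _ (p.1, z p) :=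
      (H.differentiableAt (H.z_mem_W hp)).hasDerivAt.comp_hasFDerivAt (f := Prod.snd) (p.1, z p)
        (hasFDerivAt_snd_real _)
    have h2 : HasFDerivAt (fun x : ℝ × ℝ => x.1 * x.2) _ (p.1, z p) :=
      (hasFDerivAt_fst_real _).mul (hasFDerivAt_snd_real _)
    refine (h1.sub h2).congr_fderiv ?_
    ext <;> simp [hq]
  have hz : ContinuousAt (fun x : ℝ × ℝ => (x.1, z x)) p :=
    continuousAt_fst.prodMk (H.continuousOn_z.continuousAt hO)
  have := HasFDerivAt.of_local_left_inverse (g := fun x : ℝ × ℝ => (x.1, z x)) (a := p) hz hT (by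
    filter_upwards [hO] with x hx
    exact Prod.ext rfl (H.gibbs_z hx))
  exact (hasFDerivAt_snd.comp p this)

theorem contDiffOn_z (H : WellBranch F W V S a ζ z) : ContDiffOn ℝ 1 z (wellRegion F S a ζ) := by
  refine contDiffOn_one_of_hasFDerivAt H.isOpen_wellRegion (fun p hp => H.hasFDerivAt_z hp) ?_
  have h1 : ContinuousOn (fun p : ℝ × ℝ => (deriv F (z p) - p.1)⁻¹) (wellRegion F S a ζ) :=
    ((H.contDiffOn_deriv.continuousOn.comp H.continuousOn_z fun p hp => H.z_mem_W hp).sub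
      continuousOn_fst).inv₀ fun p hp => (H.slope_z hp).ne'
  exact h1.smul ((H.continuousOn_z.smul continuousOn_const).add continuousOn_const)

theorem heightRegion_mapsTo (p : ℝ × ℝ) (hp : p ∈ heightRegion F S a ζ) :
    (p.1, gibbs F p.1 (a p.1) + p.2) ∈ wellRegion F S a ζ :=
  ⟨hp.1, by simpa using hp.2.1, hp.2.2⟩

theorem isOpen_heightRegion (H : WellBranch F W V S a ζ z) : IsOpen (heightRegion F S a ζ) := by
  have hS : IsOpen {p : ℝ × ℝ | p.1 ∈ S} := H.isOpen_S.preimage continuous_fst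
  have h1 : ContinuousOn (fun p : ℝ × ℝ => (p.1, gibbs F p.1 (a p.1) + p.2)) {p | p.1 ∈ S} :=
    continuousOn_fst.prodMk
      ((H.contDiffOn_bottom.continuousOn.comp continuousOn_fst fun p hp => hp).add continuousOn_snd)
  convert h1.isOpen_inter_preimage hS H.isOpen_wellRegion using 1
  ext p
  simp only [wellRegion, heightRegion, mem_ofPred_eq, mem_inter_iff, mem_preimage,
    lt_add_iff_pos_right]
  tauto

/-- The reason for the coordinate `h`: the bottom moves at rate `-a σ`, so at fixed height the
`σ`-derivative has numerator `z - a` instead of `z`. It vanishes at the bottom at the same rate as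
the denominator, so only the `h`-derivative is singular there. -/
theorem hasFDerivAt_heightBranch (H : WellBranch F W V S a ζ z) {p : ℝ × ℝ}
    (hp : p ∈ heightRegion F S a ζ) :
    HasFDerivAt (heightBranch F a z) ((deriv F (heightBranch F a z p) - p.1)⁻¹ •
      ((heightBranch F a z p - a p.1) • ContinuousLinearMap.fst ℝ ℝ ℝ +
        ContinuousLinearMap.snd ℝ ℝ ℝ)) p := by
  have h1 : HasFDerivAt (fun x : ℝ × ℝ => gibbs F x.1 (a x.1)) _ p :=
    (H.hasDerivAt_bottom hp.1).comp_hasFDerivAt (f := Prod.fst) p (hasFDerivAt_fst_real p)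
  have h2 := (hasFDerivAt_fst (𝕜 := ℝ) (p := p)).prodMk (h1.add hasFDerivAt_snd)
  have h3 := (H.hasFDerivAt_z (heightRegion_mapsTo p hp)).comp p h2
  refine h3.congr_fderiv ?_
  ext <;> simp [heightBranch]; ring

theorem contDiffOn_heightBranch (H : WellBranch F W V S a ζ z) :
    ContDiffOn ℝ 1 (heightBranch F a z) (heightRegion F S a ζ) := by
  refine H.contDiffOn_z.comp ?_ heightRegion_mapsTo
  exact contDiffOn_fst.prodMk
    ((H.contDiffOn_bottom.comp contDiffOn_fst fun p hp => hp.1).add contDiffOn_snd)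

end WellBranch

end

noncomputable section

/-! ### Uniform Taylor estimates -/

/-- The induction step for Taylor remainders: the `t`-derivative of a remainder based at `u` is the
remainder of `f'` of one order less. The constant is uniform in the base point, as needed for
expansions at the moving bottom `a σ`. -/
theorem exists_abs_sub_le_of_deriv_le {G G' : ℝ → ℝ → ℝ} {x₀ ρ C : ℝ} {k : ℕ}
    (hd : ∀ u ∈ Metric.ball x₀ ρ, ∀ t ∈ Metric.ball x₀ ρ, HasDerivAt (G u) (G' u t) t)
    (hb : ∀ u ∈ Metric.ball x₀ ρ, ∀ t ∈ Metric.ball x₀ ρ, |G' u t| ≤ C * |t - u| ^ k)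
    (h0 : ∀ u, G u u = 0) {u t : ℝ} (hu : u ∈ Metric.ball x₀ ρ) (ht : t ∈ Metric.ball x₀ ρ) :
    |G u t| ≤ C * |t - u| ^ (k + 1) := by
  by_cases htu : t = u
  · subst htu; simp [h0]
  have hC : 0 ≤ C := by
    have h1 : 0 < |t - u| ^ k := pow_pos (abs_pos.2 (sub_ne_zero.2 htu)) k
    exact nonneg_of_mul_nonneg_left ((abs_nonneg _).trans (hb u hu t ht)) h1
  have hseg : uIcc u t ⊆ Metric.ball x₀ ρ := by
    rw [← segment_eq_uIcc]
    exact (convex_ball x₀ ρ).segment_subset hu ht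
  have := (convex_uIcc u t).norm_image_sub_le_of_norm_hasDerivWithin_le
    (f := G u) (f' := G' u) (C := C * |t - u| ^ k)
    (fun s hs => (hd u hu s (hseg hs)).hasDerivWithinAt) (fun s hs => ?_) left_mem_uIcc right_mem_uIcc
  · rw [h0, sub_zero, Real.norm_eq_abs, Real.norm_eq_abs] at this
    rw [pow_succ, ← mul_assoc]
    exact this
  · refine (hb u hu s (hseg hs)).trans (mul_le_mul_of_nonneg_left ?_ hC)
    exact pow_le_pow_left₀ (abs_nonneg _) (abs_sub_left_of_mem_uIcc hs) k

section Taylor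

variable {f f1 f2 f3 : ℝ → ℝ} {x₀ : ℝ}

theorem exists_taylor_one (hc : ContinuousAt f1 x₀)
    (h1 : ∀ᶠ t in 𝓝 x₀, HasDerivAt f (f1 t) t) :
    ∃ C ρ, 0 < ρ ∧ ∀ u ∈ Metric.ball x₀ ρ, ∀ t ∈ Metric.ball x₀ ρ,
      |f t - f u| ≤ C * |t - u| := by
  have hb : ∀ᶠ t in 𝓝 x₀, |f1 t| ≤ |f1 x₀| + 1 :=
    (hc.abs.eventually_lt_const (lt_add_one _)).mono fun t ht => ht.le
  obtain ⟨ρ, hρ, h⟩ := Metric.eventually_nhds_iff_ball.1 (h1.and hb)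
  refine ⟨|f1 x₀| + 1, ρ, hρ, fun u hu t ht => ?_⟩
  have := exists_abs_sub_le_of_deriv_le (G := fun u t => f t - f u) (G' := fun _ t => f1 t)
    (k := 0) (C := |f1 x₀| + 1) (fun u _ t ht => ((h t ht).1.sub_const _))
    (fun u _ t ht => by simpa using (h t ht).2) (by simp) hu ht
  simpa using this

theorem exists_taylor_two (hc : ContinuousAt f2 x₀)
    (h1 : ∀ᶠ t in 𝓝 x₀, HasDerivAt f (f1 t) t) (h2 : ∀ᶠ t in 𝓝 x₀, HasDerivAt f1 (f2 t) t) :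
    ∃ C ρ, 0 < ρ ∧ ∀ u ∈ Metric.ball x₀ ρ, ∀ t ∈ Metric.ball x₀ ρ,
      |f t - f u - f1 u * (t - u)| ≤ C * |t - u| ^ 2 := by
  obtain ⟨C, ρ, hρ, h⟩ := exists_taylor_one hc h2
  obtain ⟨ρ', hρ', h'⟩ := Metric.eventually_nhds_iff_ball.1 h1
  refine ⟨C, min ρ ρ', lt_min hρ hρ', fun u hu t ht => ?_⟩
  have hs : Metric.ball x₀ (min ρ ρ') ⊆ Metric.ball x₀ ρ := Metric.ball_subset_ball (min_le_left _ _)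
  have hs' : Metric.ball x₀ (min ρ ρ') ⊆ Metric.ball x₀ ρ' :=
    Metric.ball_subset_ball (min_le_right _ _)
  refine exists_abs_sub_le_of_deriv_le (G := fun u t => f t - f u - f1 u * (t - u))
    (G' := fun u t => f1 t - f1 u) (k := 1) (fun u _ t ht => ?_)
    (fun u hu t ht => by simpa using h u (hs hu) t (hs ht)) (by simp) hu ht
  refine (((h' t (hs' ht)).sub_const (f u)).sub
    (((hasDerivAt_id t).sub_const u).const_mul (f1 u))).congr_deriv ?_
  simp

theorem exists_taylor_three (hc : ContinuousAt f3 x₀)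
    (h1 : ∀ᶠ t in 𝓝 x₀, HasDerivAt f (f1 t) t) (h2 : ∀ᶠ t in 𝓝 x₀, HasDerivAt f1 (f2 t) t)
    (h3 : ∀ᶠ t in 𝓝 x₀, HasDerivAt f2 (f3 t) t) :
    ∃ C ρ, 0 < ρ ∧ ∀ u ∈ Metric.ball x₀ ρ, ∀ t ∈ Metric.ball x₀ ρ,
      |f t - f u - f1 u * (t - u) - f2 u / 2 * (t - u) ^ 2| ≤ C * |t - u| ^ 3 := by
  obtain ⟨C, ρ, hρ, h⟩ := exists_taylor_two hc h2 h3
  obtain ⟨ρ', hρ', h'⟩ := Metric.eventually_nhds_iff_ball.1 h1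
  refine ⟨C, min ρ ρ', lt_min hρ hρ', fun u hu t ht => ?_⟩
  have hs : Metric.ball x₀ (min ρ ρ') ⊆ Metric.ball x₀ ρ := Metric.ball_subset_ball (min_le_left _ _)
  have hs' : Metric.ball x₀ (min ρ ρ') ⊆ Metric.ball x₀ ρ' :=
    Metric.ball_subset_ball (min_le_right _ _)
  refine exists_abs_sub_le_of_deriv_le
    (G := fun u t => f t - f u - f1 u * (t - u) - f2 u / 2 * (t - u) ^ 2)
    (G' := fun u t => f1 t - f1 u - f2 u * (t - u)) (k := 2) (fun u _ t ht => ?_)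
    (fun u hu t ht => h u (hs hu) t (hs ht)) (by simp) hu ht
  have e1 := ((h' t (hs' ht)).sub_const (f u)).sub
    (((hasDerivAt_id t).sub_const u).const_mul (f1 u))
  have e2 := (((hasDerivAt_id t).sub_const u).pow 2).const_mul (f2 u / 2)
  refine (e1.sub e2).congr_deriv ?_
  simp
  ring

variable {ι : Type*} {l : Filter ι} {x u : ι → ℝ}

theorem isBigO_taylor_two (hx : Tendsto x l (𝓝 x₀)) (hu : Tendsto u l (𝓝 x₀))
    (hc : ContinuousAt f2 x₀) (h1 : ∀ᶠ t in 𝓝 x₀, HasDerivAt f (f1 t) t)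
    (h2 : ∀ᶠ t in 𝓝 x₀, HasDerivAt f1 (f2 t) t) :
    (fun i => f (x i) - f (u i) - f1 (u i) * (x i - u i)) =O[l] fun i => (x i - u i) ^ 2 := by
  obtain ⟨C, ρ, hρ, h⟩ := exists_taylor_two hc h1 h2
  refine IsBigO.of_bound C ?_
  filter_upwards [hx (Metric.ball_mem_nhds _ hρ), hu (Metric.ball_mem_nhds _ hρ)] with i h1 h2
  rw [norm_pow]
  exact h _ h2 _ h1

theorem isBigO_taylor_three (hx : Tendsto x l (𝓝 x₀)) (hu : Tendsto u l (𝓝 x₀))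
    (hc : ContinuousAt f3 x₀) (h1 : ∀ᶠ t in 𝓝 x₀, HasDerivAt f (f1 t) t)
    (h2 : ∀ᶠ t in 𝓝 x₀, HasDerivAt f1 (f2 t) t) (h3 : ∀ᶠ t in 𝓝 x₀, HasDerivAt f2 (f3 t) t) :
    (fun i => f (x i) - f (u i) - f1 (u i) * (x i - u i) - f2 (u i) / 2 * (x i - u i) ^ 2)
      =O[l] fun i => (x i - u i) ^ 3 := by
  obtain ⟨C, ρ, hρ, h⟩ := exists_taylor_three hc h1 h2 h3
  refine IsBigO.of_bound C ?_
  filter_upwards [hx (Metric.ball_mem_nhds _ hρ), hu (Metric.ball_mem_nhds _ hρ)] with i h1 h2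
  rw [norm_pow]
  exact h _ h2 _ h1

end Taylor

/-! ### Functions with a common limit that agree up to `O(y)` -/

/-- `f` and `f₀` tend to `L` and differ by `O(y)`. -/
structure AgreeUpTo {ι : Type*} (l : Filter ι) (y f f₀ : ι → ℝ) (L : ℝ) : Prop where
  left : Tendsto f l (𝓝 L)
  right : Tendsto f₀ l (𝓝 L)
  isBigO : (fun i => f i - f₀ i) =O[l] y

namespace AgreeUpTo

variable {ι : Type*} {l : Filter ι} {y f f₀ g g₀ : ι → ℝ} {L M : ℝ}

theorem of_isBigO (hy : Tendsto y l (𝓝 0)) (h : Tendsto f₀ l (𝓝 L))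
    (hO : (fun i => f i - f₀ i) =O[l] y) : AgreeUpTo l y f f₀ L := by
  refine ⟨?_, h, hO⟩
  simpa using (hO.trans_tendsto hy).add h

theorem refl (y : ι → ℝ) (h : Tendsto f l (𝓝 L)) : AgreeUpTo l y f f L :=
  ⟨h, h, by simpa using isBigO_zero y l⟩

theorem mul (hf : AgreeUpTo l y f f₀ L) (hg : AgreeUpTo l y g g₀ M) :
    AgreeUpTo l y (fun i => f i * g i) (fun i => f₀ i * g₀ i) (L * M) := by
  refine ⟨hf.left.mul hg.left, hf.right.mul hg.right, ?_⟩
  have h1 := hf.isBigO.mul (hg.left.isBigO_one ℝ)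
  have h2 := (hf.right.isBigO_one ℝ).mul hg.isBigO
  simp only [mul_one, one_mul] at h1 h2
  exact (h1.add h2).congr_left fun i => by ring

theorem sub (hf : AgreeUpTo l y f f₀ L) (hg : AgreeUpTo l y g g₀ M) :
    AgreeUpTo l y (fun i => f i - g i) (fun i => f₀ i - g₀ i) (L - M) := by
  refine ⟨hf.left.sub hg.left, hf.right.sub hg.right, ?_⟩
  exact (hf.isBigO.sub hg.isBigO).congr_left fun i => by ring

/-- A C¹ function is strictly differentiable, hence Lipschitz near `L`. With products and
differences this lets whole expressions be compared with their values at the bottom without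
expanding them. -/
theorem comp (hf : AgreeUpTo l y f f₀ L) {φ : ℝ → ℝ} (hφ : ContDiffAt ℝ 1 φ L) :
    AgreeUpTo l y (fun i => φ (f i)) (fun i => φ (f₀ i)) (φ L) := by
  refine ⟨hφ.continuousAt.tendsto.comp hf.left, hφ.continuousAt.tendsto.comp hf.right, ?_⟩
  have h1 := (hφ.hasStrictFDerivAt (by norm_num)).isBigO_sub
  exact (h1.comp_tendsto (hf.left.prodMk_nhds hf.right)).trans hf.isBigO

theorem inv (hf : AgreeUpTo l y f f₀ L) (hL : L ≠ 0) :
    AgreeUpTo l y (fun i => (f i)⁻¹) (fun i => (f₀ i)⁻¹) L⁻¹ :=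
  hf.comp (contDiffAt_inv ℝ hL)

theorem sqrt (hf : AgreeUpTo l y f f₀ L) (hL : L ≠ 0) :
    AgreeUpTo l y (fun i => √(f i)) (fun i => √(f₀ i)) √L :=
  hf.comp (Real.contDiffAt_sqrt hL)

end AgreeUpTo

end

/-! ### Expansions at the bottom of a well. -/

noncomputable section

/-- The density `g / Φ_σ'` on the branch, as a function of `(σ, h)`. -/
def branchDensity (F : ℝ → ℝ) (a : ℝ → ℝ) (z : ℝ × ℝ → ℝ) (g : ℝ → ℝ) (p : ℝ × ℝ) : ℝ :=
  g (heightBranch F a z p) / (deriv F (heightBranch F a z p) - p.1)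

/-- The coefficient `g / √(2F'')` of the logarithm. -/
def logCoeff (F g : ℝ → ℝ) (x : ℝ) : ℝ := g x / √(2 * deriv (deriv F) x)

/-- The derivative of `logCoeff`. -/
def logCoeffDeriv (F g : ℝ → ℝ) (x : ℝ) : ℝ :=
  deriv g x / √(2 * deriv (deriv F) x) -
    g x * deriv (deriv (deriv F)) x / (2 * deriv (deriv F) x * √(2 * deriv (deriv F) x))

namespace WellBranch

variable {F : ℝ → ℝ} {W V S : Set ℝ} {a ζ : ℝ → ℝ} {z : ℝ × ℝ → ℝ} {g : ℝ → ℝ}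

theorem slope_heightBranch (H : WellBranch F W V S a ζ z) {p : ℝ × ℝ}
    (hp : p ∈ heightRegion F S a ζ) : 0 < deriv F (heightBranch F a z p) - p.1 :=
  H.slope_z (heightRegion_mapsTo p hp)

theorem heightBranch_mem_W (H : WellBranch F W V S a ζ z) {p : ℝ × ℝ}
    (hp : p ∈ heightRegion F S a ζ) : heightBranch F a z p ∈ W :=
  H.z_mem_W (heightRegion_mapsTo p hp)

theorem contDiffOn_branchDensity (H : WellBranch F W V S a ζ z) (hg : ContDiff ℝ 2 g) :
    ContDiffOn ℝ 1 (branchDensity F a z g) (heightRegion F S a ζ) := by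
  refine ContDiffOn.div ?_ ?_ fun p hp => (H.slope_heightBranch hp).ne'
  · exact (hg.of_le (by norm_num)).comp_contDiffOn H.contDiffOn_heightBranch
  · exact ((H.contDiffOn_deriv.of_le (by norm_num)).comp H.contDiffOn_heightBranch
      fun p hp => H.heightBranch_mem_W hp).sub contDiffOn_fst

theorem hasDerivAt_logCoeff (H : WellBranch F W V S a ζ z) (hg : ContDiff ℝ 2 g) {x : ℝ}
    (hx : x ∈ V) : HasDerivAt (logCoeff F g) (logCoeffDeriv F g x) x := by
  have hpos : 0 < 2 * deriv (deriv F) x := by have := H.convex x hx; linarith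
  have hs := Real.sqrt_pos.2 hpos
  have h1 := ((hg.differentiable (by norm_num)) x).hasDerivAt.div
    (((H.hasDerivAt_deriv2 (H.V_subset hx)).const_mul 2).sqrt hpos.ne') hs.ne'
  refine h1.congr_deriv ?_
  have hsq : √(2 * deriv (deriv F) x) ^ 2 = 2 * deriv (deriv F) x := Real.sq_sqrt hpos.le
  rw [logCoeffDeriv, ← hsq]
  generalize √(2 * deriv (deriv F) x) = s at *
  rw [Real.sqrt_sq hs.le]
  field_simp

theorem contDiffOn_logCoeff (H : WellBranch F W V S a ζ z) (hg : ContDiff ℝ 2 g) :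
    ContDiffOn ℝ 1 (logCoeff F g) V := by
  have hpos : ∀ x ∈ V, 0 < 2 * deriv (deriv F) x := fun x hx => by
    have := H.convex x hx; linarith
  refine ContDiffOn.div (hg.of_le (by norm_num)).contDiffOn (ContDiffOn.sqrt
    (contDiffOn_const.mul ((H.contDiffOn_deriv2.of_le (by norm_num)).mono H.V_subset))
    fun x hx => (hpos x hx).ne') fun x hx => (Real.sqrt_pos.2 (hpos x hx)).ne'

theorem hasFDerivAt_branchDensity (H : WellBranch F W V S a ζ z) (hg : ContDiff ℝ 2 g)
    {p : ℝ × ℝ} (hp : p ∈ heightRegion F S a ζ) {x q : ℝ} (hx : heightBranch F a z p = x)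
    (hq : deriv F x - p.1 = q) :
    fderiv ℝ (branchDensity F a z g) p (1, 0) =
        deriv g x * (x - a p.1) / q ^ 2 -
          g x * (deriv (deriv F) x * (x - a p.1) - q) / q ^ 3 ∧
      fderiv ℝ (branchDensity F a z g) p (0, 1) =
        deriv g x / q ^ 2 - g x * deriv (deriv F) x / q ^ 3 := by
  have hq0 : 0 < q := by rw [← hq, ← hx]; exact H.slope_heightBranch hp
  have hb := H.hasFDerivAt_heightBranch hp
  have h1 := ((hg.differentiable (by norm_num)) (heightBranch F a z p)).hasDerivAt.comp_hasFDerivAt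
    (f := heightBranch F a z) p hb
  have h2 := ((H.hasDerivAt_deriv (H.heightBranch_mem_W hp)).comp_hasFDerivAt
    (f := heightBranch F a z) p hb).sub (hasFDerivAt_fst_real p)
  have h3 := (hasDerivAt_inv (H.slope_heightBranch hp).ne').comp_hasFDerivAt
    (f := fun p => deriv F (heightBranch F a z p) - p.1) p h2
  have h4 : HasFDerivAt (branchDensity F a z g) _ p :=
    (h1.mul h3).congr_of_eventuallyEq (Eventually.of_forall fun p => div_eq_mul_inv _ _)
  rw [h4.fderiv]
  simp only [Function.comp_apply, hx, hq]
  constructor <;> simp <;> field_simp <;> ring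

theorem fderiv_comp_heightBranch (H : WellBranch F W V S a ζ z) {φ : ℝ → ℝ} {φ' : ℝ}
    {p : ℝ × ℝ} (hp : p ∈ heightRegion F S a ζ)
    (hφ : HasDerivAt φ φ' (heightBranch F a z p)) {x q : ℝ} (hx : heightBranch F a z p = x)
    (hq : deriv F x - p.1 = q) :
    fderiv ℝ (fun p => φ (heightBranch F a z p)) p (1, 0) = φ' * (x - a p.1) / q ∧
      fderiv ℝ (fun p => φ (heightBranch F a z p)) p (0, 1) = φ' / q := by
  have hb := H.hasFDerivAt_heightBranch hp
  have h1 : HasFDerivAt (fun p => φ (heightBranch F a z p)) _ p :=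
    hφ.comp_hasFDerivAt (f := heightBranch F a z) p hb
  rw [h1.fderiv]
  simp only [hx, hq]
  constructor <;> simp <;> field_simp

variable {σ₀ : ℝ}

theorem eventually_mem_heightRegion (H : WellBranch F W V S a ζ z) (hσ : σ₀ ∈ S) :
    ∀ᶠ p in 𝓝[{p : ℝ × ℝ | 0 < p.2}] (σ₀, 0), p ∈ heightRegion F S a ζ := by
  have hS : {p : ℝ × ℝ | p.1 ∈ S} ∈ 𝓝 (σ₀, (0 : ℝ)) :=
    (H.isOpen_S.preimage continuous_fst).mem_nhds hσ
  have hc : ContinuousAt (fun p : ℝ × ℝ => gibbs F p.1 (ζ p.1) - (gibbs F p.1 (a p.1) + p.2))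
      (σ₀, 0) := by
    have h1 : ContinuousOn (fun p : ℝ × ℝ => gibbs F p.1 (ζ p.1) - (gibbs F p.1 (a p.1) + p.2))
        {p | p.1 ∈ S} :=
      (H.continuousOn_top.comp continuousOn_fst fun p hp => hp).sub
        ((H.contDiffOn_bottom.continuousOn.comp continuousOn_fst fun p hp => hp).add
          continuousOn_snd)
    exact h1.continuousAt hS
  have hlt : 0 < gibbs F σ₀ (ζ σ₀) - (gibbs F σ₀ (a σ₀) + 0) := by
    rw [add_zero, sub_pos]
    exact H.strictMonoOn_gibbs hσ ⟨le_rfl, (H.a_lt σ₀ hσ).le⟩ ⟨(H.a_lt σ₀ hσ).le, le_rfl⟩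
      (H.a_lt σ₀ hσ)
  filter_upwards [self_mem_nhdsWithin, nhdsWithin_le_nhds hS,
    nhdsWithin_le_nhds (hc.eventually_const_lt hlt)] with p h1 h2 h3
  exact ⟨h2, h1, sub_pos.1 h3⟩

theorem z_bottom (H : WellBranch F W V S a ζ z) {σ : ℝ} (hσ : σ ∈ S) :
    z (σ, gibbs F σ (a σ)) = a σ := by
  have hle := (H.a_lt σ hσ).le
  have hmem : gibbs F σ (a σ) ∈ Icc (gibbs F σ (a σ)) (gibbs F σ (ζ σ)) :=
    ⟨le_rfl, (H.strictMonoOn_gibbs hσ).monotoneOn ⟨le_rfl, hle⟩ ⟨hle, le_rfl⟩ hle⟩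
  exact (H.strictMonoOn_gibbs hσ).injOn (H.z_mem σ hσ _ hmem) ⟨le_rfl, hle⟩ (H.z_eq σ hσ _ hmem)

theorem tendsto_heightBranch (H : WellBranch F W V S a ζ z) (hσ : σ₀ ∈ S) :
    Tendsto (heightBranch F a z) (𝓝[{p : ℝ × ℝ | 0 < p.2}] (σ₀, 0)) (𝓝 (a σ₀)) := by
  have hle := (H.a_lt σ₀ hσ).le
  have hmem : gibbs F σ₀ (a σ₀) ∈ Icc (gibbs F σ₀ (a σ₀)) (gibbs F σ₀ (ζ σ₀)) :=
    ⟨le_rfl, (H.strictMonoOn_gibbs hσ).monotoneOn ⟨le_rfl, hle⟩ ⟨hle, le_rfl⟩ hle⟩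
  have h1 := H.z_cont (σ₀, gibbs F σ₀ (a σ₀)) ⟨hσ, hmem⟩
  rw [ContinuousWithinAt, H.z_bottom hσ] at h1
  refine h1.comp (tendsto_nhdsWithin_iff.2 ⟨?_, ?_⟩)
  · have hS : {p : ℝ × ℝ | p.1 ∈ S} ∈ 𝓝 (σ₀, (0 : ℝ)) :=
      (H.isOpen_S.preimage continuous_fst).mem_nhds hσ
    have hc : ContinuousOn (fun p : ℝ × ℝ => (p.1, gibbs F p.1 (a p.1) + p.2)) {p | p.1 ∈ S} :=
      continuousOn_fst.prodMk
        ((H.contDiffOn_bottom.continuousOn.comp continuousOn_fst fun p hp => hp).add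
          continuousOn_snd)
    have := (hc.continuousAt hS).tendsto
    simp only [add_zero] at this
    exact this.mono_left nhdsWithin_le_nhds
  · filter_upwards [H.eventually_mem_heightRegion hσ] with p hp
    exact ⟨hp.1, by simpa using hp.2.1.le, hp.2.2.le⟩

/-- The expansions, up to a relative error `O(y)`, of the quantities in terms of
`y = z - a(σ)`. -/
theorem agreeUpTo_expansions (H : WellBranch F W V S a ζ z) (hσ : σ₀ ∈ S)
    {l : Filter (ℝ × ℝ)} (hl : l = 𝓝[{p : ℝ × ℝ | 0 < p.2}] (σ₀, 0))
    {x y : ℝ × ℝ → ℝ} (hx : x = heightBranch F a z) (hy : y = fun p => x p - a p.1) :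
    (∀ᶠ p in l, 0 < y p) ∧ Tendsto y l (𝓝 0) ∧ Tendsto x l (𝓝 (a σ₀)) ∧
      Tendsto (fun p : ℝ × ℝ => a p.1) l (𝓝 (a σ₀)) ∧
      AgreeUpTo l y (fun p => (deriv F (x p) - p.1) / y p) (fun p => deriv (deriv F) (a p.1))
        (deriv (deriv F) (a σ₀)) ∧
      AgreeUpTo l y (fun p => p.2 / y p ^ 2) (fun p => deriv (deriv F) (a p.1) / 2)
        (deriv (deriv F) (a σ₀) / 2) ∧
      AgreeUpTo l y (fun p => (deriv (deriv F) (x p) - (deriv F (x p) - p.1) / y p) / y p)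
        (fun p => deriv (deriv (deriv F)) (a p.1) / 2)
        (deriv (deriv (deriv F)) (a σ₀) / 2) := by
  have hmem : ∀ᶠ p in l, p ∈ heightRegion F S a ζ := hl ▸ H.eventually_mem_heightRegion hσ
  have hxl : Tendsto x l (𝓝 (a σ₀)) := by rw [hx, hl]; exact H.tendsto_heightBranch hσ
  have hal : Tendsto (fun p : ℝ × ℝ => a p.1) l (𝓝 (a σ₀)) := by
    have : ContinuousAt a σ₀ := H.a_cont.continuousAt (H.isOpen_S.mem_nhds hσ)
    rw [hl]
    exact (this.tendsto.comp (continuous_fst.tendsto (σ₀, (0 : ℝ)))).mono_left nhdsWithin_le_nhds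
  have hyl : Tendsto y l (𝓝 0) := by
    rw [hy]; simpa using hxl.sub hal
  have hypos : ∀ᶠ p in l, 0 < y p := by
    filter_upwards [hmem] with p hp
    rw [hy, hx]
    exact sub_pos.2 (H.z_mem_Ioo (heightRegion_mapsTo p hp)).1
  have hW : W ∈ 𝓝 (a σ₀) := H.isOpen_W.mem_nhds (H.a_mem_W hσ)
  have hyx : (fun p => x p - a p.1) = y := hy.symm
  have d0 : ∀ᶠ t in 𝓝 (a σ₀), HasDerivAt F (deriv F t) t := by
    filter_upwards [hW] with t ht using (H.differentiableAt ht).hasDerivAt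
  have d1 : ∀ᶠ t in 𝓝 (a σ₀), HasDerivAt (deriv F) (deriv (deriv F) t) t := by
    filter_upwards [hW] with t ht using H.hasDerivAt_deriv ht
  have d2 : ∀ᶠ t in 𝓝 (a σ₀), HasDerivAt (deriv (deriv F)) (deriv (deriv (deriv F)) t) t := by
    filter_upwards [hW] with t ht using H.hasDerivAt_deriv2 ht
  have d3 : ∀ᶠ t in 𝓝 (a σ₀),
      HasDerivAt (deriv (deriv (deriv F))) (deriv (deriv (deriv (deriv F))) t) t := by
    filter_upwards [hW] with t ht
    exact ((H.contDiffOn_deriv3.contDiffAt (H.isOpen_W.mem_nhds ht)).differentiableAt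
      (by norm_num)).hasDerivAt
  have c2 : ContinuousAt (deriv (deriv F)) (a σ₀) := (H.hasDerivAt_deriv2 (H.a_mem_W hσ)).continuousAt
  have c3 : ContinuousAt (deriv (deriv (deriv F))) (a σ₀) := d3.self_of_nhds.continuousAt
  have c4 : ContinuousAt (deriv (deriv (deriv (deriv F)))) (a σ₀) :=
    ((H.contDiffOn_deriv3.deriv_of_isOpen H.isOpen_W (m := 1) (by norm_num)).continuousOn).continuousAt
      hW
  have t1 := isBigO_taylor_two hxl hal c3 d1 d2
  have t2 := isBigO_taylor_three hxl hal c3 d0 d1 d2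
  have t3 := isBigO_taylor_three hxl hal c4 d1 d2 d3
  have t4 := isBigO_taylor_two hxl hal c4 d2 d3
  have hy' : ∀ p, x p - a p.1 = y p := fun p => by rw [hy]
  simp only [hy'] at t1 t2 t3 t4
  have hda : ∀ᶠ p in l, deriv F (a p.1) = p.1 := by
    filter_upwards [hmem] with p hp using H.deriv_a p.1 hp.1
  -- Since `F'(a) = σ`, the height is exactly the first-order Taylor remainder of `F` at the bottom.
  have hheight : ∀ᶠ p in l, p.2 = F (x p) - F (a p.1) - deriv F (a p.1) * y p := by
    filter_upwards [hmem] with p hp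
    have := H.gibbs_z (heightRegion_mapsTo p hp)
    rw [H.deriv_a p.1 hp.1, hy, hx]
    simp only [gibbs] at this
    simp only [heightBranch, gibbs]
    linarith
  refine ⟨hypos, hyl, hxl, hal, ?_, ?_, ?_⟩
  · refine AgreeUpTo.of_isBigO hyl (c2.tendsto.comp hal) ?_
    have := t1.mul (isBigO_refl (fun p => (y p)⁻¹) l)
    refine this.congr' ?_ ?_
    · filter_upwards [hypos, hda] with p hp hd
      rw [hd]
      field_simp
    · filter_upwards [hypos] with p hp
      field_simp
  · refine AgreeUpTo.of_isBigO hyl ((c2.tendsto.comp hal).div_const 2) ?_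
    have := t2.mul (isBigO_refl (fun p => (y p ^ 2)⁻¹) l)
    refine this.congr' ?_ ?_
    · filter_upwards [hypos, hheight] with p hp hd
      rw [← hd]
      field_simp
    · filter_upwards [hypos] with p hp
      field_simp
  -- Both `F''(x)` and `(F'(x) - σ)/y` start with `F''(a)`; their linear terms are `F''' y` and
  -- `F''' y/2`, so half of `F'''` survives the difference.
  · refine AgreeUpTo.of_isBigO hyl ((c3.tendsto.comp hal).div_const 2) ?_
    have e1 := t4.mul (isBigO_refl (fun p => (y p)⁻¹) l)
    have e2 := t3.mul (isBigO_refl (fun p => (y p ^ 2)⁻¹) l)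
    have e1' : _ =O[l] y := e1.congr' (g₂ := y) EventuallyEq.rfl (by
      filter_upwards [hypos] with p hp
      field_simp)
    have e2' : _ =O[l] y := e2.congr' (g₂ := y) EventuallyEq.rfl (by
      filter_upwards [hypos] with p hp
      field_simp)
    refine (e1'.sub e2').congr' ?_ EventuallyEq.rfl
    filter_upwards [hypos, hda] with p hp hd
    rw [hd]
    field_simp
    ring

end WellBranch

end

/-! ### Leading terms of the derivatives of the density and of the logarithmic coefficient. -/

noncomputable section

namespace WellBranch

variable {F : ℝ → ℝ} {W V S : Set ℝ} {a ζ : ℝ → ℝ} {z : ℝ × ℝ → ℝ} {g : ℝ → ℝ}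

/-- Write `Φ_σ' = P y` and `h = N y²`. Each derivative is then a power of `y` times an expression in
quantities that agree up to `O(y)` with their values at the bottom. Subtracting the main term makes
the bottom value of the leading expression zero, which gains one power of `y`, and `y` is comparable
to `√h`. The function `A'` is the derivative of `σ ↦ logCoeff F g (a σ)`, because `a' = 1/F''(a)`.
-/
theorem isBigO_estimates (H : WellBranch F W V S a ζ z) (hg : ContDiff ℝ 2 g) {σ₀ : ℝ}
    (hσ : σ₀ ∈ S) {l : Filter (ℝ × ℝ)} (hl : l = 𝓝[{p : ℝ × ℝ | 0 < p.2}] (σ₀, 0))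
    {A' : ℝ → ℝ} (hA' : A' = fun σ => logCoeffDeriv F g (a σ) / deriv (deriv F) (a σ)) :
    (fun p : ℝ × ℝ => fderiv ℝ (branchDensity F a z g) p (1, 0) - A' p.1 / √p.2)
        =O[l] (fun _ => (1 : ℝ)) ∧
      (fun p : ℝ × ℝ => fderiv ℝ (branchDensity F a z g) p (0, 1) +
        logCoeff F g (a p.1) / (2 * (p.2 * √p.2))) =O[l] (fun p => 1 / p.2) ∧
      (fun p : ℝ × ℝ => fderiv ℝ (fun p => logCoeff F g (heightBranch F a z p)) p (1, 0) - A' p.1)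
        =O[l] (fun p => √p.2) ∧
      (fun p : ℝ × ℝ => fderiv ℝ (fun p => logCoeff F g (heightBranch F a z p)) p (0, 1))
        =O[l] (fun p => 1 / √p.2) ∧
      (fun p : ℝ × ℝ => logCoeff F g (heightBranch F a z p) - logCoeff F g (a p.1))
        =O[l] (fun p => √p.2) ∧
      (fun p : ℝ × ℝ => A' p.1) =O[l] (fun _ => (1 : ℝ)) ∧
      (fun p : ℝ × ℝ => logCoeff F g (a p.1)) =O[l] (fun _ => (1 : ℝ)) := by
  obtain ⟨x, hx⟩ : ∃ x, x = heightBranch F a z := ⟨_, rfl⟩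
  obtain ⟨y, hy⟩ : ∃ y : ℝ × ℝ → ℝ, y = fun p => x p - a p.1 := ⟨_, rfl⟩
  obtain ⟨hypos, hyl, hxl, hal, hP, hN, hD⟩ := H.agreeUpTo_expansions hσ hl hx hy
  have hmem : ∀ᶠ p in l, p ∈ heightRegion F S a ζ := hl ▸ H.eventually_mem_heightRegion hσ
  have hxV : ∀ᶠ p in l, x p ∈ V := hxl (H.isOpen_V.mem_nhds (H.a_mem σ₀ hσ))
  have haV : ∀ᶠ p in l, a p.1 ∈ V := hal (H.isOpen_V.mem_nhds (H.a_mem σ₀ hσ))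
  have hV0 := H.a_mem σ₀ hσ
  have hW0 := H.a_mem_W hσ
  have hVn := H.isOpen_V.mem_nhds hV0
  have hWn := H.isOpen_W.mem_nhds hW0
  have hq0 : 0 < deriv (deriv F) (a σ₀) := H.convex _ hV0
  have hapos : ∀ᶠ p in l, 0 < deriv (deriv F) (a p.1) := haV.mono fun p hp => H.convex _ hp
  have hXA : AgreeUpTo l y x (fun p => a p.1) (a σ₀) := ⟨hxl, hal, by rw [hy]⟩
  -- agreement of smooth functions at `z` and at the bottom
  have cg : ContDiffAt ℝ 1 g (a σ₀) := (hg.of_le (by norm_num)).contDiffAt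
  have cg' : ContDiffAt ℝ 1 (deriv g) (a σ₀) :=
    ((contDiff_succ_iff_deriv (n := 1)).1 (by simpa using! hg)).2.2.contDiffAt
  have cF2 : ContDiffAt ℝ 1 (deriv (deriv F)) (a σ₀) :=
    (H.contDiffOn_deriv2.of_le (by norm_num)).contDiffAt hWn
  have cF3 : ContDiffAt ℝ 1 (deriv (deriv (deriv F))) (a σ₀) :=
    (H.contDiffOn_deriv3.of_le (by norm_num)).contDiffAt hWn
  have cμ : ContDiffAt ℝ 1 (logCoeff F g) (a σ₀) := (H.contDiffOn_logCoeff hg).contDiffAt hVn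
  have c2F : ContDiffAt ℝ 1 (fun t => 2 * deriv (deriv F) t) (a σ₀) := contDiffAt_const.mul cF2
  have c2F0 : 2 * deriv (deriv F) (a σ₀) ≠ 0 := by positivity
  have csq : ContDiffAt ℝ 1 (fun t => √(2 * deriv (deriv F) t)) (a σ₀) := c2F.sqrt c2F0
  have csq0 : √(2 * deriv (deriv F) (a σ₀)) ≠ 0 := (Real.sqrt_pos.2 (by positivity)).ne'
  have cμ' : ContDiffAt ℝ 1 (logCoeffDeriv F g) (a σ₀) :=
    (cg'.div csq csq0).sub ((cg.mul cF3).div (c2F.mul csq) (mul_ne_zero c2F0 csq0))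
  have Xg := hXA.comp cg
  have Xg' := hXA.comp cg'
  have XF2 := hXA.comp cF2
  have Xμ := hXA.comp cμ
  have Xμ' := hXA.comp cμ'
  have iP := hP.inv hq0.ne'
  have iN := (hN.sqrt (by positivity)).inv (Real.sqrt_pos.2 (by positivity)).ne'
  have hA'l : Tendsto (fun p : ℝ × ℝ => A' p.1) l
      (𝓝 (logCoeffDeriv F g (a σ₀) * (deriv (deriv F) (a σ₀))⁻¹)) := by
    rw [hA']
    simpa only [div_eq_mul_inv] using (Xμ'.right.mul iP.right)
  -- relations between `h` and `y`
  have hsqrt : ∀ᶠ p in l, √p.2 = y p * √(p.2 / y p ^ 2) := by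
    filter_upwards [hypos, hmem] with p hp hm
    rw [Real.sqrt_div' _ (sq_nonneg _), Real.sqrt_sq hp.le]
    field_simp
  have hNpos : ∀ᶠ p in l, 0 < p.2 / y p ^ 2 := by
    filter_upwards [hypos, hmem] with p hp hm
    have := hm.2.1
    positivity
  have hy_O : y =O[l] fun p => √p.2 := by
    have h1 := (iN.left.isBigO_one ℝ).mul (isBigO_refl (fun p : ℝ × ℝ => √p.2) l)
    refine h1.congr' ?_ (Eventually.of_forall fun p => one_mul _)
    filter_upwards [hsqrt, hNpos] with p h1 h2
    have := Real.sqrt_pos.2 h2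
    rw [h1]
    field_simp
  have hinv_O : (fun p => (y p)⁻¹) =O[l] fun p => 1 / √p.2 := by
    have h1 := ((hN.sqrt (by positivity)).left.isBigO_one ℝ).mul
      (isBigO_refl (fun p : ℝ × ℝ => 1 / √p.2) l)
    refine h1.congr' ?_ (Eventually.of_forall fun p => one_mul _)
    filter_upwards [hsqrt, hNpos, hypos] with p h1 h2 h3
    have := Real.sqrt_pos.2 h2
    rw [h1]
    field_simp
  have hinv2_O : (fun p => (y p ^ 2)⁻¹) =O[l] fun p => 1 / p.2 := by
    have h1 := (hN.left.isBigO_one ℝ).mul (isBigO_refl (fun p : ℝ × ℝ => 1 / p.2) l)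
    refine h1.congr' ?_ (Eventually.of_forall fun p => one_mul _)
    filter_upwards [hmem] with p hm
    have := hm.2.1
    field_simp
  have hq : ∀ᶠ p in l, ∃ P, 0 < P ∧ deriv F (x p) - p.1 = P * y p := by
    filter_upwards [hypos, hmem] with p hp hm
    refine ⟨(deriv F (x p) - p.1) / y p, div_pos ?_ hp, by field_simp⟩
    rw [hx]; exact H.slope_heightBranch hm
  refine ⟨?_, ?_, ?_, ?_, ?_, hA'l.isBigO_one ℝ, Xμ.right.isBigO_one ℝ⟩
  -- With `D = (F''(x) - P)/y`, the quantity to bound is `(g'/P² - g D/P³ - A'/√N)/y`, and the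
  -- bracket vanishes at the bottom.
  · have E := (((Xg'.mul (iP.mul iP)).sub ((Xg.mul hD).mul (iP.mul (iP.mul iP)))).sub
      ((AgreeUpTo.refl y hA'l).mul iN)).isBigO
    have E2 := E.mul (isBigO_refl (fun p => (y p)⁻¹) l)
    refine E2.congr' ?_ ?_
    · filter_upwards [hypos, hmem, hq, hsqrt, hNpos, hapos] with p hp hm ⟨P, hP0, hP⟩ hs hN0 ha
      obtain ⟨e1, -⟩ := H.hasFDerivAt_branchDensity hg hm (congrFun hx p).symm rfl
      rw [e1, hs, hP, show x p - a p.1 = y p by rw [hy], hA']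
      simp only [logCoeffDeriv]
      have hsN := Real.sqrt_pos.2 hN0
      generalize √(p.2 / y p ^ 2) = n at *
      -- In terms of `r = √(F''(a)/2)`, the bottom value of `√h/y`, the vanishing of the bracket
      -- becomes a rational identity.
      have r1 : √(2 * deriv (deriv F) (a p.1)) = 2 * √(deriv (deriv F) (a p.1) / 2) := by
        rw [show 2 * deriv (deriv F) (a p.1) = 2 ^ 2 * (deriv (deriv F) (a p.1) / 2) by ring,
          Real.sqrt_mul (by positivity), Real.sqrt_sq (by norm_num)]
      have r2 : deriv (deriv F) (a p.1) = 2 * √(deriv (deriv F) (a p.1) / 2) ^ 2 := by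
        rw [Real.sq_sqrt (by positivity)]; ring
      have r3 : 0 < √(deriv (deriv F) (a p.1) / 2) := Real.sqrt_pos.2 (by positivity)
      rw [r1]
      generalize √(deriv (deriv F) (a p.1) / 2) = r at *
      rw [r2]
      field_simp
      ring
    · filter_upwards [hypos] with p hp
      field_simp
  -- The terms of order `y⁻³` are `g F''/P³` and `A/(2 N^(3/2))`, equal at the bottom. Their
  -- difference, like the `g'` term, contributes only order `y⁻²`.
  · have E := ((((Xg.mul XF2).mul (iP.mul (iP.mul iP)))).sub
      (((AgreeUpTo.refl y Xμ.right).mul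
        (iN.mul (hN.inv (by positivity)))).mul
          (AgreeUpTo.refl y (tendsto_const_nhds (x := (1 / 2 : ℝ)))))).isBigO
    have E1 := (((Xg'.mul (iP.mul iP)).left.isBigO_one ℝ).mul (isBigO_refl y l)).sub
      (E.congr_right fun p => (one_mul _).symm)
    have E2 := E1.mul (isBigO_refl (fun p => (y p)⁻¹ * (y p ^ 2)⁻¹) l)
    have E3 : _ =O[l] fun p => (y p ^ 2)⁻¹ := E2.congr' EventuallyEq.rfl (by
      filter_upwards [hypos] with p hp
      field_simp)
    refine (E3.trans hinv2_O).congr' ?_ EventuallyEq.rfl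
    filter_upwards [hypos, hmem, hq, hsqrt, hNpos, hapos] with p hp hm ⟨P, hP0, hP⟩ hs hN0 ha
    obtain ⟨-, e1⟩ := H.hasFDerivAt_branchDensity hg hm (congrFun hx p).symm rfl
    have hh : p.2 = y p ^ 2 * (p.2 / y p ^ 2) := by field_simp
    rw [e1, hs, hP, logCoeff]
    have hsN := Real.sqrt_pos.2 hN0
    have hsN2 : √(p.2 / y p ^ 2) ^ 2 = p.2 / y p ^ 2 := Real.sq_sqrt hN0.le
    have hh2 : p.2 = y p ^ 2 * √(p.2 / y p ^ 2) ^ 2 := by rw [hsN2]; exact hh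
    rw [← hsN2]
    generalize √(p.2 / y p ^ 2) = n at *
    rw [hh2]
    have r1 : √(2 * deriv (deriv F) (a p.1)) = 2 * √(deriv (deriv F) (a p.1) / 2) := by
      rw [show 2 * deriv (deriv F) (a p.1) = 2 ^ 2 * (deriv (deriv F) (a p.1) / 2) by ring,
        Real.sqrt_mul (by positivity), Real.sqrt_sq (by norm_num)]
    have r2 : deriv (deriv F) (a p.1) = 2 * √(deriv (deriv F) (a p.1) / 2) ^ 2 := by
      rw [Real.sq_sqrt (by positivity)]; ring
    have r3 : 0 < √(deriv (deriv F) (a p.1) / 2) := Real.sqrt_pos.2 (by positivity)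
    rw [r1]
    generalize √(deriv (deriv F) (a p.1) / 2) = r at *
    rw [r2]
    field_simp
    ring
  · have E := (Xμ'.mul iP).isBigO.trans hy_O
    refine E.congr' ?_ EventuallyEq.rfl
    filter_upwards [hypos, hmem, hq, hxV] with p hp hm ⟨P, hP0, hP⟩ hxv
    obtain ⟨e1, -⟩ := H.fderiv_comp_heightBranch hm
      (H.hasDerivAt_logCoeff hg (hx ▸ hxv)) (congrFun hx p).symm rfl
    rw [e1, hP, hA', ← hx, show x p - a p.1 = y p by rw [hy]]
    field_simp
  · have E := ((Xμ'.mul iP).left.isBigO_one ℝ).mul hinv_O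
    refine E.congr' ?_ (Eventually.of_forall fun p => one_mul _)
    filter_upwards [hypos, hmem, hq, hxV] with p hp hm ⟨P, hP0, hP⟩ hxv
    obtain ⟨-, e1⟩ := H.fderiv_comp_heightBranch hm
      (H.hasDerivAt_logCoeff hg (hx ▸ hxv)) (congrFun hx p).symm rfl
    rw [e1, hP, ← hx]
    field_simp
  · rw [← hx]; exact Xμ.isBigO.trans hy_O

end WellBranch

end

/-! ### The branch integral and the cancellation of its singularities. -/

noncomputable section

/-- The integral over the part of the branch with `f_Δ ≤ δ²`, after the substitution `f_Δ = v²`. -/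
def branchIntegral (F : ℝ → ℝ) (a : ℝ → ℝ) (z : ℝ × ℝ → ℝ) (g : ℝ → ℝ) (ε δ : ℝ)
    (p : ℝ × ℝ) : ℝ :=
  ∫ v in (0 : ℝ)..δ, kernelWeight ε v * branchDensity F a z g (p + (0, v ^ 2))

/-- The branch integral with its logarithmic singularity removed. -/
def regularPart (F : ℝ → ℝ) (a : ℝ → ℝ) (z : ℝ × ℝ → ℝ) (g : ℝ → ℝ) (ε δ : ℝ)
    (p : ℝ × ℝ) : ℝ :=
  branchIntegral F a z g ε δ p +
    1 / √2 * logCoeff F g (heightBranch F a z p) * Real.log p.2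

theorem one_div_sqrt_le_rpow {h : ℝ} (h0 : 0 < h) (h1 : h < 1) :
    1 / √h ≤ h ^ (-(3 / 4) : ℝ) := by
  rw [Real.sqrt_eq_rpow, one_div, ← Real.rpow_neg h0.le]
  exact Real.rpow_le_rpow_of_exponent_ge h0 h1.le (by norm_num)

theorem abs_log_le_rpow {h : ℝ} (h0 : 0 < h) (h1 : h < 1) :
    |Real.log h| ≤ 4 * h ^ (-(1 / 4) : ℝ) := by
  have h2 := Real.abs_log_mul_self_rpow_lt h (1 / 4) h0 h1.le (by norm_num)
  have h3 : 0 < h ^ (1 / 4 : ℝ) := Real.rpow_pos_of_pos h0 _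
  rw [abs_mul, abs_of_pos h3] at h2
  rw [Real.rpow_neg h0.le, ← div_eq_mul_inv, le_div_iff₀ h3]
  norm_num at h2 ⊢
  exact h2.le

namespace WellBranch

variable {F : ℝ → ℝ} {W V S : Set ℝ} {a ζ : ℝ → ℝ} {z : ℝ × ℝ → ℝ} {g : ℝ → ℝ} {ε δ : ℝ}

theorem branchIntegral_contDiffAt (H : WellBranch F W V S a ζ z) (hg : ContDiff ℝ 2 g)
    (hδ : 0 ≤ δ) (hεδ : ε ^ 2 * δ ^ 2 ≤ 1) {p : ℝ × ℝ}
    (hp : ∀ v ∈ Icc 0 δ, p + (0, v ^ 2) ∈ heightRegion F S a ζ) :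
    ContDiffAt ℝ 1 (branchIntegral F a z g ε δ) p ∧
      (∀ e, fderiv ℝ (branchIntegral F a z g ε δ) p e =
        ∫ v in (0 : ℝ)..δ, kernelWeight ε v *
          fderiv ℝ (branchDensity F a z g) (p + (0, v ^ 2)) e) ∧
      ∀ e, ContinuousOn (fun v => fderiv ℝ (branchDensity F a z g) (p + (0, v ^ 2)) e)
        (Icc 0 δ) := by
  have hsh : ContDiff ℝ 1 (fun q : (ℝ × ℝ) × ℝ => q.1 + ((0 : ℝ), q.2 ^ 2)) := by fun_prop
  have hκ : ∀ v ∈ Icc 0 δ, ε ^ 2 * v ^ 2 < 2 := fun v hv => by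
    have : ε ^ 2 * v ^ 2 ≤ ε ^ 2 * δ ^ 2 := by have := hv.1; have := hv.2; gcongr
    linarith
  have hO1 : IsOpen ((fun q : (ℝ × ℝ) × ℝ => q.1 + ((0 : ℝ), q.2 ^ 2)) ⁻¹' heightRegion F S a ζ) :=
    H.isOpen_heightRegion.preimage hsh.continuous
  have hO2 : IsOpen {q : (ℝ × ℝ) × ℝ | ε ^ 2 * q.2 ^ 2 < 2} :=
    isOpen_lt (by fun_prop) continuous_const
  have hcd : ContDiffOn ℝ 1 (fun q : (ℝ × ℝ) × ℝ => kernelWeight ε q.2 *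
      branchDensity F a z g (q.1 + ((0 : ℝ), q.2 ^ 2)))
      ((fun q : (ℝ × ℝ) × ℝ => q.1 + ((0 : ℝ), q.2 ^ 2)) ⁻¹' heightRegion F S a ζ ∩
        {q : (ℝ × ℝ) × ℝ | ε ^ 2 * q.2 ^ 2 < 2}) :=
    ((contDiffOn_kernelWeight ε).comp contDiffOn_snd fun q hq => hq.2).mul
      ((H.contDiffOn_branchDensity hg).comp hsh.contDiffOn fun q hq => hq.1)
  obtain ⟨h1, h2⟩ := contDiffAt_intervalIntegral (hO1.inter hO2) hcd hδ (x₀ := p)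
    (fun v hv => ⟨hp v hv, hκ v hv⟩)
  refine ⟨h1, fun e => ?_, fun e => ?_⟩
  · rw [show branchIntegral F a z g ε δ = fun x => ∫ v in (0 : ℝ)..δ, kernelWeight ε v *
      branchDensity F a z g (x + ((0 : ℝ), v ^ 2)) from rfl, h2 e]
    refine intervalIntegral.integral_congr fun v hv => ?_
    rw [uIcc_of_le hδ] at hv
    have hd : DifferentiableAt ℝ (fun x => branchDensity F a z g (x + ((0 : ℝ), v ^ 2))) p := by
      refine (differentiableAt_comp_add_right _).2 ?_
      exact ((H.contDiffOn_branchDensity hg).contDiffAt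
        (H.isOpen_heightRegion.mem_nhds (hp v hv))).differentiableAt (by norm_num)
    simp only
    rw [fderiv_const_mul hd, fderiv_comp_add_right]
    rfl
  · have hc := (H.contDiffOn_branchDensity hg).continuousOn_fderiv_of_isOpen
      H.isOpen_heightRegion (by norm_num)
    exact (hc.clm_apply continuousOn_const).comp
      (f := fun v : ℝ => p + ((0 : ℝ), v ^ 2)) (by fun_prop) hp

/-- The integral samples the density at all heights `h + v²` with `v ≤ δ`, so the asymptotic
estimates are needed with one constant on a fixed box. -/
theorem exists_estimates_box (H : WellBranch F W V S a ζ z) (hg : ContDiff ℝ 2 g) {σ₀ : ℝ}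
    (hσ : σ₀ ∈ S) {A' : ℝ → ℝ}
    (hA' : A' = fun σ => logCoeffDeriv F g (a σ) / deriv (deriv F) (a σ)) :
    ∃ C r : ℝ, 0 < r ∧ r ≤ 1 ∧ 0 ≤ C ∧ ∀ p ∈ Ioo (σ₀ - r) (σ₀ + r) ×ˢ Ioo 0 r,
      p ∈ heightRegion F S a ζ ∧ heightBranch F a z p ∈ V ∧
      |fderiv ℝ (branchDensity F a z g) p (1, 0) - A' p.1 / √p.2| ≤ C ∧
      |fderiv ℝ (branchDensity F a z g) p (0, 1) +
        logCoeff F g (a p.1) / (2 * (p.2 * √p.2))| ≤ C * (1 / p.2) ∧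
      |fderiv ℝ (fun p => logCoeff F g (heightBranch F a z p)) p (1, 0) - A' p.1| ≤ C * √p.2 ∧
      |fderiv ℝ (fun p => logCoeff F g (heightBranch F a z p)) p (0, 1)| ≤ C * (1 / √p.2) ∧
      |logCoeff F g (heightBranch F a z p) - logCoeff F g (a p.1)| ≤ C * √p.2 ∧
      |A' p.1| ≤ C ∧ |logCoeff F g (a p.1)| ≤ C := by
  obtain ⟨h1, h2, h3, h4, h5, h6, h7⟩ := H.isBigO_estimates hg hσ rfl hA'
  obtain ⟨C1, b1⟩ := h1.bound
  obtain ⟨C2, b2⟩ := h2.bound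
  obtain ⟨C3, b3⟩ := h3.bound
  obtain ⟨C4, b4⟩ := h4.bound
  obtain ⟨C5, b5⟩ := h5.bound
  obtain ⟨C6, b6⟩ := h6.bound
  obtain ⟨C7, b7⟩ := h7.bound
  have hV := (H.tendsto_heightBranch hσ) (H.isOpen_V.mem_nhds (H.a_mem σ₀ hσ))
  obtain ⟨C, hC⟩ : ∃ C, C = |C1| + |C2| + |C3| + |C4| + |C5| + |C6| + |C7| := ⟨_, rfl⟩
  have hall : ∀ᶠ p in 𝓝[{p : ℝ × ℝ | 0 < p.2}] (σ₀, 0), p ∈ heightRegion F S a ζ ∧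
      heightBranch F a z p ∈ V ∧
      |fderiv ℝ (branchDensity F a z g) p (1, 0) - A' p.1 / √p.2| ≤ C ∧
      |fderiv ℝ (branchDensity F a z g) p (0, 1) +
        logCoeff F g (a p.1) / (2 * (p.2 * √p.2))| ≤ C * (1 / p.2) ∧
      |fderiv ℝ (fun p => logCoeff F g (heightBranch F a z p)) p (1, 0) - A' p.1| ≤ C * √p.2 ∧
      |fderiv ℝ (fun p => logCoeff F g (heightBranch F a z p)) p (0, 1)| ≤ C * (1 / √p.2) ∧
      |logCoeff F g (heightBranch F a z p) - logCoeff F g (a p.1)| ≤ C * √p.2 ∧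
      |A' p.1| ≤ C ∧ |logCoeff F g (a p.1)| ≤ C := by
    have := abs_nonneg C1
    have := abs_nonneg C2
    have := abs_nonneg C3
    have := abs_nonneg C4
    have := abs_nonneg C5
    have := abs_nonneg C6
    have := abs_nonneg C7
    have key : ∀ {c t u : ℝ}, c ≤ C → 0 ≤ t → |u| ≤ c * ‖t‖ → |u| ≤ C * t := by
      intro c t u hc ht hu
      rw [Real.norm_eq_abs, abs_of_nonneg ht] at hu
      exact hu.trans (mul_le_mul_of_nonneg_right hc ht)
    filter_upwards [H.eventually_mem_heightRegion hσ, hV, b1, b2, b3, b4, b5, b6, b7]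
      with p hp hv b1 b2 b3 b4 b5 b6 b7
    have hp2 := hp.2.1
    refine ⟨hp, hv, ?_, key ?_ ?_ b2, key ?_ ?_ b3, key ?_ ?_ b4, key ?_ ?_ b5, ?_, ?_⟩
    · simpa using key (t := 1) (by linarith [le_abs_self C1]) one_pos.le b1
    · linarith [le_abs_self C2]
    · positivity
    · linarith [le_abs_self C3]
    · positivity
    · linarith [le_abs_self C4]
    · positivity
    · linarith [le_abs_self C5]
    · positivity
    · simpa using key (t := 1) (by linarith [le_abs_self C6]) one_pos.le b6
    · simpa using key (t := 1) (by linarith [le_abs_self C7]) one_pos.le b7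
  rw [eventually_nhdsWithin_iff, Metric.eventually_nhds_iff] at hall
  obtain ⟨r, hr, h⟩ := hall
  refine ⟨C, min r 1, lt_min hr one_pos, min_le_right _ _, by rw [hC]; positivity, fun p hp => ?_⟩
  refine h ?_ hp.2.1
  have e1 := hp.1.1
  have e2 := hp.1.2
  have e3 := hp.2.1
  have e4 := hp.2.2
  have := min_le_left r 1
  rw [Prod.dist_eq, max_lt_iff, Real.dist_eq, Real.dist_eq, abs_lt, abs_lt]
  simp only
  refine ⟨⟨?_, ?_⟩, ?_, ?_⟩ <;> linarith

/-- The central estimate. In the `σ`-direction the main terms are `-(A'/√2) log h` from the integral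
and `(A'/√2) log h` from the logarithmic term; in the `h`-direction they are `-A/(√2 h)` and `A/(√2
h)`. Both pairs cancel. The worst remainder is `log h` times `∂_h` of the coefficient, of order
`h^(-1/2) |log h|`, which fits under `h^(-3/4)`. -/
theorem exists_regularPart_bounds (H : WellBranch F W V S a ζ z) (hg : ContDiff ℝ 2 g) {σ₀ : ℝ}
    (hσ : σ₀ ∈ S) (ε : ℝ) :
    ∃ δ₀ : ℝ, 0 < δ₀ ∧ ∀ δ ∈ Ioo 0 δ₀, ∃ C r : ℝ, 0 < r ∧ r ≤ 1 / 2 ∧ 0 ≤ C ∧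
      ε ^ 2 * δ ^ 2 ≤ 1 ∧
      ContDiffOn ℝ 1 (regularPart F a z g ε δ) (Ioo (σ₀ - r) (σ₀ + r) ×ˢ Ioo 0 r) ∧
      ∀ p ∈ Ioo (σ₀ - r) (σ₀ + r) ×ˢ Ioo 0 r,
        (∀ v ∈ Icc 0 δ, p + (0, v ^ 2) ∈ heightRegion F S a ζ) ∧
        |fderiv ℝ (regularPart F a z g ε δ) p (1, 0)| ≤ C ∧
        |fderiv ℝ (regularPart F a z g ε δ) p (0, 1)| ≤ C * p.2 ^ (-(3 / 4) : ℝ) := by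
  obtain ⟨A', hA'⟩ : ∃ A' : ℝ → ℝ,
    A' = fun σ => logCoeffDeriv F g (a σ) / deriv (deriv F) (a σ) := ⟨_, rfl⟩
  obtain ⟨C, R, hR, hR1, hC, hbox⟩ := H.exists_estimates_box hg hσ hA'
  -- The first bound gives `δ² < R/2` because `R ≤ 1`, so `h + v²` stays in the box when `h < R/2`;
  -- the second gives `ε² δ² ≤ 1`.
  refine ⟨min (R / 2) (1 / (|ε| + 1)), by positivity, fun δ hδ => ?_⟩
  have hδ0 := hδ.1
  have hδ1 : δ < R / 2 := hδ.2.trans_le (min_le_left _ _)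
  have hδ2 : δ < 1 / (|ε| + 1) := hδ.2.trans_le (min_le_right _ _)
  have hεδ : ε ^ 2 * δ ^ 2 ≤ 1 := by
    rw [lt_div_iff₀ (by positivity)] at hδ2
    have h1 : |ε| * δ ≤ 1 := by nlinarith
    have h2 : 0 ≤ |ε| * δ := by positivity
    calc ε ^ 2 * δ ^ 2 = (|ε| * δ) ^ 2 := by rw [mul_pow, sq_abs]
      _ ≤ 1 := pow_le_one₀ h2 h1
  have hδsq : δ ^ 2 < R / 2 := by nlinarith
  have hεv : ∀ v ∈ Icc 0 δ, ε ^ 2 * v ^ 2 ≤ 1 := fun v hv => by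
    have : ε ^ 2 * v ^ 2 ≤ ε ^ 2 * δ ^ 2 := by have := hv.1; have := hv.2; gcongr
    linarith
  have hκc : ContinuousOn (kernelWeight ε) (Icc 0 δ) :=
    (contDiffOn_kernelWeight ε).continuousOn.mono fun v hv => by
      have := hεv v hv
      simp only [mem_ofPred_eq]; linarith
  have hκ2 : ∀ v ∈ Icc 0 δ, |kernelWeight ε v - √2| ≤ 4 * ε ^ 2 * v ^ 2 :=
    fun v hv => abs_kernelWeight_sub_le (hεv v hv)
  -- At most `4` for the deviation from `√2`, plus `√2 ≤ 2`.
  have hκ6 : ∀ v ∈ Icc 0 δ, |kernelWeight ε v| ≤ 6 := fun v hv => by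
    have h1 := hκ2 v hv
    have h2 := hεv v hv
    have h3 : √2 ≤ 2 := by
      rw [Real.sqrt_le_left (by norm_num)]; norm_num
    have h4 := abs_add_le (kernelWeight ε v - √2) √2
    rw [sub_add_cancel, abs_of_nonneg (Real.sqrt_nonneg 2)] at h4
    linarith
  obtain ⟨K1, hK1⟩ := exists_abs_integral_div_sqrt_le hδ0 (by positivity) hκc hκ2
  obtain ⟨K2, hK2⟩ := exists_abs_integral_div_rpow_le hδ0 (by positivity) hκc hκ2
  have hs2 : (1 : ℝ) ≤ √2 := Real.one_le_sqrt.2 (by norm_num)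
  have hs2' : 1 / √2 ≤ 1 := by rw [div_le_one (by positivity)]; exact hs2
  have hsub : ∀ p ∈ Ioo (σ₀ - R / 2) (σ₀ + R / 2) ×ˢ Ioo 0 (R / 2), ∀ v ∈ Icc 0 δ,
      p + (0, v ^ 2) ∈ Ioo (σ₀ - R) (σ₀ + R) ×ˢ Ioo 0 R := by
    intro p hp v hv
    have h1 : v ^ 2 ≤ δ ^ 2 := pow_le_pow_left₀ hv.1 hv.2 2
    have h2 := sq_nonneg v
    have e1 := hp.1.1
    have e2 := hp.1.2
    have e3 := hp.2.1
    have e4 := hp.2.2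
    refine ⟨⟨?_, ?_⟩, ?_, ?_⟩ <;> simp only [Prod.fst_add, Prod.snd_add] <;> linarith
  have hreg : ∀ p ∈ Ioo (σ₀ - R / 2) (σ₀ + R / 2) ×ˢ Ioo 0 (R / 2), ∀ v ∈ Icc 0 δ,
      p + (0, v ^ 2) ∈ heightRegion F S a ζ := fun p hp v hv => (hbox _ (hsub p hp v hv)).1
  have hself : ∀ p ∈ Ioo (σ₀ - R / 2) (σ₀ + R / 2) ×ˢ Ioo 0 (R / 2),
      p ∈ Ioo (σ₀ - R) (σ₀ + R) ×ˢ Ioo 0 R := fun p hp => by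
    simpa using hsub p hp 0 ⟨le_rfl, hδ0.le⟩
  have hlogc : ∀ p ∈ Ioo (σ₀ - R / 2) (σ₀ + R / 2) ×ˢ Ioo 0 (R / 2),
      ContDiffAt ℝ 1 (fun p => logCoeff F g (heightBranch F a z p)) p := fun p hp => by
    obtain ⟨b0, bV, -⟩ := hbox p (hself p hp)
    exact ContDiffAt.comp p ((H.contDiffOn_logCoeff hg).contDiffAt (H.isOpen_V.mem_nhds bV))
      (H.contDiffOn_heightBranch.contDiffAt (H.isOpen_heightRegion.mem_nhds b0))
  -- The part outside the parentheses bounds the `σ`-derivative, the part inside the `h`-derivative.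
  refine ⟨6 * C * δ + C * |K1| + 2 * C + (12 * C + C * |K2| + 4 * C + C), R / 2, by positivity,
    by linarith, by positivity, hεδ, fun p hp => ?_, fun p hp => ⟨hreg p hp, ?_⟩⟩
  · have b2 := hp.2.1
    refine ContDiffAt.contDiffWithinAt ?_
    refine (H.branchIntegral_contDiffAt hg hδ0.le hεδ (hreg p hp)).1.add ?_
    exact (contDiffAt_const.mul (hlogc p hp)).mul (contDiffAt_snd.log b2.ne')
  obtain ⟨c1, c2, c3⟩ := H.branchIntegral_contDiffAt hg hδ0.le hεδ (hreg p hp)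
  obtain ⟨b0, bV, -, -, b3, b4, b5, b6, b7⟩ := hbox p (hself p hp)
  obtain ⟨h, hh⟩ : ∃ h, h = p.2 := ⟨_, rfl⟩
  have hh0 : 0 < h := hh ▸ hp.2.1
  have hh1 : h < 1 := by
    rw [hh]
    have := hp.2.2
    linarith
  have hsh := Real.sqrt_pos.2 hh0
  have hfd : ∀ e : ℝ × ℝ, fderiv ℝ (regularPart F a z g ε δ) p e =
      (∫ v in (0 : ℝ)..δ, kernelWeight ε v *
          fderiv ℝ (branchDensity F a z g) (p + (0, v ^ 2)) e) +
        1 / √2 * (logCoeff F g (heightBranch F a z p) * (p.2⁻¹ * e.2) +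
          Real.log p.2 * fderiv ℝ (fun p => logCoeff F g (heightBranch F a z p)) p e) := by
    intro e
    have d1 := (c1.differentiableAt (by norm_num)).hasFDerivAt
    have d2 := ((hlogc p hp).differentiableAt (by norm_num)).hasFDerivAt
    have d3 := (Real.hasDerivAt_log hp.2.1.ne').comp_hasFDerivAt (f := Prod.snd) p
      (hasFDerivAt_snd_real p)
    have d4 : HasFDerivAt (regularPart F a z g ε δ) _ p := d1.add ((d2.const_mul (1 / √2)).mul d3)
    rw [d4.fderiv, ← c2 e]
    simp
    ring
  have hint : ∀ e : ℝ × ℝ, IntervalIntegrable (fun v => kernelWeight ε v *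
      fderiv ℝ (branchDensity F a z g) (p + (0, v ^ 2)) e) volume 0 δ := fun e => by
    refine ContinuousOn.intervalIntegrable ?_
    rw [uIcc_of_le hδ0.le]
    exact hκc.mul (c3 e)
  have hpv : ∀ v : ℝ, 0 < h + v ^ 2 := fun v => by positivity
  have hpsv : ∀ v : ℝ, 0 < √(h + v ^ 2) := fun v => Real.sqrt_pos.2 (hpv v)
  have hlogsq : √h * |Real.log h| ≤ 2 := by
    have := Real.abs_log_mul_self_rpow_lt h (1 / 2) hh0 hh1.le (by norm_num)
    rw [← Real.sqrt_eq_rpow, abs_mul, abs_of_pos hsh] at this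
    norm_num at this
    linarith
  rw [hfd, hfd, ← hh]
  rw [← hh] at b3 b4 b5
  constructor
  · -- the derivative along the first coordinate
    have i2 : IntervalIntegrable (fun v => A' p.1 * (kernelWeight ε v / √(h + v ^ 2))) volume 0 δ :=
      (intervalIntegrable_div_of_continuousOn hδ0 hκc (by fun_prop) hpsv).const_mul _
    have e1 : (∫ v in (0 : ℝ)..δ, kernelWeight ε v *
        fderiv ℝ (branchDensity F a z g) (p + (0, v ^ 2)) (1, 0)) =
        (∫ v in (0 : ℝ)..δ, (kernelWeight ε v *
          fderiv ℝ (branchDensity F a z g) (p + (0, v ^ 2)) (1, 0) -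
            A' p.1 * (kernelWeight ε v / √(h + v ^ 2)))) +
          A' p.1 * ∫ v in (0 : ℝ)..δ, kernelWeight ε v / √(h + v ^ 2) := by
      rw [intervalIntegral.integral_sub (hint _) i2, intervalIntegral.integral_const_mul,
        sub_add_cancel]
    have e2 : ‖∫ v in (0 : ℝ)..δ, (kernelWeight ε v *
          fderiv ℝ (branchDensity F a z g) (p + (0, v ^ 2)) (1, 0) -
            A' p.1 * (kernelWeight ε v / √(h + v ^ 2)))‖ ≤ 6 * C * |δ - 0| := by
      refine intervalIntegral.norm_integral_le_of_norm_le_const fun v hv => ?_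
      rw [uIoc_of_le hδ0.le] at hv
      have hv' : v ∈ Icc 0 δ := ⟨hv.1.le, hv.2⟩
      obtain ⟨-, -, q1, -⟩ := hbox _ (hsub p hp v hv')
      simp only [Prod.fst_add, Prod.snd_add, add_zero, ← hh] at q1
      calc _ = |kernelWeight ε v| * |fderiv ℝ (branchDensity F a z g) (p + (0, v ^ 2)) (1, 0) -
            A' p.1 / √(h + v ^ 2)| := by rw [Real.norm_eq_abs, ← abs_mul]; congr 1; ring
        _ ≤ 6 * C := mul_le_mul (hκ6 v hv') q1 (abs_nonneg _) (by norm_num)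
    rw [sub_zero, abs_of_pos hδ0, Real.norm_eq_abs] at e2
    obtain ⟨I, hI⟩ : ∃ I, I = ∫ v in (0 : ℝ)..δ, kernelWeight ε v / √(h + v ^ 2) := ⟨_, rfl⟩
    have q2 := hK1 h ⟨hh0, hh1⟩
    rw [← hI] at q2 e1
    rw [e1]
    obtain ⟨J, hJ⟩ : ∃ J, J = ∫ v in (0 : ℝ)..δ, (kernelWeight ε v *
          fderiv ℝ (branchDensity F a z g) (p + (0, v ^ 2)) (1, 0) -
            A' p.1 * (kernelWeight ε v / √(h + v ^ 2))) := ⟨_, rfl⟩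
    rw [← hJ] at e2 ⊢
    obtain ⟨D, hD⟩ : ∃ D, D = fderiv ℝ (fun p => logCoeff F g (heightBranch F a z p)) p (1, 0) :=
      ⟨_, rfl⟩
    rw [← hD] at b3 ⊢
    have e3 : |A' p.1 * (I + 1 / √2 * Real.log h)| ≤ C * |K1| := by
      rw [abs_mul]
      exact mul_le_mul b6 (q2.trans (le_abs_self _)) (abs_nonneg _) hC
    have e4 : |1 / √2 * ((D - A' p.1) * Real.log h)| ≤ 2 * C := by
      rw [abs_mul, abs_mul, abs_of_nonneg (by positivity : (0 : ℝ) ≤ 1 / √2)]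
      calc _ ≤ 1 * (C * √h * |Real.log h|) := by gcongr
        _ = C * (√h * |Real.log h|) := by ring
        _ ≤ C * 2 := by gcongr
        _ = 2 * C := by ring
    -- Adding and subtracting `A' log h/√2` pairs the singular integral `I` with its logarithm and
    -- leaves `D - A' = O(√h)` against `log h`.
    have e5 : J + A' p.1 * I + 1 / √2 * (logCoeff F g (heightBranch F a z p) * (h⁻¹ * 0) +
        Real.log h * D) = J + A' p.1 * (I + 1 / √2 * Real.log h) +
          1 / √2 * ((D - A' p.1) * Real.log h) := by ring
    simp only
    rw [e5]
    refine (abs_add_three _ _ _).trans ?_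
    have : 0 ≤ C * |K2| := by positivity
    linarith
  · -- the derivative along the second coordinate
    have hpos2 : ∀ v, 0 < (h + v ^ 2) * √(h + v ^ 2) := fun v => mul_pos (hpv v) (hpsv v)
    obtain ⟨A, hA⟩ : ∃ A, A = logCoeff F g (a p.1) := ⟨_, rfl⟩
    have i2 : IntervalIntegrable (fun v => A / 2 * (kernelWeight ε v /
        ((h + v ^ 2) * √(h + v ^ 2)))) volume 0 δ :=
      (intervalIntegrable_div_of_continuousOn hδ0 hκc (by fun_prop) hpos2).const_mul _
    have e1 : (∫ v in (0 : ℝ)..δ, kernelWeight ε v *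
        fderiv ℝ (branchDensity F a z g) (p + (0, v ^ 2)) (0, 1)) =
        (∫ v in (0 : ℝ)..δ, (kernelWeight ε v *
          fderiv ℝ (branchDensity F a z g) (p + (0, v ^ 2)) (0, 1) +
            A / 2 * (kernelWeight ε v / ((h + v ^ 2) * √(h + v ^ 2))))) -
          A / 2 * ∫ v in (0 : ℝ)..δ, kernelWeight ε v / ((h + v ^ 2) * √(h + v ^ 2)) := by
      rw [intervalIntegral.integral_add (hint _) i2, intervalIntegral.integral_const_mul,
        add_sub_cancel_right]
    have i3 : IntervalIntegrable (fun v => 6 * C * (1 / (h + v ^ 2))) volume 0 δ :=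
      (intervalIntegrable_div_of_continuousOn hδ0 (κ := fun _ => 1) continuousOn_const
        (by fun_prop) hpv).const_mul _
    have e2 : ‖∫ v in (0 : ℝ)..δ, (kernelWeight ε v *
          fderiv ℝ (branchDensity F a z g) (p + (0, v ^ 2)) (0, 1) +
            A / 2 * (kernelWeight ε v / ((h + v ^ 2) * √(h + v ^ 2))))‖ ≤
        ∫ v in (0 : ℝ)..δ, 6 * C * (1 / (h + v ^ 2)) := by
      refine intervalIntegral.norm_integral_le_of_norm_le hδ0.le
        (Eventually.of_forall fun v hv => ?_) i3
      have hv' : v ∈ Icc 0 δ := ⟨hv.1.le, hv.2⟩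
      obtain ⟨-, -, -, q1, -⟩ := hbox _ (hsub p hp v hv')
      simp only [Prod.fst_add, Prod.snd_add, add_zero, ← hh, ← hA] at q1
      calc _ = |kernelWeight ε v| * |fderiv ℝ (branchDensity F a z g) (p + (0, v ^ 2)) (0, 1) +
            A / (2 * ((h + v ^ 2) * √(h + v ^ 2)))| := by
              rw [Real.norm_eq_abs, ← abs_mul]
              congr 1
              have := hpv v
              have := hpsv v
              field_simp
        _ ≤ 6 * (C * (1 / (h + v ^ 2))) := mul_le_mul (hκ6 v hv') q1 (abs_nonneg _) (by norm_num)
        _ = _ := by ring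
    have e2' : ∫ v in (0 : ℝ)..δ, 6 * C * (1 / (h + v ^ 2)) ≤ 6 * C * (2 / √h) := by
      rw [intervalIntegral.integral_const_mul]
      exact mul_le_mul_of_nonneg_left (integral_inv_add_sq_le hh0) (by positivity)
    rw [Real.norm_eq_abs] at e2
    obtain ⟨I, hI⟩ : ∃ I, I = ∫ v in (0 : ℝ)..δ, kernelWeight ε v /
      ((h + v ^ 2) * √(h + v ^ 2)) := ⟨_, rfl⟩
    have q2 := hK2 h ⟨hh0, hh1⟩
    rw [← hI] at q2 e1
    rw [e1]
    obtain ⟨J, hJ⟩ : ∃ J, J = ∫ v in (0 : ℝ)..δ, (kernelWeight ε v *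
          fderiv ℝ (branchDensity F a z g) (p + (0, v ^ 2)) (0, 1) +
            A / 2 * (kernelWeight ε v / ((h + v ^ 2) * √(h + v ^ 2)))) := ⟨_, rfl⟩
    rw [← hJ] at e2 ⊢
    obtain ⟨D, hD⟩ : ∃ D, D = fderiv ℝ (fun p => logCoeff F g (heightBranch F a z p)) p (0, 1) :=
      ⟨_, rfl⟩
    rw [← hD] at b4 ⊢
    obtain ⟨M, hM⟩ : ∃ M, M = logCoeff F g (heightBranch F a z p) := ⟨_, rfl⟩
    rw [← hM, ← hA] at b5
    rw [← hA] at b7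
    rw [← hM]
    obtain ⟨w, hw⟩ : ∃ w, w = h ^ (-(3 / 4) : ℝ) := ⟨_, rfl⟩
    have hsw : 1 / √h ≤ w := hw ▸ one_div_sqrt_le_rpow hh0 hh1
    have e3 : |A / 2 * (I - √2 / h)| ≤ C * |K2| * w := by
      have hA2 : |A / 2| ≤ C := by
        rw [abs_div, abs_two]
        linarith [abs_nonneg A]
      calc _ = |A / 2| * |I - √2 / h| := abs_mul _ _
        _ ≤ C * (K2 / √h) := mul_le_mul hA2 q2 (abs_nonneg _) hC
        _ = C * K2 * (1 / √h) := by ring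
        _ ≤ C * |K2| * w := by
          gcongr
          exact le_abs_self K2
    -- The origin of the exponent 3/4: `|log h| ≤ 4 h^(-1/4)` times `h^(-1/2)`.
    have e4 : |1 / √2 * (Real.log h * D)| ≤ 4 * C * w := by
      rw [abs_mul, abs_mul, abs_of_nonneg (by positivity : (0 : ℝ) ≤ 1 / √2)]
      have hww : h ^ (-(1 / 4) : ℝ) * (1 / √h) = w := by
        have h2 : 1 / √h = h ^ (-(1 / 2) : ℝ) := by
          rw [Real.sqrt_eq_rpow, Real.rpow_neg hh0.le]
          exact one_div _
        rw [h2, ← Real.rpow_add hh0, hw]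
        norm_num
      calc _ ≤ 1 * ((4 * h ^ (-(1 / 4) : ℝ)) * (C * (1 / √h))) := by
            have := abs_log_le_rpow hh0 hh1
            gcongr
        _ = 4 * C * (h ^ (-(1 / 4) : ℝ) * (1 / √h)) := by ring
        _ = 4 * C * w := by rw [hww]
    have e5 : |1 / √2 * ((M - A) / h)| ≤ C * w := by
      rw [abs_mul, abs_of_nonneg (by positivity : (0 : ℝ) ≤ 1 / √2), abs_div, abs_of_pos hh0]
      calc _ ≤ 1 * (C * √h / h) := by gcongr
        _ = C * (1 / √h) := by
          have : √h ^ 2 = h := Real.sq_sqrt hh0.le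
          generalize √h = s at *
          rw [← this]
          field_simp
        _ ≤ C * w := by gcongr
    -- The term `(A/2)(√2/h)` split off from `I` equals `(1/√2) A/h`, which turns `M/h` into `(M -
    -- A)/h = O(1/√h)`.
    have e6 : J - A / 2 * I + 1 / √2 * (M * (h⁻¹ * 1) + Real.log h * D) =
        J + -(A / 2 * (I - √2 / h)) + (1 / √2 * (Real.log h * D) + 1 / √2 * ((M - A) / h)) := by
      have : √2 ^ 2 = 2 := Real.sq_sqrt (by norm_num)
      have h2 : (0 : ℝ) < √2 := by positivity
      generalize √2 = s at *
      field_simp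
      linear_combination (-A) * this
    have e7 : 6 * C * (2 / √h) ≤ 12 * C * w := by
      calc 6 * C * (2 / √h) = 12 * C * (1 / √h) := by ring
        _ ≤ 12 * C * w := by gcongr
    simp only
    rw [e6, ← hw]
    refine (abs_add_three _ _ _).trans ?_
    rw [abs_neg]
    have e8 := abs_add_le (1 / √2 * (Real.log h * D)) (1 / √2 * ((M - A) / h))
    have hw0 : 0 ≤ w := (by positivity : 0 ≤ 1 / √h).trans hsw
    have e9 : 0 ≤ (6 * C * δ + C * |K1| + 2 * C) * w := by positivity
    linarith

end WellBranch

end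

/-! ### Hölder continuity up to the bottom, and the substitution `f_Δ = v²`. -/

noncomputable section

theorem hasDerivAt_slice_fst {f : ℝ × ℝ → ℝ} {x t : ℝ} (h : DifferentiableAt ℝ f (x, t)) :
    HasDerivAt (fun x => f (x, t)) (fderiv ℝ f (x, t) (1, 0)) x := by
  have h1 : HasDerivAt (fun x : ℝ => (x, t)) ((1 : ℝ), (0 : ℝ)) x :=
    (hasDerivAt_id x).prodMk (hasDerivAt_const x t)
  exact h.hasFDerivAt.comp_hasDerivAt x h1

theorem hasDerivAt_slice_snd {f : ℝ × ℝ → ℝ} {x t : ℝ} (h : DifferentiableAt ℝ f (t, x)) :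
    HasDerivAt (fun x => f (t, x)) (fderiv ℝ f (t, x) (0, 1)) x := by
  have h1 : HasDerivAt (fun x : ℝ => (t, x)) ((0 : ℝ), (1 : ℝ)) x :=
    (hasDerivAt_const x t).prodMk (hasDerivAt_id x)
  exact h.hasFDerivAt.comp_hasDerivAt x h1

theorem abs_sub_le_of_fderiv_le_strip {f : ℝ × ℝ → ℝ} {c d r C : ℝ} (hcd : d - c ≤ 1) (hC : 0 ≤ C)
    (hf : ∀ p ∈ Ioo c d ×ˢ Ioo 0 r, DifferentiableAt ℝ f p)
    (h1 : ∀ p ∈ Ioo c d ×ˢ Ioo 0 r, |fderiv ℝ f p (1, 0)| ≤ C)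
    (h2 : ∀ p ∈ Ioo c d ×ˢ Ioo 0 r, |fderiv ℝ f p (0, 1)| ≤ C * p.2 ^ (-(3 / 4) : ℝ)) :
    ∀ p ∈ Ioo c d ×ˢ Ioo 0 r, ∀ q ∈ Ioo c d ×ˢ Ioo 0 r,
      |f p - f q| ≤ 2 * (4 * C) * ‖p - q‖ ^ (1 / 4 : ℝ) := by
  intro p hp q hq
  refine abs_sub_le_norm_rpow_of_slices (by positivity) (fun t ht x hx y hy => ?_)
    (fun t ht x hx y hy => ?_) hp hq
  · refine (abs_sub_le_of_abs_deriv_le hcd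
      (fun x hx => hasDerivAt_slice_fst (hf (x, t) ⟨hx, ht⟩))
      (fun x hx => h1 (x, t) ⟨hx, ht⟩) hx hy).trans ?_
    gcongr
    linarith
  · exact abs_sub_le_of_abs_deriv_le_rpow hC
      (fun x hx => hasDerivAt_slice_snd (hf (t, x) ⟨ht, hx⟩))
      (fun x hx => h2 (t, x) ⟨ht, hx⟩) hx hy

theorem abs_sub_le_of_fderiv_le_quadrant {f : ℝ × ℝ → ℝ} {r C : ℝ} (hC : 0 ≤ C)
    (hf : ∀ p ∈ Ioo 0 r ×ˢ Ioo 0 r, DifferentiableAt ℝ f p)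
    (h1 : ∀ p ∈ Ioo 0 r ×ˢ Ioo 0 r, |fderiv ℝ f p (1, 0)| ≤ C * p.1 ^ (-(3 / 4) : ℝ))
    (h2 : ∀ p ∈ Ioo 0 r ×ˢ Ioo 0 r, |fderiv ℝ f p (0, 1)| ≤ C * p.2 ^ (-(3 / 4) : ℝ)) :
    ∀ p ∈ Ioo 0 r ×ˢ Ioo 0 r, ∀ q ∈ Ioo 0 r ×ˢ Ioo 0 r,
      |f p - f q| ≤ 2 * (4 * C) * ‖p - q‖ ^ (1 / 4 : ℝ) := by
  intro p hp q hq
  refine abs_sub_le_norm_rpow_of_slices (by positivity) (fun t ht x hx y hy => ?_)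
    (fun t ht x hx y hy => ?_) hp hq
  · exact abs_sub_le_of_abs_deriv_le_rpow hC
      (fun x hx => hasDerivAt_slice_fst (hf (x, t) ⟨hx, ht⟩))
      (fun x hx => h1 (x, t) ⟨hx, ht⟩) hx hy
  · exact abs_sub_le_of_abs_deriv_le_rpow hC
      (fun x hx => hasDerivAt_slice_snd (hf (t, x) ⟨ht, hx⟩))
      (fun x hx => h2 (t, x) ⟨ht, hx⟩) hx hy

namespace WellBranch

variable {F : ℝ → ℝ} {W V S : Set ℝ} {a ζ : ℝ → ℝ} {z : ℝ × ℝ → ℝ} {g : ℝ → ℝ} {ε δ : ℝ}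

/-- The derivative bounds give a Hölder estimate on the box, and a Hölder function has a limit at a
boundary point. The bound `r ≤ 1/2` keeps the width of the box at most 1. -/
theorem exists_tendsto_regularPart {σ₀ C r : ℝ} (hr : 0 < r) (hr2 : r ≤ 1 / 2) (hC : 0 ≤ C)
    (hcd : ContDiffOn ℝ 1 (regularPart F a z g ε δ) (Ioo (σ₀ - r) (σ₀ + r) ×ˢ Ioo 0 r))
    (hb : ∀ p ∈ Ioo (σ₀ - r) (σ₀ + r) ×ˢ Ioo 0 r,
      |fderiv ℝ (regularPart F a z g ε δ) p (1, 0)| ≤ C ∧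
        |fderiv ℝ (regularPart F a z g ε δ) p (0, 1)| ≤ C * p.2 ^ (-(3 / 4) : ℝ)) :
    ∃ y, Tendsto (regularPart F a z g ε δ) (𝓝[{p : ℝ × ℝ | 0 < p.2}] (σ₀, 0)) (𝓝 y) := by
  have hopen : IsOpen (Ioo (σ₀ - r) (σ₀ + r) ×ˢ Ioo 0 r) := isOpen_Ioo.prod isOpen_Ioo
  have hcl : (σ₀, (0 : ℝ)) ∈ closure (Ioo (σ₀ - r) (σ₀ + r) ×ˢ Ioo 0 r) := by
    rw [closure_prod_eq, closure_Ioo (by linarith), closure_Ioo hr.ne]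
    exact ⟨⟨by linarith, by linarith⟩, le_rfl, hr.le⟩
  obtain ⟨y, hy⟩ := exists_tendsto_of_abs_sub_le_norm_rpow hcl
    (abs_sub_le_of_fderiv_le_strip (by linarith) hC
      (fun p hp => (hcd.contDiffAt (hopen.mem_nhds hp)).differentiableAt (by norm_num))
      (fun p hp => (hb p hp).1) (fun p hp => (hb p hp).2))
  -- Near `(σ₀, 0)` the open half-plane and the box coincide.
  refine ⟨y, hy.mono_left ?_⟩
  rw [nhdsWithin_le_iff, mem_nhdsWithin]
  refine ⟨Ioo (σ₀ - r) (σ₀ + r) ×ˢ Ioo (-r) r, isOpen_Ioo.prod isOpen_Ioo,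
    ⟨⟨by simpa, by simpa⟩, by simpa, hr⟩, fun p hp => ⟨hp.1.1, hp.2, hp.1.2.2⟩⟩

/-- Parametrize the branch by `v`, with the point at height `h + v²`. The Jacobian `2v/Φ_σ'` removes
the `1/√f` singularity at the left endpoint, so integrability comes with the formula. -/
theorem integral_eq_branchIntegral (H : WellBranch F W V S a ζ z) (hg : ContDiff ℝ 2 g)
    (hδ : 0 < δ) (hεδ : ε ^ 2 * δ ^ 2 ≤ 1) {p : ℝ × ℝ}
    (hp : ∀ v ∈ Icc 0 δ, p + (0, v ^ 2) ∈ heightRegion F S a ζ) :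
    IntervalIntegrable
        (fun x => g x / hPlus ε (gibbs F p.1 x - (gibbs F p.1 (a p.1) + p.2))) volume
        (heightBranch F a z p) (heightBranch F a z (p + (0, δ ^ 2))) ∧
      ∫ x in (heightBranch F a z p)..(heightBranch F a z (p + (0, δ ^ 2))),
        g x / hPlus ε (gibbs F p.1 x - (gibbs F p.1 (a p.1) + p.2)) =
          branchIntegral F a z g ε δ p := by
  obtain ⟨f, hf⟩ : ∃ f : ℝ → ℝ, f = fun v => heightBranch F a z (p + (0, v ^ 2)) := ⟨_, rfl⟩
  have hfv : ∀ v ∈ Icc 0 δ, gibbs F p.1 (f v) = gibbs F p.1 (a p.1) + (p.2 + v ^ 2) := by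
    intro v hv
    have := H.gibbs_z (heightRegion_mapsTo _ (hp v hv))
    simp only [Prod.fst_add, Prod.snd_add, add_zero] at this
    rw [hf]
    simpa only [heightBranch, Prod.fst_add, Prod.snd_add, add_zero] using this
  have hfmem : ∀ v ∈ Icc 0 δ, f v ∈ Icc (a p.1) (ζ p.1) := by
    intro v hv
    have := Ioo_subset_Icc_self (H.z_mem_Ioo (heightRegion_mapsTo _ (hp v hv)))
    simp only [Prod.fst_add, Prod.snd_add, add_zero] at this
    rw [hf]
    simpa only [heightBranch, Prod.fst_add, Prod.snd_add, add_zero] using this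
  have hpS : p.1 ∈ S := by simpa using (hp 0 ⟨le_rfl, hδ.le⟩).1
  have hm : StrictMonoOn f (Icc 0 δ) := by
    intro u hu v hv huv
    rw [← (H.strictMonoOn_gibbs hpS).lt_iff_lt (hfmem u hu) (hfmem v hv), hfv u hu, hfv v hv]
    have := pow_lt_pow_left₀ huv hu.1 two_ne_zero
    linarith
  have hd : ∀ v ∈ Icc 0 δ, HasDerivAt f ((deriv F (f v) - p.1)⁻¹ * (2 * v)) v := by
    intro v hv
    have h1 : HasDerivAt (fun v : ℝ => p + ((0 : ℝ), v ^ 2)) ((0 : ℝ), 2 * v) v := by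
      have h2 : HasDerivAt (fun v : ℝ => v ^ 2) (2 * v) v := by simpa using hasDerivAt_pow 2 v
      exact ((hasDerivAt_const v (0 : ℝ)).prodMk h2).const_add p
    have h3 := (H.hasFDerivAt_heightBranch (hp v hv)).comp_hasDerivAt v h1
    rw [hf]
    refine h3.congr_deriv ?_
    simp
  have hslope : ∀ v ∈ Icc 0 δ, 0 < deriv F (f v) - p.1 := by
    intro v hv
    have := H.slope_heightBranch (hp v hv)
    rw [hf]
    simpa only [Prod.fst_add, add_zero] using this
  have hεv : ∀ v ∈ Icc 0 δ, ε ^ 2 * v ^ 2 < 2 := fun v hv => by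
    have : ε ^ 2 * v ^ 2 ≤ ε ^ 2 * δ ^ 2 := by have := hv.1; have := hv.2; gcongr
    linarith
  have hc : ContinuousOn (fun v => kernelWeight ε v * branchDensity F a z g (p + (0, v ^ 2)))
      (Icc 0 δ) := by
    refine ((contDiffOn_kernelWeight ε).continuousOn.mono fun v hv => hεv v hv).mul ?_
    exact (H.contDiffOn_branchDensity hg).continuousOn.comp
      (f := fun v : ℝ => p + ((0 : ℝ), v ^ 2)) (by fun_prop) hp
  have key := integral_eq_integral_comp_mul_deriv_of_strictMonoOn
    (g := fun x => g x / hPlus ε (gibbs F p.1 x - (gibbs F p.1 (a p.1) + p.2)))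
    (G := fun v => kernelWeight ε v * branchDensity F a z g (p + (0, v ^ 2))) hδ.le
    (fun v hv => (hd v hv).continuousAt.continuousWithinAt) hm
    (fun v hv => hd v (Ioo_subset_Icc_self hv)) (fun v hv => ?_)
    (ContinuousOn.intervalIntegrable (by rwa [uIcc_of_le hδ.le]))
    (fun v hv => mul_nonneg (inv_nonneg.2 (hslope v (Ioo_subset_Icc_self hv)).le)
      (by linarith [hv.1]))
  · have h0 : f 0 = heightBranch F a z p := by rw [hf]; simp [Prod.mk_zero_zero]
    have h1 : f δ = heightBranch F a z (p + (0, δ ^ 2)) := by rw [hf]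
    rw [h0, h1] at key
    exact key
  · have hv' := Ioo_subset_Icc_self hv
    rw [hfv v hv', show gibbs F p.1 (a p.1) + (p.2 + v ^ 2) - (gibbs F p.1 (a p.1) + p.2) = v ^ 2 by
      ring, ← inv_hPlus_sq_mul ε hv.1, branchDensity]
    have : heightBranch F a z (p + (0, v ^ 2)) = f v := by rw [hf]
    rw [this, Prod.fst_add, add_zero]
    ring

end WellBranch

end

/-! ### Critical points and wells of a free energy, and reflection. -/

noncomputable section

/-- Continuity of the solution `z (σ, b)` of `Φ_σ(z) = b` in `[a σ, c σ]`. -/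
theorem continuousOn_gibbs_solution {F : ℝ → ℝ} {I W : Set ℝ} {a c : ℝ → ℝ} {z : ℝ × ℝ → ℝ}
    {T : Set (ℝ × ℝ)} (hI : IsCompact I) (hF : ContinuousOn F W) (ha : ContinuousOn a I)
    (hc : ContinuousOn c I) (hac : ∀ σ ∈ I, a σ ≤ c σ) (hW : ∀ σ ∈ I, Icc (a σ) (c σ) ⊆ W)
    (hinj : ∀ σ ∈ I, InjOn (gibbs F σ) (Icc (a σ) (c σ))) (hT : ∀ p ∈ T, p.1 ∈ I)
    (hz : ∀ p ∈ T, z p ∈ Icc (a p.1) (c p.1)) (hze : ∀ p ∈ T, gibbs F p.1 (z p) = p.2) :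
    ContinuousOn z T := by
  have hfst : ContinuousOn (fun q : ℝ × ℝ => a q.1) (I ×ˢ Icc (0 : ℝ) 1) :=
    ha.comp continuousOn_fst fun q hq => hq.1
  have hfst' : ContinuousOn (fun q : ℝ × ℝ => c q.1) (I ×ˢ Icc (0 : ℝ) 1) :=
    hc.comp continuousOn_fst fun q hq => hq.1
  -- The region between the graphs of `a` and `c` is compact, being the image of a rectangle under
  -- the affine parametrization of each fibre; on it `(σ, x) ↦ (σ, Φ_σ(x))` is injective.
  have hK : IsCompact ((fun q : ℝ × ℝ => (q.1, a q.1 + q.2 * (c q.1 - a q.1))) ''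
      (I ×ˢ Icc (0 : ℝ) 1)) :=
    (hI.prod isCompact_Icc).image_of_continuousOn
      (continuousOn_fst.prodMk (hfst.add (continuousOn_snd.mul (hfst'.sub hfst))))
  have hsub : (fun q : ℝ × ℝ => (q.1, a q.1 + q.2 * (c q.1 - a q.1))) '' (I ×ˢ Icc (0 : ℝ) 1) ⊆
      {q | q.1 ∈ I ∧ q.2 ∈ Icc (a q.1) (c q.1)} := by
    rintro _ ⟨⟨σ, t⟩, ⟨hσ, ht0, ht1⟩, rfl⟩
    have := hac σ hσ
    simp only at ht0 ht1
    refine ⟨hσ, ?_, ?_⟩ <;> simp only <;> nlinarith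
  have hsup : {q : ℝ × ℝ | q.1 ∈ I ∧ q.2 ∈ Icc (a q.1) (c q.1)} ⊆
      (fun q : ℝ × ℝ => (q.1, a q.1 + q.2 * (c q.1 - a q.1))) '' (I ×ˢ Icc (0 : ℝ) 1) := by
    rintro ⟨σ, x⟩ ⟨hσ, h1, h2⟩
    simp only at hσ h1 h2
    rcases eq_or_lt_of_le (hac σ hσ) with h | h
    · exact ⟨(σ, 0), ⟨hσ, by simp⟩, by simp; linarith⟩
    · refine ⟨(σ, (x - a σ) / (c σ - a σ)), ⟨hσ, ?_, ?_⟩, ?_⟩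
      · exact div_nonneg (by linarith) (by linarith)
      · exact (div_le_one (by linarith)).2 (by linarith)
      · have : c σ - a σ ≠ 0 := by linarith
        simp only [Prod.mk.injEq, true_and]
        field_simp
        ring
  have hcont : ContinuousOn (fun q : ℝ × ℝ => (q.1, gibbs F q.1 q.2))
      ((fun q : ℝ × ℝ => (q.1, a q.1 + q.2 * (c q.1 - a q.1))) '' (I ×ˢ Icc (0 : ℝ) 1)) := by
    refine continuousOn_fst.prodMk (ContinuousOn.sub ?_ (continuousOn_fst.mul continuousOn_snd))
    exact hF.comp continuousOn_snd fun q hq => hW _ (hsub hq).1 (hsub hq).2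
  have := continuousOn_of_rightInverse_of_isCompact (g := fun p : ℝ × ℝ => (p.1, z p)) (S := T)
    hK hcont ?_ (fun p hp => hsup ⟨hT p hp, hz p hp⟩) (fun p hp => Prod.ext rfl (hze p hp))
  · exact continuousOn_snd.comp this fun p _ => mem_univ _
  · intro q hq q' hq' h
    obtain ⟨h1, h2⟩ := Prod.mk.inj h
    refine Prod.ext h1 (hinj q.1 (hsub hq).1 (hsub hq).2 ?_ ?_)
    · rw [h1]; exact (hsub hq').2
    · rw [h2, h1]

namespace IsFreeEnergy

variable {F : ℝ → ℝ} {αbar βbar : ℝ}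

theorem beta_pos (hF : IsFreeEnergy F αbar βbar) : 0 < βbar :=
  hF.alpha_pos.trans hF.alpha_lt_beta

theorem contDiffOn_deriv (hF : IsFreeEnergy F αbar βbar) : ContDiffOn ℝ 4 (deriv F) (Ioi 0) :=
  hF.contDiffOn.deriv_of_isOpen isOpen_Ioi (by norm_num)

theorem contDiffOn_deriv2 (hF : IsFreeEnergy F αbar βbar) :
    ContDiffOn ℝ 3 (deriv (deriv F)) (Ioi 0) :=
  hF.contDiffOn_deriv.deriv_of_isOpen isOpen_Ioi (by norm_num)

theorem differentiableAt (hF : IsFreeEnergy F αbar βbar) {x : ℝ} (hx : 0 < x) :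
    DifferentiableAt ℝ F x :=
  (hF.contDiffOn.contDiffAt (Ioi_mem_nhds hx)).differentiableAt (by norm_num)

theorem strictMonoOn_left (hF : IsFreeEnergy F αbar βbar) :
    StrictMonoOn (deriv F) (Ioc 0 αbar) := by
  refine strictMonoOn_of_deriv_pos (convex_Ioc _ _)
    (hF.contDiffOn_deriv.continuousOn.mono fun x hx => hx.1) fun x hx => ?_
  rw [interior_Ioc] at hx
  exact hF.convex_left x hx

theorem strictAntiOn_mid (hF : IsFreeEnergy F αbar βbar) :
    StrictAntiOn (deriv F) (Icc αbar βbar) := by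
  refine strictAntiOn_of_deriv_neg (convex_Icc _ _)
    (hF.contDiffOn_deriv.continuousOn.mono fun x hx => hF.alpha_pos.trans_le hx.1) fun x hx => ?_
  rw [interior_Icc] at hx
  exact hF.concave_mid x hx

theorem strictMonoOn_right (hF : IsFreeEnergy F αbar βbar) :
    StrictMonoOn (deriv F) (Ici βbar) := by
  refine strictMonoOn_of_deriv_pos (convex_Ici _)
    (hF.contDiffOn_deriv.continuousOn.mono fun x hx => hF.beta_pos.trans_le hx) fun x hx => ?_
  rw [interior_Ici] at hx
  exact hF.convex_right x hx

theorem deriv2_nonpos (hF : IsFreeEnergy F αbar βbar) {x : ℝ} (hx : x ∈ Icc αbar βbar) :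
    deriv (deriv F) x ≤ 0 := by
  have hcl : x ∈ closure (Ioo αbar βbar) := by rwa [closure_Ioo hF.alpha_lt_beta.ne]
  have hx0 : 0 < x := hF.alpha_pos.trans_le hx.1
  have hc : ContinuousWithinAt (deriv (deriv F)) (Ioo αbar βbar) x :=
    (hF.contDiffOn_deriv2.continuousOn.continuousAt (Ioi_mem_nhds hx0)).continuousWithinAt
  exact hc.closure_le hcl continuousWithinAt_const fun y hy => (hF.concave_mid y hy).le

theorem low_lt_up (hF : IsFreeEnergy F αbar βbar) : sigmaLow F βbar < sigmaUp F αbar :=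
  hF.strictAntiOn_mid ⟨le_rfl, hF.alpha_lt_beta.le⟩ ⟨hF.alpha_lt_beta.le, le_rfl⟩ hF.alpha_lt_beta

/-- The limit of `F'` at zero lies below the lower end of the range of `σ`, so some point near zero
has smaller slope than `σ`; the intermediate value theorem does the rest. -/
theorem exists_alpha (hF : IsFreeEnergy F αbar βbar) {σ : ℝ}
    (hσ : σ ∈ Icc (sigmaLow F βbar) (sigmaUp F αbar)) : ∃ x ∈ Ioc 0 αbar, deriv F x = σ := by
  obtain ⟨L, hL, hlt⟩ := hF.slope_zero
  have h1 : ∀ᶠ x in 𝓝[>] (0 : ℝ), ((deriv F x : ℝ) : EReal) < ((deriv F βbar : ℝ) : EReal) :=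
    hL.eventually_lt_const hlt
  have h2 : ∀ᶠ x in 𝓝[>] (0 : ℝ), x ∈ Ioo 0 αbar := Ioo_mem_nhdsGT hF.alpha_pos
  obtain ⟨x, hx, hx0⟩ := (h1.and h2).exists
  have hx' : deriv F x < sigmaLow F βbar := EReal.coe_lt_coe_iff.1 hx
  obtain ⟨y, hy, hye⟩ := intermediate_value_Icc hx0.2.le
    (hF.contDiffOn_deriv.continuousOn.mono fun t ht => hx0.1.trans_le ht.1)
    (show σ ∈ Icc (deriv F x) (deriv F αbar) from ⟨hx'.le.trans hσ.1, hσ.2⟩)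
  exact ⟨y, ⟨hx0.1.trans_le hy.1, hy.2⟩, hye⟩

theorem exists_beta (hF : IsFreeEnergy F αbar βbar) {σ : ℝ}
    (hσ : σ ∈ Icc (sigmaLow F βbar) (sigmaUp F αbar)) : ∃ x ∈ Ici βbar, deriv F x = σ := by
  obtain ⟨L, hL, hlt⟩ := hF.slope_infty
  have h1 : ∀ᶠ x : ℝ in atTop, ((deriv F αbar : ℝ) : EReal) < ((deriv F x : ℝ) : EReal) :=
    hL.eventually_const_lt hlt
  obtain ⟨x, hx, hx0⟩ := (h1.and (eventually_ge_atTop βbar)).exists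
  have hx' : sigmaUp F αbar < deriv F x := EReal.coe_lt_coe_iff.1 hx
  obtain ⟨y, hy, hye⟩ := intermediate_value_Icc hx0
    (hF.contDiffOn_deriv.continuousOn.mono fun t ht => hF.beta_pos.trans_le ht.1)
    (show σ ∈ Icc (deriv F βbar) (deriv F x) from ⟨hσ.1, hσ.2.trans hx'.le⟩)
  exact ⟨y, hy.1, hye⟩

theorem exists_zeta (hF : IsFreeEnergy F αbar βbar) {σ : ℝ}
    (hσ : σ ∈ Icc (sigmaLow F βbar) (sigmaUp F αbar)) : ∃ x ∈ Icc αbar βbar, deriv F x = σ :=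
  intermediate_value_Icc' hF.alpha_lt_beta.le
    (hF.contDiffOn_deriv.continuousOn.mono fun _ ht => hF.alpha_pos.trans_le ht.1) hσ

variable {σ : ℝ}

theorem alpha_mem (hF : IsFreeEnergy F αbar βbar)
    (hσ : σ ∈ Icc (sigmaLow F βbar) (sigmaUp F αbar)) : critAlpha F αbar σ ∈ Ioc 0 αbar :=
  Function.invFunOn_mem (hF.exists_alpha hσ)

theorem deriv_alpha (hF : IsFreeEnergy F αbar βbar)
    (hσ : σ ∈ Icc (sigmaLow F βbar) (sigmaUp F αbar)) : deriv F (critAlpha F αbar σ) = σ :=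
  Function.invFunOn_eq (hF.exists_alpha hσ)

theorem beta_mem (hF : IsFreeEnergy F αbar βbar)
    (hσ : σ ∈ Icc (sigmaLow F βbar) (sigmaUp F αbar)) : critBeta F βbar σ ∈ Ici βbar :=
  Function.invFunOn_mem (hF.exists_beta hσ)

theorem deriv_beta (hF : IsFreeEnergy F αbar βbar)
    (hσ : σ ∈ Icc (sigmaLow F βbar) (sigmaUp F αbar)) : deriv F (critBeta F βbar σ) = σ :=
  Function.invFunOn_eq (hF.exists_beta hσ)

theorem zeta_mem (hF : IsFreeEnergy F αbar βbar)
    (hσ : σ ∈ Icc (sigmaLow F βbar) (sigmaUp F αbar)) : critZeta F αbar βbar σ ∈ Icc αbar βbar :=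
  Function.invFunOn_mem (hF.exists_zeta hσ)

theorem deriv_zeta (hF : IsFreeEnergy F αbar βbar)
    (hσ : σ ∈ Icc (sigmaLow F βbar) (sigmaUp F αbar)) : deriv F (critZeta F αbar βbar σ) = σ :=
  Function.invFunOn_eq (hF.exists_zeta hσ)

theorem alpha_le_iff (hF : IsFreeEnergy F αbar βbar) {τ : ℝ}
    (hσ : σ ∈ Icc (sigmaLow F βbar) (sigmaUp F αbar))
    (hτ : τ ∈ Icc (sigmaLow F βbar) (sigmaUp F αbar)) :
    critAlpha F αbar σ ≤ critAlpha F αbar τ ↔ σ ≤ τ := by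
  rw [← hF.strictMonoOn_left.le_iff_le (hF.alpha_mem hσ) (hF.alpha_mem hτ), hF.deriv_alpha hσ,
    hF.deriv_alpha hτ]

theorem beta_le_iff (hF : IsFreeEnergy F αbar βbar) {τ : ℝ}
    (hσ : σ ∈ Icc (sigmaLow F βbar) (sigmaUp F αbar))
    (hτ : τ ∈ Icc (sigmaLow F βbar) (sigmaUp F αbar)) :
    critBeta F βbar σ ≤ critBeta F βbar τ ↔ σ ≤ τ := by
  rw [← hF.strictMonoOn_right.le_iff_le (hF.beta_mem hσ) (hF.beta_mem hτ), hF.deriv_beta hσ,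
    hF.deriv_beta hτ]

theorem zeta_le_iff (hF : IsFreeEnergy F αbar βbar) {τ : ℝ}
    (hσ : σ ∈ Icc (sigmaLow F βbar) (sigmaUp F αbar))
    (hτ : τ ∈ Icc (sigmaLow F βbar) (sigmaUp F αbar)) :
    critZeta F αbar βbar σ ≤ critZeta F αbar βbar τ ↔ τ ≤ σ := by
  rw [← hF.strictAntiOn_mid.le_iff_ge (hF.zeta_mem hτ) (hF.zeta_mem hσ), hF.deriv_zeta hσ,
    hF.deriv_zeta hτ]

theorem low_mem (hF : IsFreeEnergy F αbar βbar) :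
    sigmaLow F βbar ∈ Icc (sigmaLow F βbar) (sigmaUp F αbar) := ⟨le_rfl, hF.low_lt_up.le⟩

theorem up_mem (hF : IsFreeEnergy F αbar βbar) :
    sigmaUp F αbar ∈ Icc (sigmaLow F βbar) (sigmaUp F αbar) := ⟨hF.low_lt_up.le, le_rfl⟩

theorem alpha_up (hF : IsFreeEnergy F αbar βbar) : critAlpha F αbar (sigmaUp F αbar) = αbar :=
  hF.strictMonoOn_left.injOn (hF.alpha_mem hF.up_mem)
    (show αbar ∈ Ioc 0 αbar from ⟨hF.alpha_pos, le_rfl⟩)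
    (hF.deriv_alpha hF.up_mem)

theorem zeta_up (hF : IsFreeEnergy F αbar βbar) : critZeta F αbar βbar (sigmaUp F αbar) = αbar :=
  hF.strictAntiOn_mid.injOn (hF.zeta_mem hF.up_mem)
    (show αbar ∈ Icc αbar βbar from ⟨le_rfl, hF.alpha_lt_beta.le⟩)
    (hF.deriv_zeta hF.up_mem)

theorem zeta_low (hF : IsFreeEnergy F αbar βbar) : critZeta F αbar βbar (sigmaLow F βbar) = βbar :=
  hF.strictAntiOn_mid.injOn (hF.zeta_mem hF.low_mem)
    (show βbar ∈ Icc αbar βbar from ⟨hF.alpha_lt_beta.le, le_rfl⟩)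
    (hF.deriv_zeta hF.low_mem)

theorem beta_low (hF : IsFreeEnergy F αbar βbar) : critBeta F βbar (sigmaLow F βbar) = βbar :=
  hF.strictMonoOn_right.injOn (hF.beta_mem hF.low_mem) self_mem_Ici (hF.deriv_beta hF.low_mem)

theorem continuousOn_alpha (hF : IsFreeEnergy F αbar βbar) :
    ContinuousOn (critAlpha F αbar) (Icc (sigmaLow F βbar) (sigmaUp F αbar)) := by
  have h0 := (hF.alpha_mem hF.low_mem).1
  refine continuousOn_of_rightInverse_of_isCompact (f := deriv F)
    (K := Icc (critAlpha F αbar (sigmaLow F βbar)) αbar) isCompact_Icc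
    (hF.contDiffOn_deriv.continuousOn.mono fun x hx => h0.trans_le hx.1)
    (hF.strictMonoOn_left.injOn.mono (Icc_subset_Ioc h0 le_rfl))
    (fun σ hσ => ⟨(hF.alpha_le_iff hF.low_mem hσ).2 hσ.1, (hF.alpha_mem hσ).2⟩)
    fun σ hσ => hF.deriv_alpha hσ

theorem continuousOn_beta (hF : IsFreeEnergy F αbar βbar) :
    ContinuousOn (critBeta F βbar) (Icc (sigmaLow F βbar) (sigmaUp F αbar)) := by
  refine continuousOn_of_rightInverse_of_isCompact (f := deriv F)
    (K := Icc βbar (critBeta F βbar (sigmaUp F αbar))) isCompact_Icc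
    (hF.contDiffOn_deriv.continuousOn.mono fun x hx => hF.beta_pos.trans_le hx.1)
    (hF.strictMonoOn_right.injOn.mono fun x hx => hx.1)
    (fun σ hσ => ⟨hF.beta_mem hσ, (hF.beta_le_iff hσ hF.up_mem).2 hσ.2⟩)
    fun σ hσ => hF.deriv_beta hσ

theorem continuousOn_zeta (hF : IsFreeEnergy F αbar βbar) :
    ContinuousOn (critZeta F αbar βbar) (Icc (sigmaLow F βbar) (sigmaUp F αbar)) := by
  refine continuousOn_of_rightInverse_of_isCompact (f := deriv F)
    (K := Icc αbar βbar) isCompact_Icc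
    (hF.contDiffOn_deriv.continuousOn.mono fun x hx => hF.alpha_pos.trans_le hx.1)
    hF.strictAntiOn_mid.injOn (fun σ hσ => hF.zeta_mem hσ) fun σ hσ => hF.deriv_zeta hσ

theorem alpha_le_zeta (hF : IsFreeEnergy F αbar βbar)
    (hσ : σ ∈ Icc (sigmaLow F βbar) (sigmaUp F αbar)) :
    critAlpha F αbar σ ≤ critZeta F αbar βbar σ :=
  (hF.alpha_mem hσ).2.trans (hF.zeta_mem hσ).1

theorem zeta_le_beta (hF : IsFreeEnergy F αbar βbar)
    (hσ : σ ∈ Icc (sigmaLow F βbar) (sigmaUp F αbar)) :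
    critZeta F αbar βbar σ ≤ critBeta F βbar σ :=
  (hF.zeta_mem hσ).2.trans (hF.beta_mem hσ)

/-- Split at the inflection point: up to `αbar` the derivative increases from `σ`, beyond it the
derivative decreases to `σ`, reached at `ζ_σ`. -/
theorem slope_pos (hF : IsFreeEnergy F αbar βbar)
    (hσ : σ ∈ Icc (sigmaLow F βbar) (sigmaUp F αbar)) {x : ℝ}
    (hx : x ∈ Ioo (critAlpha F αbar σ) (critZeta F αbar βbar σ)) : σ < deriv F x := by
  have h0 := hF.alpha_mem hσ
  have h1 := hF.zeta_mem hσ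
  rcases le_total x αbar with h | h
  · conv_lhs => rw [← hF.deriv_alpha hσ]
    exact hF.strictMonoOn_left h0 ⟨h0.1.trans hx.1, h⟩ hx.1
  · conv_lhs => rw [← hF.deriv_zeta hσ]
    exact hF.strictAntiOn_mid ⟨h, hx.2.le.trans h1.2⟩ h1 hx.2

theorem slope_neg (hF : IsFreeEnergy F αbar βbar)
    (hσ : σ ∈ Icc (sigmaLow F βbar) (sigmaUp F αbar)) {x : ℝ}
    (hx : x ∈ Ioo (critZeta F αbar βbar σ) (critBeta F βbar σ)) : deriv F x < σ := by
  have h0 := hF.beta_mem hσ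
  have h1 := hF.zeta_mem hσ
  rcases le_total x βbar with h | h
  · conv_rhs => rw [← hF.deriv_zeta hσ]
    exact hF.strictAntiOn_mid h1 ⟨h1.1.trans hx.1.le, h⟩ hx.1
  · conv_rhs => rw [← hF.deriv_beta hσ]
    exact hF.strictMonoOn_right h h0 hx.2

theorem strictMonoOn_gibbs (hF : IsFreeEnergy F αbar βbar)
    (hσ : σ ∈ Icc (sigmaLow F βbar) (sigmaUp F αbar)) :
    StrictMonoOn (gibbs F σ) (Icc (critAlpha F αbar σ) (critZeta F αbar βbar σ)) := by
  have hd : ∀ x ∈ Icc (critAlpha F αbar σ) (critZeta F αbar βbar σ),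
      HasDerivAt (gibbs F σ) (deriv F x - σ) x :=
    fun x hx => hasDerivAt_gibbs (hF.differentiableAt ((hF.alpha_mem hσ).1.trans_le hx.1))
  refine strictMonoOn_of_deriv_pos (convex_Icc _ _)
    (fun x hx => (hd x hx).continuousAt.continuousWithinAt) fun x hx => ?_
  rw [interior_Icc] at hx
  rw [(hd x (Ioo_subset_Icc_self hx)).deriv]
  exact sub_pos.2 (hF.slope_pos hσ hx)

theorem zeta_pos (hF : IsFreeEnergy F αbar βbar)
    (hσ : σ ∈ Icc (sigmaLow F βbar) (sigmaUp F αbar)) : 0 < critZeta F αbar βbar σ :=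
  hF.alpha_pos.trans_le (hF.zeta_mem hσ).1

theorem strictAntiOn_gibbs (hF : IsFreeEnergy F αbar βbar)
    (hσ : σ ∈ Icc (sigmaLow F βbar) (sigmaUp F αbar)) :
    StrictAntiOn (gibbs F σ) (Icc (critZeta F αbar βbar σ) (critBeta F βbar σ)) := by
  have hd : ∀ x ∈ Icc (critZeta F αbar βbar σ) (critBeta F βbar σ),
      HasDerivAt (gibbs F σ) (deriv F x - σ) x :=
    fun x hx => hasDerivAt_gibbs (hF.differentiableAt ((hF.zeta_pos hσ).trans_le hx.1))
  refine strictAntiOn_of_deriv_neg (convex_Icc _ _)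
    (fun x hx => (hd x hx).continuousAt.continuousWithinAt) fun x hx => ?_
  rw [interior_Icc] at hx
  rw [(hd x (Ioo_subset_Icc_self hx)).deriv]
  exact sub_neg.2 (hF.slope_neg hσ hx)

theorem exists_zOne (hF : IsFreeEnergy F αbar βbar) {Δ : ℝ × ℝ}
    (hσ : Δ.1 ∈ Icc (sigmaLow F βbar) (sigmaUp F αbar))
    (hb : Δ.2 ∈ Icc (gibbs F Δ.1 (critAlpha F αbar Δ.1)) (gibbs F Δ.1 (critZeta F αbar βbar Δ.1))) :
    ∃ x ∈ Icc (critAlpha F αbar Δ.1) (critZeta F αbar βbar Δ.1), gibbs F Δ.1 x = Δ.2 :=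
  intermediate_value_Icc (hF.alpha_le_zeta hσ) (fun _ hx =>
    (hasDerivAt_gibbs (hF.differentiableAt
      ((hF.alpha_mem hσ).1.trans_le hx.1))).continuousAt.continuousWithinAt) hb

theorem exists_zTwo (hF : IsFreeEnergy F αbar βbar) {Δ : ℝ × ℝ}
    (hσ : Δ.1 ∈ Icc (sigmaLow F βbar) (sigmaUp F αbar))
    (hb : Δ.2 ∈ Icc (gibbs F Δ.1 (critBeta F βbar Δ.1)) (gibbs F Δ.1 (critZeta F αbar βbar Δ.1))) :
    ∃ x ∈ Icc (critZeta F αbar βbar Δ.1) (critBeta F βbar Δ.1), gibbs F Δ.1 x = Δ.2 :=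
  intermediate_value_Icc' (hF.zeta_le_beta hσ) (fun _ hx =>
    (hasDerivAt_gibbs (hF.differentiableAt
      ((hF.zeta_pos hσ).trans_le hx.1))).continuousAt.continuousWithinAt) hb

theorem continuousOn_zOne (hF : IsFreeEnergy F αbar βbar) :
    ContinuousOn (zOne F αbar βbar) {Δ | Δ.1 ∈ Icc (sigmaLow F βbar) (sigmaUp F αbar) ∧
      Δ.2 ∈ Icc (gibbs F Δ.1 (critAlpha F αbar Δ.1))
        (gibbs F Δ.1 (critZeta F αbar βbar Δ.1))} :=
  continuousOn_gibbs_solution isCompact_Icc hF.contDiffOn.continuousOn hF.continuousOn_alpha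
    hF.continuousOn_zeta (fun _ hσ => hF.alpha_le_zeta hσ)
    (fun _ hσ _ hx => (hF.alpha_mem hσ).1.trans_le hx.1)
    (fun _ hσ => (hF.strictMonoOn_gibbs hσ).injOn) (fun _ hΔ => hΔ.1)
    (fun _ hΔ => Function.invFunOn_mem (hF.exists_zOne hΔ.1 hΔ.2))
    (fun _ hΔ => Function.invFunOn_eq (hF.exists_zOne hΔ.1 hΔ.2))

theorem continuousOn_zTwo (hF : IsFreeEnergy F αbar βbar) :
    ContinuousOn (zTwo F αbar βbar) {Δ | Δ.1 ∈ Icc (sigmaLow F βbar) (sigmaUp F αbar) ∧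
      Δ.2 ∈ Icc (gibbs F Δ.1 (critBeta F βbar Δ.1))
        (gibbs F Δ.1 (critZeta F αbar βbar Δ.1))} :=
  continuousOn_gibbs_solution isCompact_Icc hF.contDiffOn.continuousOn hF.continuousOn_zeta
    hF.continuousOn_beta (fun _ hσ => hF.zeta_le_beta hσ)
    (fun _ hσ _ hx => (hF.zeta_pos hσ).trans_le hx.1)
    (fun _ hσ => (hF.strictAntiOn_gibbs hσ).injOn) (fun _ hΔ => hΔ.1)
    (fun _ hΔ => Function.invFunOn_mem (hF.exists_zTwo hΔ.1 hΔ.2))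
    (fun _ hΔ => Function.invFunOn_eq (hF.exists_zTwo hΔ.1 hΔ.2))

/-- The left well of a free energy. -/
theorem wellBranch_left (hF : IsFreeEnergy F αbar βbar) :
    WellBranch F (Ioi 0) (Ioo 0 αbar) (Ioo (sigmaLow F βbar) (sigmaUp F αbar)) (critAlpha F αbar)
      (critZeta F αbar βbar) (zOne F αbar βbar) where
  isOpen_W := isOpen_Ioi
  isOpen_V := isOpen_Ioo
  V_subset _ hx := hx.1
  isOpen_S := isOpen_Ioo
  contDiffOn := hF.contDiffOn
  convex := hF.convex_left
  a_mem σ hσ := by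
    have h := hF.alpha_mem (Ioo_subset_Icc_self hσ)
    refine ⟨h.1, lt_of_le_of_ne h.2 fun he => hσ.2.ne ?_⟩
    rw [← hF.deriv_alpha (Ioo_subset_Icc_self hσ), he, sigmaUp]
  a_cont := hF.continuousOn_alpha.mono Ioo_subset_Icc_self
  deriv_a σ hσ := hF.deriv_alpha (Ioo_subset_Icc_self hσ)
  ζ_cont := hF.continuousOn_zeta.mono Ioo_subset_Icc_self
  a_lt σ hσ := by
    have h := hF.alpha_mem (Ioo_subset_Icc_self hσ)
    refine lt_of_lt_of_le (lt_of_le_of_ne h.2 fun he => hσ.2.ne ?_)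
      (hF.zeta_mem (Ioo_subset_Icc_self hσ)).1
    rw [← hF.deriv_alpha (Ioo_subset_Icc_self hσ), he, sigmaUp]
  Icc_subset σ hσ x hx := (hF.alpha_mem (Ioo_subset_Icc_self hσ)).1.trans_le hx.1
  slope σ hσ x hx := hF.slope_pos (Ioo_subset_Icc_self hσ) hx
  z_mem σ hσ b hb := Function.invFunOn_mem
    (hF.exists_zOne (Δ := (σ, b)) (Ioo_subset_Icc_self hσ) hb)
  z_eq σ hσ b hb := Function.invFunOn_eq
    (hF.exists_zOne (Δ := (σ, b)) (Ioo_subset_Icc_self hσ) hb)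
  z_cont := hF.continuousOn_zOne.mono fun _ hΔ => ⟨Ioo_subset_Icc_self hΔ.1, hΔ.2⟩

/-- Reflecting the variable together with the slope preserves heights and exchanges left and right
wells, so one theory of branches serves both. -/
theorem gibbs_comp_neg (F : ℝ → ℝ) (σ x : ℝ) :
    gibbs (fun x => F (-x)) σ x = gibbs F (-σ) (-x) := by
  simp [gibbs]

theorem deriv_comp_neg_fun (F : ℝ → ℝ) : deriv (fun x => F (-x)) = fun x => -deriv F (-x) :=
  funext fun x => deriv_comp_neg F x

theorem deriv2_comp_neg_fun (F : ℝ → ℝ) :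
    deriv (deriv (fun x => F (-x))) = fun x => deriv (deriv F) (-x) := by
  rw [deriv_comp_neg_fun]
  funext x
  rw [deriv.fun_neg, deriv_comp_neg, neg_neg]

/-- The right well of a free energy, reflected. -/
theorem wellBranch_right (hF : IsFreeEnergy F αbar βbar) :
    WellBranch (fun x => F (-x)) (Iio 0) (Iio (-βbar))
      (Ioo (-sigmaUp F αbar) (-sigmaLow F βbar)) (fun s => -critBeta F βbar (-s))
      (fun s => -critZeta F αbar βbar (-s)) (fun p => -zTwo F αbar βbar (-p.1, p.2)) := by
  have hneg : ∀ s ∈ Ioo (-sigmaUp F αbar) (-sigmaLow F βbar),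
      -s ∈ Ioo (sigmaLow F βbar) (sigmaUp F αbar) := fun s hs =>
    ⟨by linarith [hs.2], by linarith [hs.1]⟩
  have hneg' : ∀ s ∈ Ioo (-sigmaUp F αbar) (-sigmaLow F βbar),
      -s ∈ Icc (sigmaLow F βbar) (sigmaUp F αbar) := fun s hs =>
    Ioo_subset_Icc_self (hneg s hs)
  have hbm : ∀ s ∈ Ioo (-sigmaUp F αbar) (-sigmaLow F βbar), βbar < critBeta F βbar (-s) := by
    intro s hs
    refine lt_of_le_of_ne (hF.beta_mem (hneg' s hs)) fun he => (hneg s hs).1.ne ?_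
    rw [← hF.deriv_beta (hneg' s hs), ← he, sigmaLow]
  refine
  { isOpen_W := isOpen_Iio
    isOpen_V := isOpen_Iio
    V_subset := fun x hx => lt_trans hx (neg_lt_zero.2 hF.beta_pos)
    isOpen_S := isOpen_Ioo
    contDiffOn := hF.contDiffOn.comp contDiff_neg.contDiffOn fun x hx => by
      simpa using hx
    convex := fun x hx => ?_
    a_mem := fun s hs => neg_lt_neg (hbm s hs)
    a_cont := ((hF.continuousOn_beta.comp continuousOn_neg hneg')).neg
    deriv_a := fun s hs => ?_
    ζ_cont := ((hF.continuousOn_zeta.comp continuousOn_neg hneg')).neg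
    a_lt := fun s hs => neg_lt_neg ((hF.zeta_mem (hneg' s hs)).2.trans_lt (hbm s hs))
    Icc_subset := fun s hs x hx => hx.2.trans_lt (neg_lt_zero.2 (hF.zeta_pos (hneg' s hs)))
    slope := fun s hs x hx => ?_
    z_mem := fun s hs b hb => ?_
    z_eq := fun s hs b hb => ?_
    z_cont := ?_ }
  · rw [deriv2_comp_neg_fun]
    exact hF.convex_right _ (mem_Ioi.2 (lt_neg.1 (mem_Iio.1 hx)))
  · rw [deriv_comp_neg_fun]
    simp only [neg_neg]
    rw [hF.deriv_beta (hneg' s hs), neg_neg]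
  · rw [deriv_comp_neg_fun]
    have := hF.slope_neg (hneg' s hs) (x := -x) ⟨lt_neg.1 hx.2, neg_lt.1 hx.1⟩
    simp only
    linarith
  · simp only [gibbs_comp_neg, neg_neg] at hb
    have := Function.invFunOn_mem (hF.exists_zTwo (Δ := (-s, b)) (hneg' s hs) hb)
    exact ⟨neg_le_neg this.2, neg_le_neg this.1⟩
  · simp only [gibbs_comp_neg, neg_neg] at hb ⊢
    exact Function.invFunOn_eq (hF.exists_zTwo (Δ := (-s, b)) (hneg' s hs) hb)
  · refine (hF.continuousOn_zTwo.comp (f := fun p : ℝ × ℝ => (-p.1, p.2)) (by fun_prop)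
      fun p hp => ⟨hneg' _ hp.1, ?_⟩).neg
    have := hp.2
    simpa only [gibbs_comp_neg, neg_neg] using this

end IsFreeEnergy

end

/-! ### Geometry of `Σ`: depth difference, closure and barrier height. -/

noncomputable section

/-- The difference `Φ_σ(β_σ) - Φ_σ(α_σ)` of the depths of the wells. -/
def wellGap (F : ℝ → ℝ) (αbar βbar σ : ℝ) : ℝ :=
  gibbs F σ (critBeta F βbar σ) - gibbs F σ (critAlpha F αbar σ)

/-- A closed set which contains the closure of the set of admissible pairs. -/
def closedRegion (F : ℝ → ℝ) (αbar βbar : ℝ) : Set (ℝ × ℝ) :=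
  {Δ | Δ.1 ∈ Icc (sigmaLow F βbar) (sigmaUp F αbar) ∧
    gibbs F Δ.1 (critAlpha F αbar Δ.1) ≤ Δ.2 ∧ gibbs F Δ.1 (critBeta F βbar Δ.1) ≤ Δ.2 ∧
    Δ.2 ≤ gibbs F Δ.1 (critZeta F αbar βbar Δ.1)}

/-- The part of `closedRegion` below the barrier and over the open range of `σ`. -/
def lowerRegion (F : ℝ → ℝ) (αbar βbar : ℝ) : Set (ℝ × ℝ) :=
  {Δ | Δ.1 ∈ Ioo (sigmaLow F βbar) (sigmaUp F αbar) ∧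
    gibbs F Δ.1 (critAlpha F αbar Δ.1) ≤ Δ.2 ∧ gibbs F Δ.1 (critBeta F βbar Δ.1) ≤ Δ.2 ∧
    Δ.2 < gibbs F Δ.1 (critZeta F αbar βbar Δ.1)}

namespace IsFreeEnergy

variable {F : ℝ → ℝ} {αbar βbar : ℝ}

theorem continuousOn_bottomAlpha (hF : IsFreeEnergy F αbar βbar) :
    ContinuousOn (fun σ => gibbs F σ (critAlpha F αbar σ))
      (Icc (sigmaLow F βbar) (sigmaUp F αbar)) :=
  (hF.contDiffOn.continuousOn.comp hF.continuousOn_alpha fun _ hσ => (hF.alpha_mem hσ).1).sub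
    (continuousOn_id.mul hF.continuousOn_alpha)

theorem continuousOn_bottomBeta (hF : IsFreeEnergy F αbar βbar) :
    ContinuousOn (fun σ => gibbs F σ (critBeta F βbar σ))
      (Icc (sigmaLow F βbar) (sigmaUp F αbar)) :=
  (hF.contDiffOn.continuousOn.comp hF.continuousOn_beta
    fun _ hσ => hF.beta_pos.trans_le (hF.beta_mem hσ)).sub
    (continuousOn_id.mul hF.continuousOn_beta)

theorem continuousOn_top (hF : IsFreeEnergy F αbar βbar) :
    ContinuousOn (fun σ => gibbs F σ (critZeta F αbar βbar σ))
      (Icc (sigmaLow F βbar) (sigmaUp F αbar)) :=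
  (hF.contDiffOn.continuousOn.comp hF.continuousOn_zeta fun _ hσ => hF.zeta_pos hσ).sub
    (continuousOn_id.mul hF.continuousOn_zeta)

theorem neg_mem {σ l u : ℝ} (hσ : σ ∈ Ioo l u) : -σ ∈ Ioo (-u) (-l) :=
  ⟨neg_lt_neg hσ.2, neg_lt_neg hσ.1⟩

theorem hasDerivAt_bottomBeta (hF : IsFreeEnergy F αbar βbar) {σ : ℝ}
    (hσ : σ ∈ Ioo (sigmaLow F βbar) (sigmaUp F αbar)) :
    HasDerivAt (fun s => gibbs F s (critBeta F βbar s)) (-critBeta F βbar σ) σ := by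
  have h1 := (hF.wellBranch_right.hasDerivAt_bottom (neg_mem hσ)).comp σ (hasDerivAt_neg σ)
  simp only [gibbs_comp_neg, neg_neg, mul_neg, mul_one] at h1
  refine h1.congr_of_eventuallyEq (Eventually.of_forall fun s => ?_)
  simp

theorem continuousOn_wellGap (hF : IsFreeEnergy F αbar βbar) :
    ContinuousOn (wellGap F αbar βbar) (Icc (sigmaLow F βbar) (sigmaUp F αbar)) :=
  hF.continuousOn_bottomBeta.sub hF.continuousOn_bottomAlpha

theorem hasDerivAt_wellGap (hF : IsFreeEnergy F αbar βbar) {σ : ℝ}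
    (hσ : σ ∈ Ioo (sigmaLow F βbar) (sigmaUp F αbar)) :
    HasDerivAt (wellGap F αbar βbar) (critAlpha F αbar σ - critBeta F βbar σ) σ :=
  ((hF.hasDerivAt_bottomBeta hσ).sub (hF.wellBranch_left.hasDerivAt_bottom hσ)).congr_deriv
    (by ring)

theorem alpha_lt_critBeta (hF : IsFreeEnergy F αbar βbar) {σ : ℝ}
    (hσ : σ ∈ Icc (sigmaLow F βbar) (sigmaUp F αbar)) :
    critAlpha F αbar σ < critBeta F βbar σ :=
  (hF.alpha_mem hσ).2.trans_lt (hF.alpha_lt_beta.trans_le (hF.beta_mem hσ))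

/-- By the envelope formula the derivative is `α_σ - β_σ < 0`. This makes `σ₀` unique and makes `σ`
a function of `π₁ - π₂`. -/
theorem strictAntiOn_wellGap (hF : IsFreeEnergy F αbar βbar) :
    StrictAntiOn (wellGap F αbar βbar) (Icc (sigmaLow F βbar) (sigmaUp F αbar)) := by
  refine strictAntiOn_of_deriv_neg (convex_Icc _ _) hF.continuousOn_wellGap fun σ hσ => ?_
  rw [interior_Icc] at hσ
  rw [(hF.hasDerivAt_wellGap hσ).deriv]
  linarith [hF.alpha_lt_critBeta (Ioo_subset_Icc_self hσ)]

/-- At the lower end `β_σ` and `ζ_σ` merge, so the gap is the full height of the barrier over the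
left bottom. -/
theorem wellGap_low_pos (hF : IsFreeEnergy F αbar βbar) :
    0 < wellGap F αbar βbar (sigmaLow F βbar) := by
  have h := hF.strictMonoOn_gibbs hF.low_mem ⟨le_rfl, hF.alpha_le_zeta hF.low_mem⟩
    ⟨hF.alpha_le_zeta hF.low_mem, le_rfl⟩
    (by rw [hF.zeta_low]; exact (hF.alpha_mem hF.low_mem).2.trans_lt hF.alpha_lt_beta)
  rw [hF.zeta_low] at h
  rw [wellGap, hF.beta_low]
  exact sub_pos.2 h

theorem wellGap_up_neg (hF : IsFreeEnergy F αbar βbar) :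
    wellGap F αbar βbar (sigmaUp F αbar) < 0 := by
  have h := hF.strictAntiOn_gibbs hF.up_mem ⟨le_rfl, hF.zeta_le_beta hF.up_mem⟩
    ⟨hF.zeta_le_beta hF.up_mem, le_rfl⟩
    (by rw [hF.zeta_up]; exact hF.alpha_lt_beta.trans_le (hF.beta_mem hF.up_mem))
  rw [hF.zeta_up] at h
  rw [wellGap, hF.alpha_up]
  exact sub_neg.2 h

theorem surjOn_wellGap (hF : IsFreeEnergy F αbar βbar) :
    SurjOn (wellGap F αbar βbar) (Icc (sigmaLow F βbar) (sigmaUp F αbar))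
      (Icc (wellGap F αbar βbar (sigmaUp F αbar)) (wellGap F αbar βbar (sigmaLow F βbar))) :=
  intermediate_value_Icc' hF.low_lt_up.le hF.continuousOn_wellGap

theorem sigmaZero_spec (hF : IsFreeEnergy F αbar βbar) :
    sigmaZero F αbar βbar ∈ Ioo (sigmaLow F βbar) (sigmaUp F αbar) ∧
      wellGap F αbar βbar (sigmaZero F αbar βbar) = 0 := by
  obtain ⟨σ, hσ, h0⟩ := hF.surjOn_wellGap ⟨hF.wellGap_up_neg.le, hF.wellGap_low_pos.le⟩
  have hlow := hF.wellGap_low_pos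
  have hup := hF.wellGap_up_neg
  have hσ' : σ ∈ Ioo (sigmaLow F βbar) (sigmaUp F αbar) := by
    refine ⟨lt_of_le_of_ne hσ.1 fun h => ?_, lt_of_le_of_ne hσ.2 fun h => ?_⟩
    · rw [h, h0] at hlow; exact hlow.false
    · rw [← h, h0] at hup; exact hup.false
  have := Classical.epsilon_spec (p := fun σ => σ ∈ Ioo (sigmaLow F βbar) (sigmaUp F αbar) ∧
    gibbs F σ (critAlpha F αbar σ) = gibbs F σ (critBeta F βbar σ))
    ⟨σ, hσ', (sub_eq_zero.1 h0).symm⟩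
  exact ⟨this.1, sub_eq_zero.2 this.2.symm⟩

theorem admissible_subset (F : ℝ → ℝ) (αbar βbar : ℝ) :
    admissible F αbar βbar ⊆ lowerRegion F αbar βbar := fun Δ h => by
  obtain ⟨h1, h2, h3⟩ := h
  rw [max_lt_iff] at h2
  exact ⟨h1, h2.1.le, h2.2.le, h3⟩

theorem lowerRegion_subset (F : ℝ → ℝ) (αbar βbar : ℝ) :
    lowerRegion F αbar βbar ⊆ closedRegion F αbar βbar :=
  fun _ h => ⟨Ioo_subset_Icc_self h.1, h.2.1, h.2.2.1, h.2.2.2.le⟩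

theorem isClosed_closedRegion (hF : IsFreeEnergy F αbar βbar) :
    IsClosed (closedRegion F αbar βbar) := by
  have hI : IsClosed {Δ : ℝ × ℝ | Δ.1 ∈ Icc (sigmaLow F βbar) (sigmaUp F αbar)} :=
    isClosed_Icc.preimage continuous_fst
  have h1 : ContinuousOn (fun Δ : ℝ × ℝ => Δ.2 - gibbs F Δ.1 (critAlpha F αbar Δ.1))
      {Δ | Δ.1 ∈ Icc (sigmaLow F βbar) (sigmaUp F αbar)} :=
    continuousOn_snd.sub (hF.continuousOn_bottomAlpha.comp continuousOn_fst fun _ h => h)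
  have h2 : ContinuousOn (fun Δ : ℝ × ℝ => Δ.2 - gibbs F Δ.1 (critBeta F βbar Δ.1))
      {Δ | Δ.1 ∈ Icc (sigmaLow F βbar) (sigmaUp F αbar)} :=
    continuousOn_snd.sub (hF.continuousOn_bottomBeta.comp continuousOn_fst fun _ h => h)
  have h3 : ContinuousOn (fun Δ : ℝ × ℝ => gibbs F Δ.1 (critZeta F αbar βbar Δ.1) - Δ.2)
      {Δ | Δ.1 ∈ Icc (sigmaLow F βbar) (sigmaUp F αbar)} :=
    (hF.continuousOn_top.comp continuousOn_fst fun _ h => h).sub continuousOn_snd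
  have := ((h1.preimage_isClosed_of_isClosed hI isClosed_Ici (t := Ici 0)).inter
    (h2.preimage_isClosed_of_isClosed hI isClosed_Ici (t := Ici 0))).inter
    (h3.preimage_isClosed_of_isClosed hI isClosed_Ici (t := Ici 0))
  convert this using 1
  ext Δ
  simp only [closedRegion, mem_ofPred_eq, mem_inter_iff, mem_preimage, mem_Ici, sub_nonneg]
  tauto

theorem closure_subset (hF : IsFreeEnergy F αbar βbar) :
    closure (admissible F αbar βbar) ⊆ closedRegion F αbar βbar :=
  closure_minimal ((admissible_subset F αbar βbar).trans (lowerRegion_subset F αbar βbar))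
    hF.isClosed_closedRegion

theorem zOne_spec (hF : IsFreeEnergy F αbar βbar) {Δ : ℝ × ℝ}
    (hΔ : Δ ∈ closedRegion F αbar βbar) :
    zOne F αbar βbar Δ ∈ Icc (critAlpha F αbar Δ.1) (critZeta F αbar βbar Δ.1) ∧
      gibbs F Δ.1 (zOne F αbar βbar Δ) = Δ.2 :=
  ⟨Function.invFunOn_mem (hF.exists_zOne hΔ.1 ⟨hΔ.2.1, hΔ.2.2.2⟩),
    Function.invFunOn_eq (hF.exists_zOne hΔ.1 ⟨hΔ.2.1, hΔ.2.2.2⟩)⟩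

theorem zTwo_spec (hF : IsFreeEnergy F αbar βbar) {Δ : ℝ × ℝ}
    (hΔ : Δ ∈ closedRegion F αbar βbar) :
    zTwo F αbar βbar Δ ∈ Icc (critZeta F αbar βbar Δ.1) (critBeta F βbar Δ.1) ∧
      gibbs F Δ.1 (zTwo F αbar βbar Δ) = Δ.2 :=
  ⟨Function.invFunOn_mem (hF.exists_zTwo hΔ.1 ⟨hΔ.2.2.1, hΔ.2.2.2⟩),
    Function.invFunOn_eq (hF.exists_zTwo hΔ.1 ⟨hΔ.2.2.1, hΔ.2.2.2⟩)⟩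

theorem zOne_eq_zeta (hF : IsFreeEnergy F αbar βbar) {Δ : ℝ × ℝ}
    (hΔ : Δ ∈ closedRegion F αbar βbar)
    (h : gibbs F Δ.1 (critZeta F αbar βbar Δ.1) ≤ Δ.2) :
    zOne F αbar βbar Δ = critZeta F αbar βbar Δ.1 := by
  have hs := hF.zOne_spec hΔ
  refine (hF.strictMonoOn_gibbs hΔ.1).injOn hs.1 ⟨hF.alpha_le_zeta hΔ.1, le_rfl⟩ ?_
  rw [hs.2]
  exact le_antisymm hΔ.2.2.2 h

theorem zTwo_eq_zeta (hF : IsFreeEnergy F αbar βbar) {Δ : ℝ × ℝ}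
    (hΔ : Δ ∈ closedRegion F αbar βbar)
    (h : gibbs F Δ.1 (critZeta F αbar βbar Δ.1) ≤ Δ.2) :
    zTwo F αbar βbar Δ = critZeta F αbar βbar Δ.1 := by
  have hs := hF.zTwo_spec hΔ
  refine (hF.strictAntiOn_gibbs hΔ.1).injOn hs.1 ⟨le_rfl, hF.zeta_le_beta hΔ.1⟩ ?_
  rw [hs.2]
  exact le_antisymm hΔ.2.2.2 h

/-- The condition `F''(z₁) > 0` forces `z₁ < αbar`. This excludes the barrier level, where `z₁ = ζ_σ
≥ αbar`, and the upper end of `σ`, where already `α_σ = αbar`. At the lower end `β_σ = ζ_σ`, so only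
the barrier level would be left. -/
theorem regionOne_subset (hF : IsFreeEnergy F αbar βbar) {Δ : ℝ × ℝ}
    (hΔ : Δ ∈ regionOne F αbar βbar) :
    Δ ∈ lowerRegion F αbar βbar ∧ zOne F αbar βbar Δ ∈ Ioo 0 αbar := by
  have hc := hF.closure_subset hΔ.1
  have hs := (hF.zOne_spec hc).1
  have hz := hF.zeta_mem hc.1
  have hlt : zOne F αbar βbar Δ < αbar := by
    by_contra! hle
    exact absurd hΔ.2 (hF.deriv2_nonpos ⟨hle, hs.2.trans hz.2⟩).not_gt
  have hb : Δ.2 < gibbs F Δ.1 (critZeta F αbar βbar Δ.1) := by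
    by_contra! hle
    rw [hF.zOne_eq_zeta hc hle] at hlt
    exact absurd hz.1 hlt.not_ge
  refine ⟨⟨⟨lt_of_le_of_ne hc.1.1 fun h => ?_, lt_of_le_of_ne hc.1.2 fun h => ?_⟩, hc.2.1, hc.2.2.1,
    hb⟩, (hF.alpha_mem hc.1).1.trans_le hs.1, hlt⟩
  · have := hc.2.2.1
    rw [← h] at this hb
    rw [hF.beta_low] at this
    rw [hF.zeta_low] at hb
    linarith
  · have := hs.1
    rw [h, hF.alpha_up] at this
    linarith

theorem regionTwo_subset (hF : IsFreeEnergy F αbar βbar) {Δ : ℝ × ℝ}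
    (hΔ : Δ ∈ regionTwo F αbar βbar) :
    Δ ∈ lowerRegion F αbar βbar ∧ βbar < zTwo F αbar βbar Δ := by
  have hc := hF.closure_subset hΔ.1
  have hs := (hF.zTwo_spec hc).1
  have hz := hF.zeta_mem hc.1
  have hlt : βbar < zTwo F αbar βbar Δ := by
    by_contra! hle
    exact absurd hΔ.2 (hF.deriv2_nonpos ⟨hz.1.trans hs.1, hle⟩).not_gt
  have hb : Δ.2 < gibbs F Δ.1 (critZeta F αbar βbar Δ.1) := by
    by_contra! hle
    rw [hF.zTwo_eq_zeta hc hle] at hlt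
    exact absurd hz.2 hlt.not_ge
  refine ⟨⟨⟨lt_of_le_of_ne hc.1.1 fun h => ?_, lt_of_le_of_ne hc.1.2 fun h => ?_⟩, hc.2.1, hc.2.2.1,
    hb⟩, hlt⟩
  · have := hs.2
    rw [← h, hF.beta_low] at this
    linarith
  · have := hc.2.1
    rw [h] at this hb
    rw [hF.alpha_up] at this
    rw [hF.zeta_up] at hb
    linarith

/-- If `π₂ = 0`, then `b` is the right bottom and lies above the left one, so the gap is
nonnegative; by monotonicity `σ ≤ σ₀`, which places `Δ` on `∂₂Σ`. -/
theorem piTwo_pos (hF : IsFreeEnergy F αbar βbar) {Δ : ℝ × ℝ}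
    (hΔ : Δ ∈ lowerRegion F αbar βbar) (hb : Δ ∉ bdryTwo F αbar βbar) :
    0 < piTwo F βbar Δ := by
  refine lt_of_le_of_ne (sub_nonneg.2 hΔ.2.2.1) fun h => hb ?_
  have he : Δ.2 = gibbs F Δ.1 (critBeta F βbar Δ.1) := sub_eq_zero.1 h.symm
  refine ⟨he, hΔ.1.1, ?_⟩
  rw [← hF.strictAntiOn_wellGap.le_iff_ge (Ioo_subset_Icc_self hF.sigmaZero_spec.1)
    (Ioo_subset_Icc_self hΔ.1), hF.sigmaZero_spec.2]
  exact sub_nonneg.2 (he ▸ hΔ.2.1)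

theorem piOne_pos (hF : IsFreeEnergy F αbar βbar) {Δ : ℝ × ℝ}
    (hΔ : Δ ∈ lowerRegion F αbar βbar) (hb : Δ ∉ bdryOne F αbar βbar) :
    0 < piOne F αbar Δ := by
  refine lt_of_le_of_ne (sub_nonneg.2 hΔ.2.1) fun h => hb ?_
  have he : Δ.2 = gibbs F Δ.1 (critAlpha F αbar Δ.1) := sub_eq_zero.1 h.symm
  refine ⟨he, ?_, hΔ.1.2⟩
  rw [← hF.strictAntiOn_wellGap.le_iff_ge (Ioo_subset_Icc_self hΔ.1)
    (Ioo_subset_Icc_self hF.sigmaZero_spec.1), hF.sigmaZero_spec.2]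
  exact sub_nonpos.2 (he ▸ hΔ.2.2.1)

/-- Measure the barrier from the left bottom when `σ ≥ σ₀` and from the right bottom when `σ ≤ σ₀`.
In both cases the change of tilt subtracts a nonnegative amount, and at `σ₀` the critical points are
extremal on the relevant intervals. -/
theorem barrier_le (hF : IsFreeEnergy F αbar βbar) {Δ : ℝ × ℝ}
    (hΔ : Δ ∈ closedRegion F αbar βbar) :
    gibbs F Δ.1 (critZeta F αbar βbar Δ.1) - Δ.2 ≤
      gibbs F (sigmaZero F αbar βbar) (critZeta F αbar βbar (sigmaZero F αbar βbar)) -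
        gibbs F (sigmaZero F αbar βbar) (critBeta F βbar (sigmaZero F αbar βbar)) := by
  obtain ⟨hσ0, hgap⟩ := hF.sigmaZero_spec
  obtain ⟨σ, b⟩ := Δ
  obtain ⟨hσ, h1, h2, h3⟩ := hΔ
  simp only at *
  generalize sigmaZero F αbar βbar = τ at *
  have hτ := Ioo_subset_Icc_self hσ0
  have hgap' : gibbs F τ (critBeta F βbar τ) = gibbs F τ (critAlpha F αbar τ) := sub_eq_zero.1 hgap
  have hzσ := hF.zeta_mem hσ
  have hzτ := hF.zeta_mem hτ
  have hshift : ∀ x, gibbs F σ x = gibbs F τ x - (σ - τ) * x := fun x => by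
    simp only [gibbs]; ring
  rcases le_total τ σ with h | h
  · have e1 : gibbs F τ (critZeta F αbar βbar σ) ≤ gibbs F τ (critZeta F αbar βbar τ) :=
      (hF.strictMonoOn_gibbs hτ).monotoneOn
        ⟨(hF.alpha_mem hτ).2.trans hzσ.1, (hF.zeta_le_iff hσ hτ).2 h⟩
        ⟨hF.alpha_le_zeta hτ, le_rfl⟩ ((hF.zeta_le_iff hσ hτ).2 h)
    have e2 : gibbs F τ (critAlpha F αbar τ) ≤ gibbs F τ (critAlpha F αbar σ) :=
      (hF.strictMonoOn_gibbs hτ).monotoneOn ⟨le_rfl, hF.alpha_le_zeta hτ⟩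
        ⟨(hF.alpha_le_iff hτ hσ).2 h, (hF.alpha_mem hσ).2.trans hzτ.1⟩
        ((hF.alpha_le_iff hτ hσ).2 h)
    have e3 := mul_nonneg (sub_nonneg.2 h) (sub_nonneg.2 (hF.alpha_le_zeta hσ))
    have e4 := hshift (critZeta F αbar βbar σ)
    have e5 := hshift (critAlpha F αbar σ)
    linarith
  · have e1 : gibbs F τ (critZeta F αbar βbar σ) ≤ gibbs F τ (critZeta F αbar βbar τ) :=
      (hF.strictAntiOn_gibbs hτ).antitoneOn ⟨le_rfl, hF.zeta_le_beta hτ⟩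
        ⟨(hF.zeta_le_iff hτ hσ).2 h, hzσ.2.trans (hF.beta_mem hτ)⟩
        ((hF.zeta_le_iff hτ hσ).2 h)
    have e2 : gibbs F τ (critBeta F βbar τ) ≤ gibbs F τ (critBeta F βbar σ) :=
      (hF.strictAntiOn_gibbs hτ).antitoneOn
        ⟨hzτ.2.trans (hF.beta_mem hσ), (hF.beta_le_iff hσ hτ).2 h⟩
        ⟨hF.zeta_le_beta hτ, le_rfl⟩ ((hF.beta_le_iff hσ hτ).2 h)
    have e3 := mul_nonneg (sub_nonneg.2 h) (sub_nonneg.2 (hF.zeta_le_beta hσ))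
    have e4 := hshift (critZeta F αbar βbar σ)
    have e5 := hshift (critBeta F βbar σ)
    linarith

theorem sq_mul_barrier_lt (hF : IsFreeEnergy F αbar βbar) {ε : ℝ}
    (hε : ε ∈ Ioo 0 (epsMax F αbar βbar)) {Δ : ℝ × ℝ} (hΔ : Δ ∈ closedRegion F αbar βbar) :
    ε ^ 2 * (gibbs F Δ.1 (critZeta F αbar βbar Δ.1) - Δ.2) < 1 := by
  have h1 := hF.barrier_le hΔ
  have h2 := hε.2
  rw [epsMax] at h2
  have hσ := Ioo_subset_Icc_self hF.sigmaZero_spec.1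
  have hpos : 0 < gibbs F (sigmaZero F αbar βbar) (critZeta F αbar βbar (sigmaZero F αbar βbar)) -
      gibbs F (sigmaZero F αbar βbar) (critBeta F βbar (sigmaZero F αbar βbar)) :=
    sub_pos.2 (hF.strictAntiOn_gibbs hσ ⟨le_rfl, hF.zeta_le_beta hσ⟩ ⟨hF.zeta_le_beta hσ, le_rfl⟩
      (by
        have := hF.wellBranch_right.a_lt _ (neg_mem hF.sigmaZero_spec.1)
        simpa using this))
  generalize gibbs F (sigmaZero F αbar βbar) (critZeta F αbar βbar (sigmaZero F αbar βbar)) -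
      gibbs F (sigmaZero F αbar βbar) (critBeta F βbar (sigmaZero F αbar βbar)) = M at *
  have h3 : ε ^ 2 < (M ^ (-(1 / 2) : ℝ)) ^ 2 := pow_lt_pow_left₀ h2 hε.1.le two_ne_zero
  have h4 : (M ^ (-(1 / 2) : ℝ)) ^ 2 = M⁻¹ := by
    rw [← Real.rpow_natCast, ← Real.rpow_mul hpos.le, ← Real.rpow_neg_one]
    norm_num
  rw [h4] at h3
  calc _ ≤ ε ^ 2 * M := by gcongr
    _ < M⁻¹ * M := by gcongr
    _ = 1 := inv_mul_cancel₀ hpos.ne'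

/-- The difference `π₁ - π₂` is the well gap, which determines `σ`; then `π₁` determines `b`. -/
theorem injOn_piMap (hF : IsFreeEnergy F αbar βbar) :
    InjOn (piMap F αbar βbar) (closedRegion F αbar βbar) := by
  rintro ⟨σ, b⟩ h ⟨τ, c⟩ h' he
  obtain ⟨h1, h2⟩ := Prod.mk.inj he
  simp only [piOne, piTwo] at h1 h2
  have : σ = τ := hF.strictAntiOn_wellGap.injOn h.1 h'.1 (by
    simp only [wellGap]
    linarith)
  subst this
  refine Prod.ext rfl ?_
  simp only
  linarith

end IsFreeEnergy

end

/-! ### Splitting the integral into two ends and a middle. -/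

noncomputable section

theorem contDiffAt_intervalIntegral_of_contDiffAt {f : (ℝ × ℝ) × ℝ → ℝ} {a b : ℝ} (hab : a ≤ b)
    {x₀ : ℝ × ℝ} (hx : ∀ v ∈ Icc a b, ContDiffAt ℝ 1 f (x₀, v)) :
    ContDiffAt ℝ 1 (fun x => ∫ v in a..b, f (x, v)) x₀ := by
  have hO : IsOpen {q | ContDiffAt ℝ 1 f q} := by
    rw [isOpen_iff_mem_nhds]
    exact fun q hq => ContDiffAt.eventually hq (by norm_num)
  exact (contDiffAt_intervalIntegral hO (fun q hq => ContDiffAt.contDiffWithinAt hq) hab hx).1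

theorem rpow_neg_half_eq (x : ℝ) : x ^ (-(1 / 2) : ℝ) = 1 / √x := by
  rcases le_or_gt 0 x with h | h
  · rw [Real.rpow_neg h, Real.sqrt_eq_rpow, one_div (x ^ (1 / 2 : ℝ))]
  -- For a negative base both sides are zero by convention: the power contains `cos (π/2)` and the
  -- square root vanishes.
  · rw [Real.rpow_def_of_neg h, Real.sqrt_eq_zero_of_nonpos h.le,
      show (-(1 / 2) : ℝ) * Real.pi = -(Real.pi / 2) by ring, Real.cos_neg, Real.cos_pi_div_two]
    simp

namespace WellBranch

variable {F : ℝ → ℝ} {W V S : Set ℝ} {a ζ : ℝ → ℝ} {z : ℝ × ℝ → ℝ} {g : ℝ → ℝ}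

theorem shift_mem_heightRegion {δ : ℝ} {p : ℝ × ℝ} (hσ : p.1 ∈ S) (h0 : 0 < p.2)
    (htop : gibbs F p.1 (a p.1) + p.2 + δ ^ 2 < gibbs F p.1 (ζ p.1)) {v : ℝ} (hv : v ∈ Icc 0 δ) :
    p + (0, v ^ 2) ∈ heightRegion F S a ζ := by
  have h1 : v ^ 2 ≤ δ ^ 2 := pow_le_pow_left₀ hv.1 hv.2 2
  refine ⟨by simpa using hσ, ?_, ?_⟩
  · simp only [Prod.snd_add]; positivity
  · simp only [Prod.snd_add, Prod.fst_add, add_zero]; linarith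

/-- Chooses the cut level below the barrier and inside the regular range of the kernel. Statements
hold for all small `δ`, so that both ends and the middle can share one value. -/
theorem exists_sq_lt {t ε : ℝ} (ht : 0 < t) :
    ∃ δ₀ : ℝ, 0 < δ₀ ∧ ∀ δ ∈ Ioo 0 δ₀, δ ^ 2 < t ∧ ε ^ 2 * δ ^ 2 ≤ 1 := by
  have h1 : Tendsto (fun δ : ℝ => δ ^ 2) (𝓝 0) (𝓝 0) := by
    have : ContinuousAt (fun δ : ℝ => δ ^ 2) 0 := by fun_prop
    simpa [ContinuousAt] using this
  have h2 : Tendsto (fun δ : ℝ => ε ^ 2 * δ ^ 2) (𝓝 0) (𝓝 0) := by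
    simpa using h1.const_mul (ε ^ 2)
  obtain ⟨r, hr, h⟩ := Metric.eventually_nhds_iff.1
    ((h1.eventually_lt_const ht).and (h2.eventually_lt_const one_pos))
  refine ⟨r, hr, fun δ hδ => ?_⟩
  have := h (y := δ) (by rw [Real.dist_0_eq_abs, abs_of_pos hδ.1]; exact hδ.2)
  exact ⟨this.1, this.2.le⟩

theorem exists_tendsto_branchIntegral (H : WellBranch F W V S a ζ z) (hg : ContDiff ℝ 2 g)
    (ε : ℝ) {p : ℝ × ℝ} (hp : p ∈ heightRegion F S a ζ) :
    ∃ δ₀ : ℝ, 0 < δ₀ ∧ ∀ δ ∈ Ioo 0 δ₀, ∃ y,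
      Tendsto (branchIntegral F a z g ε δ) (𝓝[{p : ℝ × ℝ | 0 < p.2}] p) (𝓝 y) := by
  obtain ⟨δ₀, h0, h⟩ := exists_sq_lt (ε := ε) (sub_pos.2 hp.2.2)
  refine ⟨δ₀, h0, fun δ hδ => ?_⟩
  have h1 := h δ hδ
  have := (H.branchIntegral_contDiffAt hg hδ.1.le h1.2
    (fun v hv => shift_mem_heightRegion hp.1 hp.2.1 (by linarith) hv)).1.continuousAt.tendsto
  exact ⟨_, this.mono_left nhdsWithin_le_nhds⟩

/-- At height zero the limit comes from the Hölder estimate; at positive height every ingredient is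
continuous. -/
theorem exists_tendsto_regularPart_of_mem (H : WellBranch F W V S a ζ z) (hg : ContDiff ℝ 2 g)
    (ε : ℝ) {p : ℝ × ℝ} (hσ : p.1 ∈ S) (h0 : 0 ≤ p.2)
    (htop : gibbs F p.1 (a p.1) + p.2 < gibbs F p.1 (ζ p.1)) (hV : heightBranch F a z p ∈ V) :
    ∃ δ₀ : ℝ, 0 < δ₀ ∧ ∀ δ ∈ Ioo 0 δ₀, ∃ y,
      Tendsto (regularPart F a z g ε δ) (𝓝[{p : ℝ × ℝ | 0 < p.2}] p) (𝓝 y) := by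
  rcases h0.eq_or_lt with h | h
  · obtain ⟨δ₀, hδ₀, hb⟩ := H.exists_regularPart_bounds hg hσ ε
    refine ⟨δ₀, hδ₀, fun δ hδ => ?_⟩
    obtain ⟨C, r, hr, hr2, hC, -, hcd, hbd⟩ := hb δ hδ
    have := exists_tendsto_regularPart hr hr2 hC hcd fun p hp => (hbd p hp).2
    rwa [show p = (p.1, 0) from Prod.ext rfl h.symm]
  · have hp : p ∈ heightRegion F S a ζ := ⟨hσ, h, htop⟩
    obtain ⟨δ₀, hδ₀, hb⟩ := H.exists_tendsto_branchIntegral hg ε hp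
    refine ⟨δ₀, hδ₀, fun δ hδ => ?_⟩
    obtain ⟨y, hy⟩ := hb δ hδ
    have h1 : ContinuousAt (fun p => logCoeff F g (heightBranch F a z p)) p :=
      ContinuousAt.comp (((H.contDiffOn_logCoeff hg).contDiffAt (H.isOpen_V.mem_nhds hV)).continuousAt)
        (H.contDiffOn_heightBranch.contDiffAt (H.isOpen_heightRegion.mem_nhds hp)).continuousAt
    have h2 : ContinuousAt (fun p : ℝ × ℝ => 1 / √2 * logCoeff F g (heightBranch F a z p) *
        Real.log p.2) p :=
      (continuousAt_const.mul h1).mul (continuousAt_snd.log h.ne')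
    exact ⟨_, hy.add (h2.tendsto.mono_left nhdsWithin_le_nhds)⟩

end WellBranch

/-- The integral over the part of the interval where `f_Δ ≥ δ²`. -/
def middleIntegral (F : ℝ → ℝ) (αbar βbar ε : ℝ) (n : ℕ) (δ : ℝ) (Δ : ℝ × ℝ) : ℝ :=
  ∫ x in (zOne F αbar βbar (Δ + (0, δ ^ 2)))..(zTwo F αbar βbar (Δ + (0, δ ^ 2))),
    integrandI F ε n Δ x

/-- The left branch integral, as a function of `(σ, π₁)`. -/
def leftIntegral (F : ℝ → ℝ) (αbar βbar ε : ℝ) (n : ℕ) (δ : ℝ) (p : ℝ × ℝ) : ℝ :=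
  branchIntegral F (critAlpha F αbar) (zOne F αbar βbar) (fun x => x ^ n) ε δ p

/-- The right branch integral, as a function of `(-σ, π₂)`. -/
def rightIntegral (F : ℝ → ℝ) (αbar βbar ε : ℝ) (n : ℕ) (δ : ℝ) (p : ℝ × ℝ) : ℝ :=
  branchIntegral (fun x => F (-x)) (fun s => -critBeta F βbar (-s))
    (fun p => -zTwo F αbar βbar (-p.1, p.2)) (fun x => (-x) ^ n) ε δ p

/-- The left branch integral without its logarithmic singularity. -/
def leftRegular (F : ℝ → ℝ) (αbar βbar ε : ℝ) (n : ℕ) (δ : ℝ) (p : ℝ × ℝ) : ℝ :=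
  regularPart F (critAlpha F αbar) (zOne F αbar βbar) (fun x => x ^ n) ε δ p

/-- The right branch integral without its logarithmic singularity. -/
def rightRegular (F : ℝ → ℝ) (αbar βbar ε : ℝ) (n : ℕ) (δ : ℝ) (p : ℝ × ℝ) : ℝ :=
  regularPart (fun x => F (-x)) (fun s => -critBeta F βbar (-s))
    (fun p => -zTwo F αbar βbar (-p.1, p.2)) (fun x => (-x) ^ n) ε δ p

theorem heightBranch_left (F : ℝ → ℝ) (αbar βbar : ℝ) (Δ : ℝ × ℝ) :
    heightBranch F (critAlpha F αbar) (zOne F αbar βbar) (Δ.1, piOne F αbar Δ) =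
      zOne F αbar βbar Δ := by
  simp [heightBranch, piOne]

theorem heightBranch_right (F : ℝ → ℝ) (αbar βbar : ℝ) (Δ : ℝ × ℝ) :
    heightBranch (fun x => F (-x)) (fun s => -critBeta F βbar (-s))
      (fun p => -zTwo F αbar βbar (-p.1, p.2)) (-Δ.1, piTwo F βbar Δ) = -zTwo F αbar βbar Δ := by
  simp [heightBranch, piTwo, IsFreeEnergy.gibbs_comp_neg]

theorem leftRegular_eq (F : ℝ → ℝ) (αbar βbar ε : ℝ) (n : ℕ) (δ : ℝ) (Δ : ℝ × ℝ) :
    leftRegular F αbar βbar ε n δ (Δ.1, piOne F αbar Δ) =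
      leftIntegral F αbar βbar ε n δ (Δ.1, piOne F αbar Δ) + logTermOne F αbar βbar n Δ := by
  rw [leftRegular, regularPart, heightBranch_left, leftIntegral, logTermOne, coeffOne, logCoeff,
    rpow_neg_half_eq]
  ring

theorem rightRegular_eq (F : ℝ → ℝ) (αbar βbar ε : ℝ) (n : ℕ) (δ : ℝ) (Δ : ℝ × ℝ) :
    rightRegular F αbar βbar ε n δ (-Δ.1, piTwo F βbar Δ) =
      rightIntegral F αbar βbar ε n δ (-Δ.1, piTwo F βbar Δ) + logTermTwo F αbar βbar n Δ := by
  rw [rightRegular, regularPart, heightBranch_right, rightIntegral, logTermTwo, coeffTwo, logCoeff,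
    rpow_neg_half_eq, IsFreeEnergy.deriv2_comp_neg_fun]
  simp only [neg_neg]
  ring

namespace IsFreeEnergy

variable {F : ℝ → ℝ} {αbar βbar ε δ : ℝ} {n : ℕ}

theorem contDiffAt_zOne (hF : IsFreeEnergy F αbar βbar) {Δ : ℝ × ℝ}
    (hσ : Δ.1 ∈ Ioo (sigmaLow F βbar) (sigmaUp F αbar))
    (h1 : gibbs F Δ.1 (critAlpha F αbar Δ.1) < Δ.2)
    (h2 : Δ.2 < gibbs F Δ.1 (critZeta F αbar βbar Δ.1)) :
    ContDiffAt ℝ 1 (zOne F αbar βbar) Δ :=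
  hF.wellBranch_left.contDiffOn_z.contDiffAt
    (hF.wellBranch_left.isOpen_wellRegion.mem_nhds ⟨hσ, h1, h2⟩)

theorem contDiffAt_zTwo (hF : IsFreeEnergy F αbar βbar) {Δ : ℝ × ℝ}
    (hσ : Δ.1 ∈ Ioo (sigmaLow F βbar) (sigmaUp F αbar))
    (h1 : gibbs F Δ.1 (critBeta F βbar Δ.1) < Δ.2)
    (h2 : Δ.2 < gibbs F Δ.1 (critZeta F αbar βbar Δ.1)) :
    ContDiffAt ℝ 1 (zTwo F αbar βbar) Δ := by
  have hmem : (-Δ.1, Δ.2) ∈ wellRegion (fun x => F (-x))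
      (Ioo (-sigmaUp F αbar) (-sigmaLow F βbar)) (fun s => -critBeta F βbar (-s))
      (fun s => -critZeta F αbar βbar (-s)) :=
    ⟨neg_mem hσ, by simpa [gibbs_comp_neg] using h1, by simpa [gibbs_comp_neg] using h2⟩
  have h := (hF.wellBranch_right.contDiffOn_z.contDiffAt
    (hF.wellBranch_right.isOpen_wellRegion.mem_nhds hmem))
  have h' := (h.comp (f := fun p : ℝ × ℝ => (-p.1, p.2)) Δ (by fun_prop)).neg
  refine h'.congr_of_eventuallyEq (Eventually.of_forall fun p => ?_)
  simp

theorem gibbs_between (hF : IsFreeEnergy F αbar βbar) {σ c₁ c₂ b : ℝ}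
    (hσ : σ ∈ Icc (sigmaLow F βbar) (sigmaUp F αbar))
    (hc₁ : c₁ ∈ Icc (critAlpha F αbar σ) (critZeta F αbar βbar σ))
    (hc₂ : c₂ ∈ Icc (critZeta F αbar βbar σ) (critBeta F βbar σ))
    (h1 : gibbs F σ c₁ = b) (h2 : gibbs F σ c₂ = b) {x : ℝ} (hx : x ∈ Icc c₁ c₂) :
    b ≤ gibbs F σ x ∧ gibbs F σ x ≤ gibbs F σ (critZeta F αbar βbar σ) := by
  rcases le_total x (critZeta F αbar βbar σ) with h | h
  · have hx' : x ∈ Icc (critAlpha F αbar σ) (critZeta F αbar βbar σ) := ⟨hc₁.1.trans hx.1, h⟩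
    exact ⟨h1 ▸ (hF.strictMonoOn_gibbs hσ).monotoneOn hc₁ hx' hx.1,
      (hF.strictMonoOn_gibbs hσ).monotoneOn hx' ⟨hF.alpha_le_zeta hσ, le_rfl⟩ h⟩
  · have hx' : x ∈ Icc (critZeta F αbar βbar σ) (critBeta F βbar σ) := ⟨h, hx.2.trans hc₂.2⟩
    exact ⟨h2 ▸ (hF.strictAntiOn_gibbs hσ).antitoneOn hx' hc₂ hx.2,
      (hF.strictAntiOn_gibbs hσ).antitoneOn ⟨le_rfl, hF.zeta_le_beta hσ⟩ hx' h⟩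

theorem shift_mem_closedRegion {Δ : ℝ × ℝ} (hΔ : Δ ∈ lowerRegion F αbar βbar)
    (hδ : Δ.2 + δ ^ 2 < gibbs F Δ.1 (critZeta F αbar βbar Δ.1)) :
    Δ + (0, δ ^ 2) ∈ closedRegion F αbar βbar := by
  have h := sq_nonneg δ
  refine ⟨?_, ?_, ?_, ?_⟩ <;> simp only [Prod.fst_add, Prod.snd_add, add_zero]
  · exact Ioo_subset_Icc_self hΔ.1
  · linarith [hΔ.2.1]
  · linarith [hΔ.2.2.1]
  · exact hδ.le

/-- `f_Δ` stays away from the singularities of the integrand on the middle interval. -/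
theorem middle_spec (hF : IsFreeEnergy F αbar βbar) (hε : ε ∈ Ioo 0 (epsMax F αbar βbar))
    (hδ0 : 0 < δ) {Δ : ℝ × ℝ} (hΔ : Δ ∈ lowerRegion F αbar βbar)
    (hδ : Δ.2 + δ ^ 2 < gibbs F Δ.1 (critZeta F αbar βbar Δ.1)) :
    zOne F αbar βbar (Δ + (0, δ ^ 2)) ≤ zTwo F αbar βbar (Δ + (0, δ ^ 2)) ∧
      ∀ x ∈ Icc (zOne F αbar βbar (Δ + (0, δ ^ 2))) (zTwo F αbar βbar (Δ + (0, δ ^ 2))),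
        0 < x ∧ 0 < fDelta F Δ x ∧ ε ^ 2 * fDelta F Δ x < 2 := by
  have hc := shift_mem_closedRegion hΔ hδ
  have h1 := hF.zOne_spec hc
  have h2 := hF.zTwo_spec hc
  simp only [Prod.fst_add, Prod.snd_add, add_zero] at h1 h2
  have hσ := Ioo_subset_Icc_self hΔ.1
  refine ⟨h1.1.2.trans h2.1.1, fun x hx => ?_⟩
  obtain ⟨b1, b2⟩ := hF.gibbs_between hσ h1.1 h2.1 h1.2 h2.2 hx
  have hε1 := hF.sq_mul_barrier_lt hε (lowerRegion_subset F αbar βbar hΔ)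
  refine ⟨(hF.alpha_mem hσ).1.trans_le (h1.1.1.trans hx.1), ?_, ?_⟩
  · rw [fDelta]
    have : 0 < δ ^ 2 := by positivity
    linarith
  · rw [fDelta]
    have : ε ^ 2 * (gibbs F Δ.1 x - Δ.2) ≤
        ε ^ 2 * (gibbs F Δ.1 (critZeta F αbar βbar Δ.1) - Δ.2) := by gcongr
    linarith

theorem contDiffAt_integrandI (hF : IsFreeEnergy F αbar βbar) {q : (ℝ × ℝ) × ℝ} (h0 : 0 < q.2)
    (h1 : 0 < fDelta F q.1 q.2) (h2 : ε ^ 2 * fDelta F q.1 q.2 < 2) :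
    ContDiffAt ℝ 1 (fun q : (ℝ × ℝ) × ℝ => integrandI F ε n q.1 q.2) q := by
  have hFd : ContDiffAt ℝ 1 (fun q : (ℝ × ℝ) × ℝ => F q.2) q :=
    ((hF.contDiffOn.contDiffAt (Ioi_mem_nhds h0)).of_le (by norm_num)).comp q contDiffAt_snd
  have hf : ContDiffAt ℝ 1 (fun q : (ℝ × ℝ) × ℝ => fDelta F q.1 q.2) q :=
    (hFd.sub (contDiffAt_fst.fst.mul contDiffAt_snd)).sub contDiffAt_fst.snd
  have hpos : 0 < fDelta F q.1 q.2 * (2 - ε ^ 2 * fDelta F q.1 q.2) := mul_pos h1 (by linarith)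
  have hm : ContDiffAt ℝ 1 (fun q : (ℝ × ℝ) × ℝ => q.2 ^ n * (1 - ε ^ 2 * fDelta F q.1 q.2) /
      √(fDelta F q.1 q.2 * (2 - ε ^ 2 * fDelta F q.1 q.2))) q := by
    refine ContDiffAt.div ?_ (ContDiffAt.sqrt (hf.mul (contDiffAt_const.sub
      (contDiffAt_const.mul hf))) hpos.ne') (Real.sqrt_pos.2 hpos).ne'
    exact (contDiffAt_snd.pow n).mul (contDiffAt_const.sub (contDiffAt_const.mul hf))
  -- The identity `x/(y/w) = x w/y` also holds for `w = 0` with division by zero equal to zero, so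
  -- zeros of `1 - ε² f_Δ` need no separate treatment.
  refine hm.congr_of_eventuallyEq (Eventually.of_forall fun q => ?_)
  simp only [integrandI, hPlus, div_div_eq_mul_div]

theorem contDiffAt_middleIntegral (hF : IsFreeEnergy F αbar βbar)
    (hε : ε ∈ Ioo 0 (epsMax F αbar βbar)) (hδ0 : 0 < δ) {Δ : ℝ × ℝ}
    (hΔ : Δ ∈ lowerRegion F αbar βbar)
    (hδ : Δ.2 + δ ^ 2 < gibbs F Δ.1 (critZeta F αbar βbar Δ.1)) :
    ContDiffAt ℝ 1 (middleIntegral F αbar βbar ε n δ) Δ := by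
  obtain ⟨hle, hmid⟩ := hF.middle_spec hε hδ0 hΔ hδ
  have hδ2 : 0 < δ ^ 2 := by positivity
  have hz1 : ContDiffAt ℝ 1 (fun Δ : ℝ × ℝ => zOne F αbar βbar (Δ + (0, δ ^ 2))) Δ := by
    refine ContDiffAt.comp (f := fun Δ : ℝ × ℝ => Δ + ((0 : ℝ), δ ^ 2)) Δ
      (hF.contDiffAt_zOne ?_ ?_ ?_) (by fun_prop) <;>
      simp only [Prod.fst_add, Prod.snd_add, add_zero]
    · exact hΔ.1
    · linarith [hΔ.2.1]
    · exact hδ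
  have hz2 : ContDiffAt ℝ 1 (fun Δ : ℝ × ℝ => zTwo F αbar βbar (Δ + (0, δ ^ 2))) Δ := by
    refine ContDiffAt.comp (f := fun Δ : ℝ × ℝ => Δ + ((0 : ℝ), δ ^ 2)) Δ
      (hF.contDiffAt_zTwo ?_ ?_ ?_) (by fun_prop) <;>
      simp only [Prod.fst_add, Prod.snd_add, add_zero]
    · exact hΔ.1
    · linarith [hΔ.2.2.1]
    · exact hδ
  -- Rescaling affinely to `[0, 1]` moves the dependence of the endpoints into the integrand.
  have key : ContDiffAt ℝ 1 (fun Δ : ℝ × ℝ => ∫ t in (0 : ℝ)..1,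
      integrandI F ε n Δ ((zTwo F αbar βbar (Δ + (0, δ ^ 2)) -
        zOne F αbar βbar (Δ + (0, δ ^ 2))) * t + zOne F αbar βbar (Δ + (0, δ ^ 2)))) Δ := by
    refine contDiffAt_intervalIntegral_of_contDiffAt (f := fun q : (ℝ × ℝ) × ℝ =>
      integrandI F ε n q.1 ((zTwo F αbar βbar (q.1 + (0, δ ^ 2)) -
        zOne F αbar βbar (q.1 + (0, δ ^ 2))) * q.2 + zOne F αbar βbar (q.1 + (0, δ ^ 2))))
      zero_le_one fun t ht => ?_
    have hx : (zTwo F αbar βbar (Δ + (0, δ ^ 2)) - zOne F αbar βbar (Δ + (0, δ ^ 2))) * t +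
        zOne F αbar βbar (Δ + (0, δ ^ 2)) ∈
        Icc (zOne F αbar βbar (Δ + (0, δ ^ 2))) (zTwo F αbar βbar (Δ + (0, δ ^ 2))) := by
      have h0 := ht.1
      have h1 := ht.2
      constructor <;> nlinarith
    obtain ⟨m1, m2, m3⟩ := hmid _ hx
    have e1 : ContDiffAt ℝ 1 (fun q : (ℝ × ℝ) × ℝ => zOne F αbar βbar (q.1 + (0, δ ^ 2)))
        (Δ, t) := hz1.comp (Δ, t) contDiffAt_fst
    have e2 : ContDiffAt ℝ 1 (fun q : (ℝ × ℝ) × ℝ => zTwo F αbar βbar (q.1 + (0, δ ^ 2)))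
        (Δ, t) := hz2.comp (Δ, t) contDiffAt_fst
    exact (hF.contDiffAt_integrandI (q := (Δ, _)) m1 m2 m3).comp
      (f := fun q : (ℝ × ℝ) × ℝ => (q.1, (zTwo F αbar βbar (q.1 + (0, δ ^ 2)) -
        zOne F αbar βbar (q.1 + (0, δ ^ 2))) * q.2 + zOne F αbar βbar (q.1 + (0, δ ^ 2)))) (Δ, t)
      (contDiffAt_fst.prodMk (((e2.sub e1).mul contDiffAt_snd).add e1))
  refine ((hz2.sub hz1).mul key).congr_of_eventuallyEq (Eventually.of_forall fun Δ => ?_)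
  beta_reduce
  rw [intervalIntegral.mul_integral_comp_mul_add, middleIntegral]
  simp

/-- The decomposition of the integral into its left, middle and right parts. -/
theorem integralI_eq (hF : IsFreeEnergy F αbar βbar) (hε : ε ∈ Ioo 0 (epsMax F αbar βbar))
    (hδ0 : 0 < δ) {Δ : ℝ × ℝ} (hΔ : Δ ∈ admissible F αbar βbar)
    (hδ : Δ.2 + δ ^ 2 < gibbs F Δ.1 (critZeta F αbar βbar Δ.1)) :
    IntervalIntegrable (integrandI F ε n Δ) volume (zOne F αbar βbar Δ) (zTwo F αbar βbar Δ) ∧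
      integralI F αbar βbar ε n Δ = leftIntegral F αbar βbar ε n δ (Δ.1, piOne F αbar Δ) +
        middleIntegral F αbar βbar ε n δ Δ +
          rightIntegral F αbar βbar ε n δ (-Δ.1, piTwo F βbar Δ) := by
  have hlow := admissible_subset F αbar βbar hΔ
  obtain ⟨hσ, hmax, -⟩ := hΔ
  rw [max_lt_iff] at hmax
  obtain ⟨hle, hmid⟩ := hF.middle_spec hε hδ0 hlow hδ
  have hεδ : ε ^ 2 * δ ^ 2 ≤ 1 := by
    have h1 := hF.sq_mul_barrier_lt hε (lowerRegion_subset F αbar βbar hlow)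
    have h2 : ε ^ 2 * δ ^ 2 ≤ ε ^ 2 * (gibbs F Δ.1 (critZeta F αbar βbar Δ.1) - Δ.2) := by
      gcongr
      linarith
    linarith
  have hg1 : ContDiff ℝ 2 fun x : ℝ => x ^ n := by fun_prop
  have hg2 : ContDiff ℝ 2 fun x : ℝ => (-x) ^ n := by fun_prop
  obtain ⟨i1, e1⟩ := hF.wellBranch_left.integral_eq_branchIntegral (ε := ε) hg1 hδ0 hεδ
    (p := (Δ.1, piOne F αbar Δ))
    (fun v hv => WellBranch.shift_mem_heightRegion
      (p := (Δ.1, piOne F αbar Δ)) hσ (sub_pos.2 hmax.1)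
      (by simp only [piOne]; linarith) hv)
  obtain ⟨i2, e2⟩ := hF.wellBranch_right.integral_eq_branchIntegral (ε := ε) hg2 hδ0 hεδ
    (p := (-Δ.1, piTwo F βbar Δ))
    (fun v hv => WellBranch.shift_mem_heightRegion
      (p := (-Δ.1, piTwo F βbar Δ)) (neg_mem hσ) (sub_pos.2 hmax.2)
      (by simp only [gibbs_comp_neg, neg_neg, piTwo]; linarith) hv)
  have hs1 : ((Δ.1, piOne F αbar Δ) : ℝ × ℝ) + (0, δ ^ 2) =
      ((Δ + (0, δ ^ 2)).1, piOne F αbar (Δ + (0, δ ^ 2))) := by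
    simp only [piOne, Prod.mk_add_mk, Prod.fst_add, Prod.snd_add, add_zero, Prod.mk.injEq, true_and]
    ring
  have hs2 : ((-Δ.1, piTwo F βbar Δ) : ℝ × ℝ) + (0, δ ^ 2) =
      (-(Δ + (0, δ ^ 2)).1, piTwo F βbar (Δ + (0, δ ^ 2))) := by
    simp only [piTwo, Prod.mk_add_mk, Prod.fst_add, Prod.snd_add, add_zero, Prod.mk.injEq, true_and]
    ring
  have hb1 : gibbs F Δ.1 (critAlpha F αbar Δ.1) + piOne F αbar Δ = Δ.2 := by
    simp only [piOne]; ring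
  have hb2 : gibbs F Δ.1 (critBeta F βbar Δ.1) + piTwo F βbar Δ = Δ.2 := by
    simp only [piTwo]; ring
  rw [hs1, heightBranch_left, heightBranch_left] at i1 e1
  rw [hs2, heightBranch_right, heightBranch_right] at i2 e2
  simp only [hb1] at i1 e1
  simp only [gibbs_comp_neg, neg_neg, hb2] at i2 e2
  change IntervalIntegrable (integrandI F ε n Δ) volume _ _ at i1
  change ∫ x in _.._, integrandI F ε n Δ x = _ at e1
  change IntervalIntegrable (fun x => integrandI F ε n Δ (-x)) volume _ _ at i2
  change ∫ x in _.._, integrandI F ε n Δ (-x) = _ at e2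
  -- Undo the reflection used for the right well.
  have i2' : IntervalIntegrable (integrandI F ε n Δ) volume (zTwo F αbar βbar (Δ + (0, δ ^ 2)))
      (zTwo F αbar βbar Δ) := by
    have := (IntervalIntegrable.iff_comp_neg (by simp)).1 i2
    simp only [neg_neg] at this
    exact this.symm
  have e2' : ∫ x in (zTwo F αbar βbar (Δ + (0, δ ^ 2)))..(zTwo F αbar βbar Δ),
      integrandI F ε n Δ x = rightIntegral F αbar βbar ε n δ (-Δ.1, piTwo F βbar Δ) := by
    rw [rightIntegral, ← e2]
    have := intervalIntegral.integral_comp_neg (f := integrandI F ε n Δ)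
      (a := -zTwo F αbar βbar Δ) (b := -zTwo F αbar βbar (Δ + (0, δ ^ 2)))
    rw [neg_neg, neg_neg] at this
    exact this.symm
  have im : IntervalIntegrable (integrandI F ε n Δ) volume (zOne F αbar βbar (Δ + (0, δ ^ 2)))
      (zTwo F αbar βbar (Δ + (0, δ ^ 2))) := by
    refine ContinuousOn.intervalIntegrable ?_
    rw [uIcc_of_le hle]
    intro x hx
    obtain ⟨m1, m2, m3⟩ := hmid x hx
    have := (hF.contDiffAt_integrandI (n := n) (q := (Δ, x)) m1 m2 m3).continuousAt
    exact (this.comp (f := fun x : ℝ => (Δ, x)) (by fun_prop)).continuousWithinAt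
  refine ⟨(i1.trans im).trans i2', ?_⟩
  rw [integralI, ← intervalIntegral.integral_add_adjacent_intervals
    (i1.trans im) i2', ← intervalIntegral.integral_add_adjacent_intervals i1 im,
    e2', leftIntegral, ← e1, middleIntegral]

end IsFreeEnergy

end

/-! ### Limits at the boundary of `Σ` and continuous extensions. -/

noncomputable section

/-- At a point of `A` the neighbourhoods within `A` contain the point itself, so the limit is
automatically the value and the extension agrees with `G`. -/
theorem continuousOn_extendFrom_of_tendsto {X : Type*} [TopologicalSpace X] {A Ω : Set X}
    {G : X → ℝ} (hΩ : Ω ⊆ closure A) (h : ∀ x ∈ Ω, ∃ y, Tendsto G (𝓝[A] x) (𝓝 y)) :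
    ContinuousOn (extendFrom A G) Ω ∧ ∀ x ∈ Ω ∩ A, G x = extendFrom A G x := by
  refine ⟨continuousOn_extendFrom hΩ h, fun x hx => ?_⟩
  obtain ⟨y, hy⟩ := h x hx.1
  rw [extendFrom_eq (hΩ hx.1) hy]
  exact tendsto_nhds_unique (tendsto_pure_nhds G x) (hy.mono_left (pure_le_nhdsWithin hx.2))

namespace IsFreeEnergy

variable {F : ℝ → ℝ} {αbar βbar ε δ : ℝ} {n : ℕ}

theorem continuousAt_piOne (hF : IsFreeEnergy F αbar βbar) {Δ : ℝ × ℝ}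
    (hσ : Δ.1 ∈ Ioo (sigmaLow F βbar) (sigmaUp F αbar)) : ContinuousAt (piOne F αbar) Δ :=
  continuousAt_snd.sub (ContinuousAt.comp (f := Prod.fst)
    (hF.continuousOn_bottomAlpha.continuousAt (Icc_mem_nhds hσ.1 hσ.2)) continuousAt_fst)

theorem continuousAt_piTwo (hF : IsFreeEnergy F αbar βbar) {Δ : ℝ × ℝ}
    (hσ : Δ.1 ∈ Ioo (sigmaLow F βbar) (sigmaUp F αbar)) : ContinuousAt (piTwo F βbar) Δ :=
  continuousAt_snd.sub (ContinuousAt.comp (f := Prod.fst)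
    (hF.continuousOn_bottomBeta.continuousAt (Icc_mem_nhds hσ.1 hσ.2)) continuousAt_fst)

theorem pi_pos {Δ : ℝ × ℝ} (hΔ : Δ ∈ admissible F αbar βbar) :
    0 < piOne F αbar Δ ∧ 0 < piTwo F βbar Δ := by
  have := max_lt_iff.1 hΔ.2.1
  exact ⟨sub_pos.2 this.1, sub_pos.2 this.2⟩

theorem tendsto_left (hF : IsFreeEnergy F αbar βbar) {Δ : ℝ × ℝ}
    (hσ : Δ.1 ∈ Ioo (sigmaLow F βbar) (sigmaUp F αbar)) :
    Tendsto (fun Δ : ℝ × ℝ => (Δ.1, piOne F αbar Δ)) (𝓝[admissible F αbar βbar] Δ)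
      (𝓝[{p : ℝ × ℝ | 0 < p.2}] (Δ.1, piOne F αbar Δ)) :=
  tendsto_nhdsWithin_iff.2
    ⟨(continuousAt_fst.prodMk (hF.continuousAt_piOne hσ)).tendsto.mono_left nhdsWithin_le_nhds,
      eventually_mem_nhdsWithin.mono fun _ h => (pi_pos h).1⟩

theorem tendsto_right (hF : IsFreeEnergy F αbar βbar) {Δ : ℝ × ℝ}
    (hσ : Δ.1 ∈ Ioo (sigmaLow F βbar) (sigmaUp F αbar)) :
    Tendsto (fun Δ : ℝ × ℝ => (-Δ.1, piTwo F βbar Δ)) (𝓝[admissible F αbar βbar] Δ)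
      (𝓝[{p : ℝ × ℝ | 0 < p.2}] (-Δ.1, piTwo F βbar Δ)) :=
  tendsto_nhdsWithin_iff.2
    ⟨(continuousAt_fst.neg.prodMk
      (hF.continuousAt_piTwo hσ)).tendsto.mono_left nhdsWithin_le_nhds,
      eventually_mem_nhdsWithin.mono fun _ h => (pi_pos h).2⟩

theorem exists_tendsto_leftRegular (hF : IsFreeEnergy F αbar βbar) (ε : ℝ) (n : ℕ) {Δ : ℝ × ℝ}
    (hΔ : Δ ∈ regionOne F αbar βbar) :
    ∃ δ₀ : ℝ, 0 < δ₀ ∧ ∀ δ ∈ Ioo 0 δ₀, ∃ y,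
      Tendsto (fun Δ : ℝ × ℝ => leftIntegral F αbar βbar ε n δ (Δ.1, piOne F αbar Δ) +
        logTermOne F αbar βbar n Δ) (𝓝[admissible F αbar βbar] Δ) (𝓝 y) := by
  obtain ⟨hlow, hz⟩ := hF.regionOne_subset hΔ
  obtain ⟨δ₀, h0, h⟩ := hF.wellBranch_left.exists_tendsto_regularPart_of_mem
    (g := fun x => x ^ n) (by fun_prop) ε (p := (Δ.1, piOne F αbar Δ)) hlow.1
    (sub_nonneg.2 hlow.2.1) (by simpa [piOne] using hlow.2.2.2)
    (by rw [heightBranch_left]; exact hz)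
  refine ⟨δ₀, h0, fun δ hδ => ?_⟩
  obtain ⟨y, hy⟩ := h δ hδ
  exact ⟨y, (hy.comp (hF.tendsto_left hlow.1)).congr
    fun Δ => leftRegular_eq F αbar βbar ε n δ Δ⟩

theorem exists_tendsto_rightRegular (hF : IsFreeEnergy F αbar βbar) (ε : ℝ) (n : ℕ) {Δ : ℝ × ℝ}
    (hΔ : Δ ∈ regionTwo F αbar βbar) :
    ∃ δ₀ : ℝ, 0 < δ₀ ∧ ∀ δ ∈ Ioo 0 δ₀, ∃ y,
      Tendsto (fun Δ : ℝ × ℝ => rightIntegral F αbar βbar ε n δ (-Δ.1, piTwo F βbar Δ) +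
        logTermTwo F αbar βbar n Δ) (𝓝[admissible F αbar βbar] Δ) (𝓝 y) := by
  obtain ⟨hlow, hz⟩ := hF.regionTwo_subset hΔ
  obtain ⟨δ₀, h0, h⟩ := hF.wellBranch_right.exists_tendsto_regularPart_of_mem
    (g := fun x => (-x) ^ n) (by fun_prop) ε (p := (-Δ.1, piTwo F βbar Δ)) (neg_mem hlow.1)
    (sub_nonneg.2 hlow.2.2.1) (by simpa [piTwo, gibbs_comp_neg] using hlow.2.2.2)
    (by rw [heightBranch_right]; exact neg_lt_neg hz)
  refine ⟨δ₀, h0, fun δ hδ => ?_⟩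
  obtain ⟨y, hy⟩ := h δ hδ
  exact ⟨y, (hy.comp (hF.tendsto_right hlow.1)).congr
    fun Δ => rightRegular_eq F αbar βbar ε n δ Δ⟩

theorem exists_tendsto_leftIntegral (hF : IsFreeEnergy F αbar βbar) (ε : ℝ) (n : ℕ) {Δ : ℝ × ℝ}
    (hΔ : Δ ∈ lowerRegion F αbar βbar) (hπ : 0 < piOne F αbar Δ) :
    ∃ δ₀ : ℝ, 0 < δ₀ ∧ ∀ δ ∈ Ioo 0 δ₀, ∃ y,
      Tendsto (fun Δ : ℝ × ℝ => leftIntegral F αbar βbar ε n δ (Δ.1, piOne F αbar Δ))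
        (𝓝[admissible F αbar βbar] Δ) (𝓝 y) := by
  obtain ⟨δ₀, h0, h⟩ := hF.wellBranch_left.exists_tendsto_branchIntegral
    (g := fun x => x ^ n) (by fun_prop) ε (p := (Δ.1, piOne F αbar Δ))
    ⟨hΔ.1, hπ, by simpa [piOne] using hΔ.2.2.2⟩
  refine ⟨δ₀, h0, fun δ hδ => ?_⟩
  obtain ⟨y, hy⟩ := h δ hδ
  exact ⟨y, hy.comp (hF.tendsto_left hΔ.1)⟩

theorem exists_tendsto_rightIntegral (hF : IsFreeEnergy F αbar βbar) (ε : ℝ) (n : ℕ) {Δ : ℝ × ℝ}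
    (hΔ : Δ ∈ lowerRegion F αbar βbar) (hπ : 0 < piTwo F βbar Δ) :
    ∃ δ₀ : ℝ, 0 < δ₀ ∧ ∀ δ ∈ Ioo 0 δ₀, ∃ y,
      Tendsto (fun Δ : ℝ × ℝ => rightIntegral F αbar βbar ε n δ (-Δ.1, piTwo F βbar Δ))
        (𝓝[admissible F αbar βbar] Δ) (𝓝 y) := by
  obtain ⟨δ₀, h0, h⟩ := hF.wellBranch_right.exists_tendsto_branchIntegral
    (g := fun x => (-x) ^ n) (by fun_prop) ε (p := (-Δ.1, piTwo F βbar Δ))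
    ⟨neg_mem hΔ.1, hπ, by simpa [piTwo, gibbs_comp_neg] using hΔ.2.2.2⟩
  refine ⟨δ₀, h0, fun δ hδ => ?_⟩
  obtain ⟨y, hy⟩ := h δ hδ
  exact ⟨y, hy.comp (hF.tendsto_right hΔ.1)⟩

theorem eventually_lt_top (hF : IsFreeEnergy F αbar βbar) {Δ : ℝ × ℝ}
    (hσ : Δ.1 ∈ Ioo (sigmaLow F βbar) (sigmaUp F αbar)) {t : ℝ}
    (h : Δ.2 + t < gibbs F Δ.1 (critZeta F αbar βbar Δ.1)) :
    ∀ᶠ Δ' : ℝ × ℝ in 𝓝 Δ, Δ'.2 + t < gibbs F Δ'.1 (critZeta F αbar βbar Δ'.1) := by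
  have h1 : ContinuousAt (fun Δ : ℝ × ℝ => gibbs F Δ.1 (critZeta F αbar βbar Δ.1)) Δ :=
    ContinuousAt.comp (f := Prod.fst) (g := fun σ => gibbs F σ (critZeta F αbar βbar σ))
      (hF.continuousOn_top.continuousAt (Icc_mem_nhds hσ.1 hσ.2)) continuousAt_fst
  exact (continuousAt_snd.add continuousAt_const).eventually_lt h1 h

/-- Limits of the integral with correction terms follow from those of its end parts. -/
theorem exists_tendsto_integralI (hF : IsFreeEnergy F αbar βbar)
    (hε : ε ∈ Ioo 0 (epsMax F αbar βbar)) {Δ₀ : ℝ × ℝ} (hΔ : Δ₀ ∈ lowerRegion F αbar βbar)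
    {T₁ T₂ : ℝ × ℝ → ℝ}
    (h1 : ∃ δ₀ : ℝ, 0 < δ₀ ∧ ∀ δ ∈ Ioo 0 δ₀, ∃ y,
      Tendsto (fun Δ : ℝ × ℝ => leftIntegral F αbar βbar ε n δ (Δ.1, piOne F αbar Δ) + T₁ Δ)
        (𝓝[admissible F αbar βbar] Δ₀) (𝓝 y))
    (h2 : ∃ δ₀ : ℝ, 0 < δ₀ ∧ ∀ δ ∈ Ioo 0 δ₀, ∃ y,
      Tendsto (fun Δ : ℝ × ℝ => rightIntegral F αbar βbar ε n δ (-Δ.1, piTwo F βbar Δ) + T₂ Δ)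
        (𝓝[admissible F αbar βbar] Δ₀) (𝓝 y)) :
    ∃ y, Tendsto (fun Δ => integralI F αbar βbar ε n Δ + T₁ Δ + T₂ Δ)
      (𝓝[admissible F αbar βbar] Δ₀) (𝓝 y) := by
  obtain ⟨d1, hd1, h1⟩ := h1
  obtain ⟨d2, hd2, h2⟩ := h2
  obtain ⟨d3, hd3, h3⟩ := WellBranch.exists_sq_lt (ε := ε) (sub_pos.2 hΔ.2.2.2)
  -- One cut level admissible for both ends and below the barrier at `Δ₀`, hence also at nearby
  -- points.
  obtain ⟨δ, hδ0, hδ⟩ := exists_between (lt_min (lt_min hd1 hd2) hd3)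
  rw [lt_min_iff, lt_min_iff] at hδ
  obtain ⟨y1, hy1⟩ := h1 δ ⟨hδ0, hδ.1.1⟩
  obtain ⟨y2, hy2⟩ := h2 δ ⟨hδ0, hδ.1.2⟩
  have hlt : Δ₀.2 + δ ^ 2 < gibbs F Δ₀.1 (critZeta F αbar βbar Δ₀.1) := by
    linarith [(h3 δ ⟨hδ0, hδ.2⟩).1]
  have hm := (hF.contDiffAt_middleIntegral (n := n) hε hδ0 hΔ hlt).continuousAt.tendsto.mono_left
    (nhdsWithin_le_nhds (s := admissible F αbar βbar))
  refine ⟨_, ((hy1.add hm).add hy2).congr' ?_⟩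
  filter_upwards [eventually_mem_nhdsWithin,
    nhdsWithin_le_nhds (hF.eventually_lt_top hΔ.1 hlt)] with Δ ha hb
  rw [(hF.integralI_eq hε hδ0 ha hb).2]
  ring

theorem intervalIntegrable_integrandI (hF : IsFreeEnergy F αbar βbar)
    (hε : ε ∈ Ioo 0 (epsMax F αbar βbar)) {Δ : ℝ × ℝ} (hΔ : Δ ∈ admissible F αbar βbar) :
    IntervalIntegrable (integrandI F ε n Δ) volume (zOne F αbar βbar Δ) (zTwo F αbar βbar Δ) := by
  obtain ⟨d, hd, h⟩ := WellBranch.exists_sq_lt (ε := ε) (sub_pos.2 hΔ.2.2)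
  have := (h (d / 2) ⟨by linarith, by linarith⟩).1
  exact (hF.integralI_eq hε (half_pos hd) hΔ (by linarith)).1

theorem exists_extension_one (hF : IsFreeEnergy F αbar βbar)
    (hε : ε ∈ Ioo 0 (epsMax F αbar βbar)) (n : ℕ) {Ω : Set (ℝ × ℝ)}
    (hΩ : Ω ⊆ regionOne F αbar βbar \ bdryTwo F αbar βbar) :
    ∃ Ψ : ℝ × ℝ → ℝ, ContinuousOn Ψ Ω ∧ ∀ Δ ∈ Ω ∩ admissible F αbar βbar,
      integralI F αbar βbar ε n Δ + logTermOne F αbar βbar n Δ = Ψ Δ := by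
  refine ⟨_, continuousOn_extendFrom_of_tendsto (G := fun Δ => integralI F αbar βbar ε n Δ +
    logTermOne F αbar βbar n Δ) (fun Δ h => (hΩ h).1.1) fun Δ h => ?_⟩
  have hlow := (hF.regionOne_subset (hΩ h).1).1
  simpa using hF.exists_tendsto_integralI (n := n) (T₂ := fun _ => 0) hε hlow
    (hF.exists_tendsto_leftRegular ε n (hΩ h).1)
    (by simpa using hF.exists_tendsto_rightIntegral ε n hlow (hF.piTwo_pos hlow (hΩ h).2))

theorem exists_extension_two (hF : IsFreeEnergy F αbar βbar)
    (hε : ε ∈ Ioo 0 (epsMax F αbar βbar)) (n : ℕ) {Ω : Set (ℝ × ℝ)}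
    (hΩ : Ω ⊆ regionTwo F αbar βbar \ bdryOne F αbar βbar) :
    ∃ Ψ : ℝ × ℝ → ℝ, ContinuousOn Ψ Ω ∧ ∀ Δ ∈ Ω ∩ admissible F αbar βbar,
      integralI F αbar βbar ε n Δ + logTermTwo F αbar βbar n Δ = Ψ Δ := by
  refine ⟨_, continuousOn_extendFrom_of_tendsto (G := fun Δ => integralI F αbar βbar ε n Δ +
    logTermTwo F αbar βbar n Δ) (fun Δ h => (hΩ h).1.1) fun Δ h => ?_⟩
  have hlow := (hF.regionTwo_subset (hΩ h).1).1
  simpa using hF.exists_tendsto_integralI (n := n) (T₁ := fun _ => 0) hε hlow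
    (by simpa using hF.exists_tendsto_leftIntegral ε n hlow (hF.piOne_pos hlow (hΩ h).2))
    (hF.exists_tendsto_rightRegular ε n (hΩ h).1)

theorem exists_extension_both (hF : IsFreeEnergy F αbar βbar)
    (hε : ε ∈ Ioo 0 (epsMax F αbar βbar)) (n : ℕ) {Ω : Set (ℝ × ℝ)}
    (hΩ : Ω ⊆ regionOne F αbar βbar ∩ regionTwo F αbar βbar) :
    ∃ Ψ : ℝ × ℝ → ℝ, ContinuousOn Ψ Ω ∧ ∀ Δ ∈ Ω ∩ admissible F αbar βbar,
      integralI F αbar βbar ε n Δ + logTermOne F αbar βbar n Δ + logTermTwo F αbar βbar n Δ =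
        Ψ Δ :=
  ⟨_, continuousOn_extendFrom_of_tendsto (G := fun Δ => integralI F αbar βbar ε n Δ +
    logTermOne F αbar βbar n Δ + logTermTwo F αbar βbar n Δ) (fun _ h => (hΩ h).1.1) fun _ h =>
    hF.exists_tendsto_integralI hε (hF.regionOne_subset (hΩ h).1).1
      (hF.exists_tendsto_leftRegular ε n (hΩ h).1) (hF.exists_tendsto_rightRegular ε n (hΩ h).2)⟩

end IsFreeEnergy

end

/-! ### The coordinates `h = π(Δ)` and derivative bounds in them. -/

noncomputable section

theorem fderiv_comp_prodMk_apply {f u v : ℝ × ℝ → ℝ} {h : ℝ × ℝ}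
    (hf : DifferentiableAt ℝ f (u h, v h)) (hu : DifferentiableAt ℝ u h)
    (hv : DifferentiableAt ℝ v h) (e : ℝ × ℝ) :
    fderiv ℝ (fun h => f (u h, v h)) h e =
      fderiv ℝ u h e * fderiv ℝ f (u h, v h) (1, 0) +
        fderiv ℝ v h e * fderiv ℝ f (u h, v h) (0, 1) := by
  have h1 := hf.hasFDerivAt.comp (f := fun h => (u h, v h)) h
    (hu.hasFDerivAt.prodMk hv.hasFDerivAt)
  have h2 : fderiv ℝ (fun h => f (u h, v h)) h = _ := h1.fderiv
  rw [h2, ContinuousLinearMap.comp_apply, ContinuousLinearMap.prod_apply,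
    show ((fderiv ℝ u h e, fderiv ℝ v h e) : ℝ × ℝ) =
      fderiv ℝ u h e • ((1 : ℝ), (0 : ℝ)) + fderiv ℝ v h e • ((0 : ℝ), (1 : ℝ)) by simp,
    map_add, map_smul, map_smul, smul_eq_mul, smul_eq_mul]

theorem one_le_rpow_neg {x : ℝ} (h0 : 0 < x) (h1 : x ≤ 1) : 1 ≤ x ^ (-(3 / 4) : ℝ) :=
  Real.one_le_rpow_of_pos_of_le_one_of_nonpos h0 h1 (by norm_num)

/-- Bounds for the derivatives of a sum of functions of `(u h, h₁)`, of `h` and of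
`(-u h, h₂)`. -/
theorem differentiableAt_sum_and_bounds {L N R u : ℝ × ℝ → ℝ} {C K : ℝ} {h : ℝ × ℝ}
    (hC : 0 ≤ C) (hK : 0 ≤ K) (h1 : h.1 ∈ Ioc 0 1) (h2 : h.2 ∈ Ioc 0 1)
    (hu : DifferentiableAt ℝ u h) (huK : ‖fderiv ℝ u h‖ ≤ K)
    (hN : DifferentiableAt ℝ N h) (hNK : ‖fderiv ℝ N h‖ ≤ K)
    (hL : DifferentiableAt ℝ L (u h, h.1)) (hR : DifferentiableAt ℝ R (-u h, h.2))
    (hL1 : |fderiv ℝ L (u h, h.1) (1, 0)| ≤ C)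
    (hL2 : |fderiv ℝ L (u h, h.1) (0, 1)| ≤ C * h.1 ^ (-(3 / 4) : ℝ))
    (hR1 : |fderiv ℝ R (-u h, h.2) (1, 0)| ≤ C)
    (hR2 : |fderiv ℝ R (-u h, h.2) (0, 1)| ≤ C * h.2 ^ (-(3 / 4) : ℝ)) :
    DifferentiableAt ℝ (fun h : ℝ × ℝ => L (u h, h.1) + N h + R (-u h, h.2)) h ∧
      |fderiv ℝ (fun h : ℝ × ℝ => L (u h, h.1) + N h + R (-u h, h.2)) h (1, 0)| ≤
        (2 * (K * C) + C + K) * h.1 ^ (-(3 / 4) : ℝ) ∧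
      |fderiv ℝ (fun h : ℝ × ℝ => L (u h, h.1) + N h + R (-u h, h.2)) h (0, 1)| ≤
        (2 * (K * C) + C + K) * h.2 ^ (-(3 / 4) : ℝ) := by
  have dL : DifferentiableAt ℝ (fun h : ℝ × ℝ => L (u h, h.1)) h :=
    hL.comp (f := fun h : ℝ × ℝ => (u h, h.1)) h (hu.prodMk differentiableAt_fst)
  have dR : DifferentiableAt ℝ (fun h : ℝ × ℝ => R (-u h, h.2)) h :=
    hR.comp (f := fun h : ℝ × ℝ => (-u h, h.2)) h (hu.neg.prodMk differentiableAt_snd)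
  have e1 : ‖((1 : ℝ), (0 : ℝ))‖ = 1 := by simp
  have e2 : ‖((0 : ℝ), (1 : ℝ))‖ = 1 := by simp
  have bound : ∀ {f : ℝ × ℝ → ℝ} {e : ℝ × ℝ}, ‖fderiv ℝ f h‖ ≤ K → ‖e‖ = 1 →
      |fderiv ℝ f h e| ≤ K := fun {f e} hf he => by
    have := (fderiv ℝ f h).le_opNorm e
    rw [he, mul_one] at this
    exact this.trans hf
  have split : ∀ e, fderiv ℝ (fun h : ℝ × ℝ => L (u h, h.1) + N h + R (-u h, h.2)) h e =
      (fderiv ℝ u h e * fderiv ℝ L (u h, h.1) (1, 0) + e.1 * fderiv ℝ L (u h, h.1) (0, 1)) +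
        fderiv ℝ N h e +
      (-(fderiv ℝ u h e) * fderiv ℝ R (-u h, h.2) (1, 0) +
        e.2 * fderiv ℝ R (-u h, h.2) (0, 1)) := by
    intro e
    have a1 := fderiv_comp_prodMk_apply (v := Prod.fst) hL hu differentiableAt_fst e
    have a2 := fderiv_comp_prodMk_apply (u := fun h => -u h) (v := Prod.snd) hR hu.neg
      differentiableAt_snd e
    rw [fderiv_fst, ContinuousLinearMap.coe_fst'] at a1
    rw [fderiv_snd, ContinuousLinearMap.coe_snd', fderiv_fun_neg,
      neg_apply] at a2
    have dLN : DifferentiableAt ℝ (fun h : ℝ × ℝ => L (u h, h.1) + N h) h := dL.add hN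
    rw [fderiv_fun_add dLN dR, fderiv_fun_add dL hN, add_apply,
      add_apply, a1, a2]
  have prod : ∀ {x y : ℝ}, |x| ≤ K → |y| ≤ C → |x * y| ≤ K * C := fun hx hy => by
    rw [abs_mul]
    exact mul_le_mul hx hy (abs_nonneg _) hK
  have final : ∀ {X l m x y t : ℝ}, X = l + m + x + y → |l| ≤ K * C → |x| ≤ K * C → |m| ≤ K →
      |y| ≤ C * t → 1 ≤ t → |X| ≤ (2 * (K * C) + C + K) * t := by
    rintro X l m x y t rfl hl hx hm hy ht
    have := abs_add_le (l + m + x) y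
    have := abs_add_le (l + m) x
    have := abs_add_le l m
    have : 0 ≤ (2 * (K * C) + K) * (t - 1) := mul_nonneg (by positivity) (by linarith)
    nlinarith
  refine ⟨(dL.add hN).add dR, ?_, ?_⟩
  · refine final (t := h.1 ^ (-(3 / 4) : ℝ)) ?_ (prod (bound huK e1) hL1)
      (prod (x := -(fderiv ℝ u h (1, 0))) (by rw [abs_neg]; exact bound huK e1) hR1)
      (bound hNK e1) hL2 (one_le_rpow_neg h1.1 h1.2)
    rw [split]
    ring
  · refine final (t := h.2 ^ (-(3 / 4) : ℝ)) ?_ (prod (bound huK e2) hL1)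
      (prod (x := -(fderiv ℝ u h (0, 1))) (by rw [abs_neg]; exact bound huK e2) hR1)
      (bound hNK e2) hR2 (one_le_rpow_neg h2.1 h2.2)
    rw [split]
    ring

/-- Both sides are continuous in the pair `(p, q)`, so the inequality passes to the closure of `N ×ˢ
N`. It is needed at `h = 0`, which is a boundary point. -/
theorem abs_sub_le_norm_rpow_of_mem_closure {ψ : ℝ × ℝ → ℝ} {N : Set (ℝ × ℝ)} {C : ℝ}
    (h : ∀ p ∈ N, ∀ q ∈ N, |ψ p - ψ q| ≤ C * ‖p - q‖ ^ (1 / 4 : ℝ)) {p q : ℝ × ℝ}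
    (hp : p ∈ closure N) (hq : q ∈ closure N) (hpc : ContinuousWithinAt ψ N p)
    (hqc : ContinuousWithinAt ψ N q) : |ψ p - ψ q| ≤ C * ‖p - q‖ ^ (1 / 4 : ℝ) := by
  have hx : (p, q) ∈ closure (N ×ˢ N) := by
    rw [closure_prod_eq]
    exact ⟨hp, hq⟩
  have c1 : ContinuousWithinAt (fun x : (ℝ × ℝ) × (ℝ × ℝ) => ψ x.1) (N ×ˢ N) (p, q) :=
    hpc.comp continuousWithinAt_fst fun x hx => hx.1
  have c2 : ContinuousWithinAt (fun x : (ℝ × ℝ) × (ℝ × ℝ) => ψ x.2) (N ×ˢ N) (p, q) :=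
    hqc.comp continuousWithinAt_snd fun x hx => hx.2
  have c3 : ContinuousWithinAt (fun x : (ℝ × ℝ) × (ℝ × ℝ) => C * ‖x.1 - x.2‖ ^ (1 / 4 : ℝ))
      (N ×ˢ N) (p, q) :=
    continuousWithinAt_const.mul
      ((continuousWithinAt_fst.sub continuousWithinAt_snd).norm.rpow_const (Or.inr (by norm_num)))
  exact ContinuousWithinAt.closure_le hx (c1.sub c2).abs c3 fun x hx => h _ hx.1 _ hx.2

/-- The inverse of `wellGap`. -/
def gapInv (F : ℝ → ℝ) (αbar βbar : ℝ) : ℝ → ℝ :=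
  Function.invFunOn (wellGap F αbar βbar) (Icc (sigmaLow F βbar) (sigmaUp F αbar))

/-- The explicit inverse of the change of variables `π`. -/
def piPoint (F : ℝ → ℝ) (αbar βbar : ℝ) (h : ℝ × ℝ) : ℝ × ℝ :=
  (gapInv F αbar βbar (h.1 - h.2),
    gibbs F (gapInv F αbar βbar (h.1 - h.2)) (critAlpha F αbar (gapInv F αbar βbar (h.1 - h.2))) +
      h.1)

/-- The range of `wellGap`. -/
def gapRange (F : ℝ → ℝ) (αbar βbar : ℝ) : Set ℝ :=
  Ioo (wellGap F αbar βbar (sigmaUp F αbar)) (wellGap F αbar βbar (sigmaLow F βbar))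

namespace IsFreeEnergy

variable {F : ℝ → ℝ} {αbar βbar ε δ : ℝ} {n : ℕ}

theorem gapInv_spec (hF : IsFreeEnergy F αbar βbar) {t : ℝ} (ht : t ∈ gapRange F αbar βbar) :
    gapInv F αbar βbar t ∈ Ioo (sigmaLow F βbar) (sigmaUp F αbar) ∧
      wellGap F αbar βbar (gapInv F αbar βbar t) = t := by
  have hex := hF.surjOn_wellGap (Ioo_subset_Icc_self ht)
  have hm : gapInv F αbar βbar t ∈ Icc (sigmaLow F βbar) (sigmaUp F αbar) :=
    Function.invFunOn_mem hex
  have he : wellGap F αbar βbar (gapInv F αbar βbar t) = t := Function.invFunOn_eq hex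
  refine ⟨⟨lt_of_le_of_ne hm.1 fun h => ?_, lt_of_le_of_ne hm.2 fun h => ?_⟩, he⟩
  · rw [← h] at he
    exact ht.2.ne' he
  · rw [h] at he
    exact ht.1.ne he

theorem continuousOn_gapInv (hF : IsFreeEnergy F αbar βbar) :
    ContinuousOn (gapInv F αbar βbar) (gapRange F αbar βbar) :=
  continuousOn_of_rightInverse_of_isCompact isCompact_Icc hF.continuousOn_wellGap
    hF.strictAntiOn_wellGap.injOn (fun _ ht => Ioo_subset_Icc_self (hF.gapInv_spec ht).1)
    fun _ ht => (hF.gapInv_spec ht).2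

theorem contDiffOn_gapInv (hF : IsFreeEnergy F αbar βbar) :
    ContDiffOn ℝ 1 (gapInv F αbar βbar) (gapRange F αbar βbar) := by
  have hne : ∀ t ∈ gapRange F αbar βbar, critAlpha F αbar (gapInv F αbar βbar t) -
      critBeta F βbar (gapInv F αbar βbar t) ≠ 0 := fun t ht =>
    (sub_neg.2 (hF.alpha_lt_critBeta (Ioo_subset_Icc_self (hF.gapInv_spec ht).1))).ne
  have hd : ∀ t ∈ gapRange F αbar βbar, HasDerivAt (gapInv F αbar βbar)
      (critAlpha F αbar (gapInv F αbar βbar t) - critBeta F βbar (gapInv F αbar βbar t))⁻¹ t := by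
    intro t ht
    refine HasDerivAt.of_local_left_inverse
      (hF.continuousOn_gapInv.continuousAt (isOpen_Ioo.mem_nhds ht))
      (hF.hasDerivAt_wellGap (hF.gapInv_spec ht).1) (hne t ht) ?_
    filter_upwards [isOpen_Ioo.mem_nhds ht] with s hs using (hF.gapInv_spec hs).2
  have hm : MapsTo (gapInv F αbar βbar) (gapRange F αbar βbar)
      (Icc (sigmaLow F βbar) (sigmaUp F αbar)) :=
    fun t ht => Ioo_subset_Icc_self (hF.gapInv_spec ht).1
  have : ContDiffOn ℝ (0 + 1) (gapInv F αbar βbar) (gapRange F αbar βbar) := by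
    rw [gapRange, contDiffOn_succ_iff_deriv_of_isOpen isOpen_Ioo]
    refine ⟨fun t ht => (hd t ht).differentiableAt.differentiableWithinAt, by simp, ?_⟩
    rw [contDiffOn_zero]
    refine ContinuousOn.congr ?_ fun t ht => (hd t ht).deriv
    exact ((hF.continuousOn_alpha.comp hF.continuousOn_gapInv hm).sub
      (hF.continuousOn_beta.comp hF.continuousOn_gapInv hm)).inv₀ hne
  simpa using this

theorem zero_mem_gapRange (hF : IsFreeEnergy F αbar βbar) : (0 : ℝ) ∈ gapRange F αbar βbar :=
  ⟨hF.wellGap_up_neg, hF.wellGap_low_pos⟩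

theorem gapInv_zero (hF : IsFreeEnergy F αbar βbar) :
    gapInv F αbar βbar 0 = sigmaZero F αbar βbar := by
  have h := hF.gapInv_spec hF.zero_mem_gapRange
  exact hF.strictAntiOn_wellGap.injOn (Ioo_subset_Icc_self h.1)
    (Ioo_subset_Icc_self hF.sigmaZero_spec.1) (h.2.trans hF.sigmaZero_spec.2.symm)

theorem contDiffAt_gapInv_sub (hF : IsFreeEnergy F αbar βbar) {h : ℝ × ℝ}
    (hh : h.1 - h.2 ∈ gapRange F αbar βbar) :
    ContDiffAt ℝ 1 (fun h : ℝ × ℝ => gapInv F αbar βbar (h.1 - h.2)) h :=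
  (hF.contDiffOn_gapInv.contDiffAt (isOpen_Ioo.mem_nhds hh)).comp
    (f := fun h : ℝ × ℝ => h.1 - h.2) h (by fun_prop)

theorem contDiffAt_piPoint (hF : IsFreeEnergy F αbar βbar) {h : ℝ × ℝ}
    (hh : h.1 - h.2 ∈ gapRange F αbar βbar) : ContDiffAt ℝ 1 (piPoint F αbar βbar) h := by
  have h1 := hF.contDiffAt_gapInv_sub hh
  have h2 : ContDiffAt ℝ 1 (fun h : ℝ × ℝ => gibbs F (gapInv F αbar βbar (h.1 - h.2))
      (critAlpha F αbar (gapInv F αbar βbar (h.1 - h.2)))) h :=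
    (hF.wellBranch_left.contDiffOn_bottom.contDiffAt
      (isOpen_Ioo.mem_nhds (hF.gapInv_spec hh).1)).comp
      (f := fun h : ℝ × ℝ => gapInv F αbar βbar (h.1 - h.2)) h h1
  exact h1.prodMk (h2.add contDiffAt_fst)

theorem piOne_piPoint (F : ℝ → ℝ) (αbar βbar : ℝ) (h : ℝ × ℝ) :
    piOne F αbar (piPoint F αbar βbar h) = h.1 := by
  simp [piOne, piPoint]

theorem piTwo_piPoint (hF : IsFreeEnergy F αbar βbar) {h : ℝ × ℝ}
    (hh : h.1 - h.2 ∈ gapRange F αbar βbar) : piTwo F βbar (piPoint F αbar βbar h) = h.2 := by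
  have := (hF.gapInv_spec hh).2
  simp only [wellGap] at this
  simp only [piTwo, piPoint]
  linarith

theorem piMap_piPoint (hF : IsFreeEnergy F αbar βbar) {h : ℝ × ℝ}
    (hh : h.1 - h.2 ∈ gapRange F αbar βbar) :
    piMap F αbar βbar (piPoint F αbar βbar h) = h :=
  Prod.ext (piOne_piPoint F αbar βbar h) (hF.piTwo_piPoint hh)

theorem piPoint_mem_admissible (hF : IsFreeEnergy F αbar βbar) {h : ℝ × ℝ}
    (hh : h.1 - h.2 ∈ gapRange F αbar βbar) (h1 : 0 < h.1) (h2 : 0 < h.2)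
    (htop : (piPoint F αbar βbar h).2 <
      gibbs F (piPoint F αbar βbar h).1 (critZeta F αbar βbar (piPoint F αbar βbar h).1)) :
    piPoint F αbar βbar h ∈ admissible F αbar βbar := by
  refine ⟨(hF.gapInv_spec hh).1, max_lt ?_ ?_, htop⟩
  · have := piOne_piPoint F αbar βbar h
    rw [piOne] at this
    linarith
  · have := hF.piTwo_piPoint hh
    rw [piTwo] at this
    linarith

/-- Identifies the chosen inverse with the explicit C¹ one, by injectivity of `π` on the closed
region. -/
theorem piInv_eq_piPoint (hF : IsFreeEnergy F αbar βbar) {h : ℝ × ℝ}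
    (hh : h.1 - h.2 ∈ gapRange F αbar βbar)
    (hm : piPoint F αbar βbar h ∈ closure (admissible F αbar βbar)) :
    piInv F αbar βbar h = piPoint F αbar βbar h := by
  have hex : ∃ Δ ∈ closure (admissible F αbar βbar), piMap F αbar βbar Δ = h :=
    ⟨_, hm, hF.piMap_piPoint hh⟩
  exact hF.injOn_piMap (hF.closure_subset (Function.invFunOn_mem hex)) (hF.closure_subset hm)
    ((Function.invFunOn_eq hex).trans (hF.piMap_piPoint hh).symm)

theorem piPoint_zero (hF : IsFreeEnergy F αbar βbar) :
    piPoint F αbar βbar 0 = maxwellPoint F αbar βbar := by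
  simp [piPoint, maxwellPoint, hF.gapInv_zero]

theorem maxwellPoint_mem_lowerRegion (hF : IsFreeEnergy F αbar βbar) :
    maxwellPoint F αbar βbar ∈ lowerRegion F αbar βbar := by
  obtain ⟨hσ, hgap⟩ := hF.sigmaZero_spec
  have hσ' := Ioo_subset_Icc_self hσ
  exact ⟨hσ, le_rfl, (sub_eq_zero.1 hgap).le, hF.strictMonoOn_gibbs hσ'
    ⟨le_rfl, hF.alpha_le_zeta hσ'⟩ ⟨hF.alpha_le_zeta hσ', le_rfl⟩
    (hF.wellBranch_left.a_lt _ hσ)⟩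

end IsFreeEnergy

end

/-! ### Near regularity at the Maxwell point. -/

noncomputable section

theorem ContDiffAt.eventually_norm_fderiv_le {E G : Type*} [NormedAddCommGroup E]
    [NormedSpace ℝ E] [NormedAddCommGroup G] [NormedSpace ℝ G] {f : E → G} {x : E}
    (h : ContDiffAt ℝ 1 f x) :
    ∀ᶠ y in 𝓝 x, ContDiffAt ℝ 1 f y ∧ ‖fderiv ℝ f y‖ ≤ ‖fderiv ℝ f x‖ + 1 := by
  have hc : ContinuousAt (fderiv ℝ f) x := (h.fderiv_right (m := 0) (by norm_num)).continuousAt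
  exact (h.eventually (by norm_num)).and
    ((hc.norm.eventually_lt_const (lt_add_one _)).mono fun _ h => h.le)

namespace IsFreeEnergy

variable {F : ℝ → ℝ} {αbar βbar ε δ : ℝ} {n : ℕ}

/-- The decomposition of the regularized integral near the Maxwell point, in terms of `h = π(Δ)`. -/
theorem integralI_piPoint_eq (hF : IsFreeEnergy F αbar βbar)
    (hε : ε ∈ Ioo 0 (epsMax F αbar βbar)) (hδ0 : 0 < δ) {h : ℝ × ℝ}
    (hh : h.1 - h.2 ∈ gapRange F αbar βbar)
    (hA : piPoint F αbar βbar h ∈ admissible F αbar βbar)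
    (hδ : (piPoint F αbar βbar h).2 + δ ^ 2 <
      gibbs F (piPoint F αbar βbar h).1 (critZeta F αbar βbar (piPoint F αbar βbar h).1)) :
    integralI F αbar βbar ε n (piPoint F αbar βbar h) +
        logTermOne F αbar βbar n (piPoint F αbar βbar h) +
        logTermTwo F αbar βbar n (piPoint F αbar βbar h) =
      leftRegular F αbar βbar ε n δ (gapInv F αbar βbar (h.1 - h.2), h.1) +
        middleIntegral F αbar βbar ε n δ (piPoint F αbar βbar h) +
        rightRegular F αbar βbar ε n δ (-gapInv F αbar βbar (h.1 - h.2), h.2) := by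
  have e1 := leftRegular_eq F αbar βbar ε n δ (piPoint F αbar βbar h)
  have e2 := rightRegular_eq F αbar βbar ε n δ (piPoint F αbar βbar h)
  have e3 := (hF.integralI_eq (n := n) hε hδ0 hA hδ).2
  rw [piOne_piPoint] at e1 e3
  rw [hF.piTwo_piPoint hh] at e2 e3
  have e4 : (piPoint F αbar βbar h).1 = gapInv F αbar βbar (h.1 - h.2) := rfl
  rw [e4] at e1 e2 e3
  rw [e1, e2, e3]
  ring

/-- In the coordinates `h` the function is the left regular part at `(u h, h₁)`, plus a C¹ function,
plus the right regular part at `(-u h, h₂)`. Each singular derivative is met only along its own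
`h_i`; the other end enters through `u` and contributes a bounded term. -/
theorem nearlyRegular (hF : IsFreeEnergy F αbar βbar) (hε : ε ∈ Ioo 0 (epsMax F αbar βbar))
    {Ω : Set (ℝ × ℝ)} {Ψ : ℝ × ℝ → ℝ} (hΨc : ContinuousOn Ψ Ω)
    (hΨ : ∀ Δ ∈ Ω ∩ admissible F αbar βbar, integralI F αbar βbar ε n Δ +
      logTermOne F αbar βbar n Δ + logTermTwo F αbar βbar n Δ = Ψ Δ)
    (hΩ : Ω ∈ 𝓝[closure (admissible F αbar βbar)] maxwellPoint F αbar βbar) :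
    NearlyRegular (piMap F αbar βbar '' admissible F αbar βbar)
      (fun h => Ψ (piInv F αbar βbar h)) := by
  obtain ⟨hσ, -⟩ := hF.sigmaZero_spec
  have hlow := hF.maxwellPoint_mem_lowerRegion
  obtain ⟨d1, hd1, hl⟩ := hF.wellBranch_left.exists_regularPart_bounds (g := fun x => x ^ n)
    (by fun_prop) hσ ε
  obtain ⟨d2, hd2, hr⟩ := hF.wellBranch_right.exists_regularPart_bounds (g := fun x => (-x) ^ n)
    (by fun_prop) (neg_mem hσ) ε
  obtain ⟨d3, hd3, h3⟩ := WellBranch.exists_sq_lt (ε := ε) (sub_pos.2 hlow.2.2.2)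
  obtain ⟨δ, hδ0, hδ⟩ := exists_between (lt_min (lt_min hd1 hd2) hd3)
  rw [lt_min_iff, lt_min_iff] at hδ
  obtain ⟨C₁, r₁, hr₁, hr₁', hC₁, -, hL, hLb⟩ := hl δ ⟨hδ0, hδ.1.1⟩
  obtain ⟨C₂, r₂, hr₂, hr₂', hC₂, -, hR, hRb⟩ := hr δ ⟨hδ0, hδ.1.2⟩
  have htop : (maxwellPoint F αbar βbar).2 + δ ^ 2 < gibbs F (maxwellPoint F αbar βbar).1
      (critZeta F αbar βbar (maxwellPoint F αbar βbar).1) := by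
    linarith [(h3 δ ⟨hδ0, hδ.2⟩).1]
  change ContDiffOn ℝ 1 (leftRegular F αbar βbar ε n δ) _ at hL
  change ∀ p ∈ _, _ ∧ |fderiv ℝ (leftRegular F αbar βbar ε n δ) p (1, 0)| ≤ _ ∧
    |fderiv ℝ (leftRegular F αbar βbar ε n δ) p (0, 1)| ≤ _ at hLb
  change ContDiffOn ℝ 1 (rightRegular F αbar βbar ε n δ) _ at hR
  change ∀ p ∈ _, _ ∧ |fderiv ℝ (rightRegular F αbar βbar ε n δ) p (1, 0)| ≤ _ ∧
    |fderiv ℝ (rightRegular F αbar βbar ε n δ) p (0, 1)| ≤ _ at hRb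
  have hmid := hF.contDiffAt_middleIntegral (n := n) hε hδ0 hlow htop
  have hevtop := hF.eventually_lt_top hlow.1 htop
  rw [← hF.piPoint_zero] at hmid hevtop hΩ
  have h00 : ((0 : ℝ × ℝ).1 - (0 : ℝ × ℝ).2) ∈ gapRange F αbar βbar := by
    simpa using hF.zero_mem_gapRange
  have hP0 := hF.contDiffAt_piPoint h00
  have hu0 := hF.contDiffAt_gapInv_sub h00
  have hN0 : ContDiffAt ℝ 1 (fun h => middleIntegral F αbar βbar ε n δ (piPoint F αbar βbar h)) 0 :=
    hmid.comp 0 hP0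
  generalize hu : (fun h : ℝ × ℝ => gapInv F αbar βbar (h.1 - h.2)) = u at hu0
  generalize hN : (fun h => middleIntegral F αbar βbar ε n δ (piPoint F αbar βbar h)) = N at hN0
  have hu_apply : ∀ h : ℝ × ℝ, gapInv F αbar βbar (h.1 - h.2) = u h := fun h => congrFun hu h
  have hN_apply : ∀ h, middleIntegral F αbar βbar ε n δ (piPoint F αbar βbar h) = N h :=
    fun h => congrFun hN h
  have hu00 : u 0 = sigmaZero F αbar βbar := by
    rw [← hu_apply]
    simpa using hF.gapInv_zero
  have hev : ∀ᶠ h : ℝ × ℝ in 𝓝 0, h.1 - h.2 ∈ gapRange F αbar βbar ∧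
      (ContDiffAt ℝ 1 u h ∧ ‖fderiv ℝ u h‖ ≤ ‖fderiv ℝ u 0‖ + 1) ∧
      (ContDiffAt ℝ 1 N h ∧ ‖fderiv ℝ N h‖ ≤ ‖fderiv ℝ N 0‖ + 1) ∧
      (piPoint F αbar βbar h).2 + δ ^ 2 < gibbs F (piPoint F αbar βbar h).1
        (critZeta F αbar βbar (piPoint F αbar βbar h).1) ∧
      (piPoint F αbar βbar h ∈ closure (admissible F αbar βbar) → piPoint F αbar βbar h ∈ Ω) ∧
      u h ∈ Ioo (sigmaZero F αbar βbar - r₁) (sigmaZero F αbar βbar + r₁) ∧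
      -u h ∈ Ioo (-sigmaZero F αbar βbar - r₂) (-sigmaZero F αbar βbar + r₂) ∧
      h.1 < r₁ ∧ h.2 < r₂ := by
    have a1 : ∀ᶠ h : ℝ × ℝ in 𝓝 0, h.1 - h.2 ∈ gapRange F αbar βbar :=
      (continuous_fst.sub continuous_snd).continuousAt.eventually (isOpen_Ioo.mem_nhds h00)
    have a2 : ∀ᶠ h in 𝓝 0,
        u h ∈ Ioo (sigmaZero F αbar βbar - r₁) (sigmaZero F αbar βbar + r₁) :=
      hu0.continuousAt.eventually
        (Ioo_mem_nhds (by rw [hu00]; linarith) (by rw [hu00]; linarith))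
    have a3 : ∀ᶠ h in 𝓝 0,
        -u h ∈ Ioo (-sigmaZero F αbar βbar - r₂) (-sigmaZero F αbar βbar + r₂) :=
      hu0.neg.continuousAt.eventually
        (Ioo_mem_nhds (by simp only [hu00]; linarith) (by simp only [hu00]; linarith))
    have a4 : ∀ᶠ h : ℝ × ℝ in 𝓝 0, h.1 < r₁ :=
      continuous_fst.continuousAt.eventually (Iio_mem_nhds hr₁)
    have a5 : ∀ᶠ h : ℝ × ℝ in 𝓝 0, h.2 < r₂ :=
      continuous_snd.continuousAt.eventually (Iio_mem_nhds hr₂)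
    filter_upwards [a1, hu0.eventually_norm_fderiv_le, hN0.eventually_norm_fderiv_le,
      hP0.continuousAt.eventually hevtop,
      hP0.continuousAt.eventually (eventually_nhdsWithin_iff.1 hΩ), a2, a3, a4, a5]
      with h b1 b2 b3 b4 b5 b6 b7 b8 b9 using ⟨b1, b2, b3, b4, b5, b6, b7, b8, b9⟩
  obtain ⟨r, hr0, hball⟩ := Metric.eventually_nhds_iff_ball.1 hev
  have hB : Ioo (0 : ℝ) r ×ˢ Ioo (0 : ℝ) r ⊆ Metric.ball 0 r := by
    rintro ⟨x, y⟩ ⟨hx, hy⟩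
    rw [mem_ball_zero_iff, Prod.norm_mk, max_lt_iff, Real.norm_of_nonneg hx.1.le,
      Real.norm_of_nonneg hy.1.le]
    exact ⟨hx.2, hy.2⟩
  have hBA : ∀ h ∈ Ioo (0 : ℝ) r ×ˢ Ioo (0 : ℝ) r,
      piPoint F αbar βbar h ∈ admissible F αbar βbar := fun h hh => by
    obtain ⟨m1, -, -, m4, -⟩ := hball h (hB hh)
    exact hF.piPoint_mem_admissible m1 hh.1.1 hh.2.1 (by linarith [sq_nonneg δ])
  -- Close to the Maxwell point the barrier constraint is inactive, so the image of `Σ` is locally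
  -- the full open quadrant. In the sup norm the ball cuts out a square, on which slices are
  -- intervals.
  have hUH : Metric.ball 0 r ∩ piMap F αbar βbar '' admissible F αbar βbar =
      Ioo (0 : ℝ) r ×ˢ Ioo (0 : ℝ) r := by
    refine Subset.antisymm ?_ fun h hh =>
      ⟨hB hh, _, hBA h hh, hF.piMap_piPoint (hball h (hB hh)).1⟩
    rintro _ ⟨hn, Δ, hΔ, rfl⟩
    have hp := pi_pos hΔ
    rw [mem_ball_zero_iff, Prod.norm_def, max_lt_iff] at hn
    exact ⟨⟨hp.1, (le_abs_self _).trans_lt hn.1⟩, hp.2, (le_abs_self _).trans_lt hn.2⟩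
  have hcl : ∀ h ∈ Metric.ball 0 r ∩ closure (piMap F αbar βbar '' admissible F αbar βbar),
      h ∈ closure (Ioo (0 : ℝ) r ×ˢ Ioo (0 : ℝ) r) := fun h hh =>
    hUH ▸ Metric.isOpen_ball.inter_closure hh
  have hPc : ContinuousOn (piPoint F αbar βbar) (Metric.ball 0 r) := fun h hh =>
    (hF.contDiffAt_piPoint (hball h hh).1).continuousAt.continuousWithinAt
  have hmem : ∀ h ∈ Metric.ball 0 r ∩ closure (piMap F αbar βbar '' admissible F αbar βbar),
      piPoint F αbar βbar h ∈ closure (admissible F αbar βbar) := fun h hh =>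
    ((hPc h hh.1).mono hB).mem_closure (hcl h hh) hBA
  have hψ : ∀ h ∈ Metric.ball 0 r ∩ closure (piMap F αbar βbar '' admissible F αbar βbar),
      Ψ (piInv F αbar βbar h) = Ψ (piPoint F αbar βbar h) := fun h hh => by
    rw [hF.piInv_eq_piPoint (hball h hh.1).1 (hmem h hh)]
  have hcont : ContinuousOn (fun h => Ψ (piInv F αbar βbar h))
      (Metric.ball 0 r ∩ closure (piMap F αbar βbar '' admissible F αbar βbar)) :=
    (hΨc.comp (hPc.mono inter_subset_left) fun h hh =>
      (hball h hh.1).2.2.2.2.1 (hmem h hh)).congr hψ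
  have hBU : Ioo (0 : ℝ) r ×ˢ Ioo (0 : ℝ) r ⊆
      Metric.ball 0 r ∩ closure (piMap F αbar βbar '' admissible F αbar βbar) :=
    hUH ▸ inter_subset_inter_right _ subset_closure
  have h0mem : (0 : ℝ × ℝ) ∈
      Metric.ball 0 r ∩ closure (piMap F αbar βbar '' admissible F αbar βbar) := by
    refine ⟨Metric.mem_ball_self hr0, closure_mono (hUH ▸ inter_subset_right) ?_⟩
    rw [closure_prod_eq, closure_Ioo hr0.ne]
    exact ⟨⟨le_rfl, hr0.le⟩, le_rfl, hr0.le⟩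
  have hG : ∀ h ∈ Ioo (0 : ℝ) r ×ˢ Ioo (0 : ℝ) r, Ψ (piInv F αbar βbar h) =
      leftRegular F αbar βbar ε n δ (u h, h.1) + N h +
        rightRegular F αbar βbar ε n δ (-u h, h.2) := fun h hh => by
    obtain ⟨m1, -, -, m4, m5, -⟩ := hball h (hB hh)
    rw [hψ h (hBU hh), ← hΨ _ ⟨m5 (subset_closure (hBA h hh)), hBA h hh⟩,
      hF.integralI_piPoint_eq hε hδ0 m1 (hBA h hh) m4, hu_apply, hN_apply]
  have hbox1 : ∀ h ∈ Ioo (0 : ℝ) r ×ˢ Ioo (0 : ℝ) r, (u h, h.1) ∈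
      Ioo (sigmaZero F αbar βbar - r₁) (sigmaZero F αbar βbar + r₁) ×ˢ Ioo 0 r₁ := fun h hh => by
    obtain ⟨-, -, -, -, -, m6, -, m8, -⟩ := hball h (hB hh)
    exact ⟨m6, hh.1.1, m8⟩
  have hbox2 : ∀ h ∈ Ioo (0 : ℝ) r ×ˢ Ioo (0 : ℝ) r, (-u h, h.2) ∈
      Ioo (-sigmaZero F αbar βbar - r₂) (-sigmaZero F αbar βbar + r₂) ×ˢ Ioo 0 r₂ := fun h hh => by
    obtain ⟨-, -, -, -, -, -, m7, -, m9⟩ := hball h (hB hh)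
    exact ⟨m7, hh.2.1, m9⟩
  have hopen : IsOpen (Ioo (0 : ℝ) r ×ˢ Ioo (0 : ℝ) r) := isOpen_Ioo.prod isOpen_Ioo
  have hGcd : ContDiffOn ℝ 1 (fun h => Ψ (piInv F αbar βbar h))
      (Ioo (0 : ℝ) r ×ˢ Ioo (0 : ℝ) r) := by
    refine ContDiffOn.congr (fun h hh => ContDiffAt.contDiffWithinAt ?_) hG
    obtain ⟨-, m2, m3, -⟩ := hball h (hB hh)
    have a1 : ContDiffAt ℝ 1 (fun h : ℝ × ℝ => leftRegular F αbar βbar ε n δ (u h, h.1)) h :=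
      (hL.contDiffAt ((isOpen_Ioo.prod isOpen_Ioo).mem_nhds (hbox1 h hh))).comp
        (f := fun h : ℝ × ℝ => (u h, h.1)) h (m2.1.prodMk contDiffAt_fst)
    have a2 : ContDiffAt ℝ 1 (fun h : ℝ × ℝ => rightRegular F αbar βbar ε n δ (-u h, h.2)) h :=
      (hR.contDiffAt ((isOpen_Ioo.prod isOpen_Ioo).mem_nhds (hbox2 h hh))).comp
        (f := fun h : ℝ × ℝ => (-u h, h.2)) h (m2.1.neg.prodMk contDiffAt_snd)
    exact (a1.add m3.1).add a2
  obtain ⟨K, hK0, hK⟩ : ∃ K : ℝ, 0 ≤ K ∧ ∀ h ∈ Ioo (0 : ℝ) r ×ˢ Ioo (0 : ℝ) r,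
      |fderiv ℝ (fun h => Ψ (piInv F αbar βbar h)) h (1, 0)| ≤ K * h.1 ^ (-(3 / 4) : ℝ) ∧
      |fderiv ℝ (fun h => Ψ (piInv F αbar βbar h)) h (0, 1)| ≤ K * h.2 ^ (-(3 / 4) : ℝ) := by
    obtain ⟨C, hC, hC₁', hC₂'⟩ : ∃ C : ℝ, 0 ≤ C ∧ C₁ ≤ C ∧ C₂ ≤ C :=
      ⟨max C₁ C₂, hC₁.trans (le_max_left _ _), le_max_left _ _, le_max_right _ _⟩
    obtain ⟨M, hM, hM₁, hM₂⟩ : ∃ M : ℝ, 0 ≤ M ∧ ‖fderiv ℝ u 0‖ + 1 ≤ M ∧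
        ‖fderiv ℝ N 0‖ + 1 ≤ M :=
      ⟨max _ _, (by positivity : 0 ≤ ‖fderiv ℝ u 0‖ + 1).trans (le_max_left _ _), le_max_left _ _,
        le_max_right _ _⟩
    refine ⟨2 * (M * C) + C + M, by positivity, fun h hh => ?_⟩
    obtain ⟨-, m2, m3, -, -, -, -, m8, m9⟩ := hball h (hB hh)
    have b1 := (hLb _ (hbox1 h hh)).2
    have b2 := (hRb _ (hbox2 h hh)).2
    have p1 : 0 ≤ h.1 ^ (-(3 / 4) : ℝ) := Real.rpow_nonneg hh.1.1.le _
    have p2 : 0 ≤ h.2 ^ (-(3 / 4) : ℝ) := Real.rpow_nonneg hh.2.1.le _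
    have key := (differentiableAt_sum_and_bounds (L := leftRegular F αbar βbar ε n δ)
      (R := rightRegular F αbar βbar ε n δ) hC hM ⟨hh.1.1, by linarith⟩ ⟨hh.2.1, by linarith⟩
      (m2.1.differentiableAt one_ne_zero) (m2.2.trans hM₁) (m3.1.differentiableAt one_ne_zero)
      (m3.2.trans hM₂)
      ((hL.contDiffAt ((isOpen_Ioo.prod isOpen_Ioo).mem_nhds (hbox1 h hh))).differentiableAt
        one_ne_zero)
      ((hR.contDiffAt ((isOpen_Ioo.prod isOpen_Ioo).mem_nhds (hbox2 h hh))).differentiableAt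
        one_ne_zero)
      (b1.1.trans hC₁') (b1.2.trans (mul_le_mul_of_nonneg_right hC₁' p1))
      (b2.1.trans hC₂') (b2.2.trans (mul_le_mul_of_nonneg_right hC₂' p2))).2
    rwa [Filter.EventuallyEq.fderiv_eq (eventually_of_mem (hopen.mem_nhds hh) hG)]
  -- The Hölder bound on the open square extends by continuity to its closure, in particular to the
  -- pair `(h, 0)`.
  have hbound : ∀ h ∈ Metric.ball 0 r ∩ closure (piMap F αbar βbar '' admissible F αbar βbar),
      |Ψ (piInv F αbar βbar h) - Ψ (piInv F αbar βbar 0)| ≤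
        2 * (4 * K) * ‖h‖ ^ (1 / 4 : ℝ) := fun h hh => by
    have := abs_sub_le_norm_rpow_of_mem_closure (abs_sub_le_of_fderiv_le_quadrant hK0
      (fun h hh => (hGcd.contDiffAt (hopen.mem_nhds hh)).differentiableAt one_ne_zero)
      (fun h hh => (hK h hh).1) (fun h hh => (hK h hh).2)) (hcl h hh) (hcl 0 h0mem)
      ((hcont h hh).mono hBU) ((hcont 0 h0mem).mono hBU)
    rwa [sub_zero] at this
  have hUnhds : Metric.ball (0 : ℝ × ℝ) r ∈ 𝓝 0 := Metric.ball_mem_nhds 0 hr0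
  have hevH : ∀ᶠ h in 𝓝[piMap F αbar βbar '' admissible F αbar βbar] (0 : ℝ × ℝ),
      h ∈ Ioo (0 : ℝ) r ×ˢ Ioo (0 : ℝ) r := by
    filter_upwards [eventually_mem_nhdsWithin, nhdsWithin_le_nhds hUnhds] with h h1 h2
    exact hUH ▸ ⟨h2, h1⟩
  -- The choice `s = 3/4` matches the derivative bounds, and `1 - s = 1/4` is the Hölder exponent
  -- they imply.
  refine ⟨Metric.ball 0 r, Metric.isOpen_ball, Metric.mem_ball_self hr0, 3 / 4, by norm_num,
    hcont, by rw [hUH]; exact hGcd, ?_, ?_, ?_⟩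
  · refine IsBigO.of_bound (2 * (4 * K)) ?_
    filter_upwards [eventually_mem_nhdsWithin, nhdsWithin_le_nhds hUnhds] with h h1 h2
    rw [Real.norm_eq_abs, Real.norm_of_nonneg (by positivity),
      show (1 - 3 / 4 : ℝ) = 1 / 4 by norm_num]
    exact hbound h ⟨h2, h1⟩
  · refine IsBigO.of_bound K (hevH.mono fun h hh => ?_)
    rw [Real.norm_eq_abs, Real.norm_of_nonneg (Real.rpow_nonneg hh.1.1.le _)]
    exact (hK h hh).1
  · refine IsBigO.of_bound K (hevH.mono fun h hh => ?_)
    rw [Real.norm_eq_abs, Real.norm_of_nonneg (Real.rpow_nonneg hh.2.1.le _)]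
    exact (hK h hh).2

end IsFreeEnergy

end

theorem proposition4p1 (F : ℝ → ℝ) (αbar βbar : ℝ) (hF : IsFreeEnergy F αbar βbar)
    (ε : ℝ) (hε : ε ∈ Set.Ioo 0 (epsMax F αbar βbar)) (n : ℕ) (hn : n = 0 ∨ n = 1) :
    (∀ Δ ∈ admissible F αbar βbar,
      IntervalIntegrable (integrandI F ε n Δ) MeasureTheory.volume
        (zOne F αbar βbar Δ) (zTwo F αbar βbar Δ)) ∧
    (∀ Ω₁ : Set (ℝ × ℝ), IsClosed Ω₁ →
      Ω₁ ⊆ regionOne F αbar βbar \ bdryTwo F αbar βbar →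
      ∃ Ψ : ℝ × ℝ → ℝ, ContinuousOn Ψ Ω₁ ∧
        ∀ Δ ∈ Ω₁ ∩ admissible F αbar βbar,
          integralI F αbar βbar ε n Δ + logTermOne F αbar βbar n Δ = Ψ Δ) ∧
    (∀ Ω₂ : Set (ℝ × ℝ), IsClosed Ω₂ →
      Ω₂ ⊆ regionTwo F αbar βbar \ bdryOne F αbar βbar →
      ∃ Ψ : ℝ × ℝ → ℝ, ContinuousOn Ψ Ω₂ ∧
        ∀ Δ ∈ Ω₂ ∩ admissible F αbar βbar,
          integralI F αbar βbar ε n Δ + logTermTwo F αbar βbar n Δ = Ψ Δ) ∧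
    (∀ Ω₀ : Set (ℝ × ℝ), IsClosed Ω₀ →
      Ω₀ ⊆ regionOne F αbar βbar ∩ regionTwo F αbar βbar →
      ∃ Ψ : ℝ × ℝ → ℝ, ContinuousOn Ψ Ω₀ ∧
        (∀ Δ ∈ Ω₀ ∩ admissible F αbar βbar,
          integralI F αbar βbar ε n Δ + logTermOne F αbar βbar n Δ
            + logTermTwo F αbar βbar n Δ = Ψ Δ) ∧
        (Ω₀ ∈ nhdsWithin (maxwellPoint F αbar βbar) (closure (admissible F αbar βbar)) →
          MemNR F αbar βbar Ω₀ Ψ)) := by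
  refine ⟨fun Δ hΔ => hF.intervalIntegrable_integrandI hε hΔ,
    fun Ω _ hΩ => hF.exists_extension_one hε n hΩ,
    fun Ω _ hΩ => hF.exists_extension_two hε n hΩ, fun Ω _ hΩ => ?_⟩
  obtain ⟨Ψ, hc, he⟩ := hF.exists_extension_both hε n hΩ
  exact ⟨Ψ, hc, he, fun hΩ₀ => ⟨hc, hF.nearlyRegular hε hc he hΩ₀⟩⟩
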